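/- Let $N\ge 1$ be a square-free integer with $r$ prime factors, let $\sigma(N)$ be the sum of the positive divisors of $N$, and let $$\Gamma_0(N)^+=\left\{e^{-1/2}\begin{pmatrix}a&b\\c&d\end{pmatrix}\in SL(2,\mathbb R):\ a,b,c,d,e\in\mathbb Z,\ ad-bc=e>0,\ e\mid N,\ e\mid a,\ e\mid d,\ N\mid c\right\}.$$ Let $X_N=\overline{\Gamma_0(N)^+}\backslash\mathbb H$, where $\overline{\Gamma_0(N)^+}=\Gamma_0(N)^+/\{\pm \mathrm{Id}\}$; a cusp form on $X_N$ is a cusp form for $\Gamma_0(N)^+$, and such a form vanishes only at the cusp if it has no zero in the upper half-plane $\mathbb H$. Put $$k_N=\operatorname{lcm}\Big(4,\ 2^{r-1}\frac{24}{\gcd(24,\sigma(N))}\Big),\qquad \ell_N=2^{1-r}k_N .$$ Then $\ell_N$ is a positive integer, and the function $$\Delta_N(z)=\Big(\prod_{v\mid N}\eta(vz)\Big)^{\ell_N},\qquad \eta(z)=e^{2\pi i z/24}\prod_{n\ge1}\big(1-e^{2\pi i n z}\big),$$ is the smallest-weight cusp form on $X_N$ vanishing only at the cusp: $\Delta_N$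 is a cusp form of weight $k_N$ on $X_N$ with no zero in $\mathbb H$; every cusp form on $X_N$, of any integral weight $k$, that has no zero in $\mathbb H$ satisfies $k\ge k_N$; and every such form of weight $k_N$ is a constant multiple of $\Delta_N$. Moreover, the order of vanishing of $\Delta_N$ at $i\infty$, that is, the least $n$ with non-zero coefficient of $q^n$, $q=e^{2\pi i z}$, in its $q$-expansion, is $$v_{i\infty}(\Delta_N)=\frac{\sigma(N)\,\ell_N}{24}=k_N\cdot\frac{\sigma(N)}{24\cdot 2^{r-1}} .$$ -/

import Mathlib

open scoped MatrixGroups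

open UpperHalfPlane

noncomputable section

/-- The group `Γ₀(N)⁺ ⊆ SL(2, ℝ)` of all matrices `e^{-1/2} (a b; c d)` with `a, b, c, d, e`
integers, `ad - bc = e`, `e > 0`, `e ∣ N`, `e ∣ a`, `e ∣ d` and `N ∣ c`. -/
def Gamma0Plus (N : ℕ) : Subgroup SL(2, ℝ) where
  carrier := {γ | ∃ a b c d e : ℤ, 0 < e ∧ a * d - b * c = e ∧
    e ∣ (N : ℤ) ∧ e ∣ a ∧ e ∣ d ∧ (N : ℤ) ∣ c ∧
    (γ : Matrix (Fin 2) (Fin 2) ℝ) =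
      (Real.sqrt (e : ℝ))⁻¹ • !![(a : ℝ), (b : ℝ); (c : ℝ), (d : ℝ)]}
  one_mem' := ⟨1, 0, 0, 1, 1, by norm_num, by norm_num, one_dvd _, one_dvd _, one_dvd _,
    dvd_zero _, by
      ext i j
      fin_cases i <;> fin_cases j <;> simp⟩
  inv_mem' := by
    rintro γ ⟨a, b, c, d, e, he, hdet, heN, hea, hed, hNc, hγ⟩
    refine ⟨d, -b, -c, a, e, he, by linarith, heN, hed, hea, (dvd_neg).2 hNc, ?_⟩
    rw [Matrix.SpecialLinearGroup.coe_inv, hγ, Matrix.adjugate_fin_two]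
    ext i j
    fin_cases i <;> fin_cases j <;> simp
  mul_mem' := by
    rintro γ δ ⟨a, b, c, d, e, he, hdet, heN, ⟨a', rfl⟩, ⟨d', rfl⟩, hNc, hγ⟩
      ⟨p, q, r, s, f, hf, hdet', hfN, ⟨p', rfl⟩, ⟨s', rfl⟩, hNr, hδ⟩
    obtain ⟨g, e', f', hg, hcop, rfl, rfl⟩ : ∃ g e' f' : ℤ, 0 < g ∧ IsCoprime e' f' ∧
        e = g * e' ∧ f = g * f' := by
      have hpos : 0 < Int.gcd e f := Int.gcd_pos_of_ne_zero_left _ he.ne'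
      obtain ⟨e', f', h, h1, h2⟩ := Int.exists_gcd_one hpos
      exact ⟨Int.gcd e f, e', f', by exact_mod_cast hpos, Int.isCoprime_iff_gcd_eq_one.2 h,
        by rw [mul_comm]; exact h1, by rw [mul_comm]; exact h2⟩
    have he' : 0 < e' := pos_of_mul_pos_right he hg.le
    have hf' : 0 < f' := pos_of_mul_pos_right hf hg.le
    have hlcm : g * e' * f' ∣ (N : ℤ) := by
      obtain ⟨M, hM⟩ := (dvd_mul_right g e').trans heN
      rw [hM] at heN hfN ⊢
      rw [mul_assoc]
      exact mul_dvd_mul_left g (hcop.mul_dvd ((mul_dvd_mul_iff_left hg.ne').1 heN)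
        ((mul_dvd_mul_iff_left hg.ne').1 hfN))
    obtain ⟨M, hM⟩ := hlcm
    obtain ⟨c', rfl⟩ := hNc
    obtain ⟨r', rfl⟩ := hNr
    rw [hM] at hdet hdet' hγ hδ ⊢
    refine ⟨e' * f' * (g * a' * p' + M * b * r'), e' * a' * q + f' * b * s',
      g * e' * f' * M * (c' * f' * p' + e' * d' * r'),
      e' * f' * (M * c' * q + g * d' * s'), e' * f', mul_pos he' hf', ?_,
      ⟨g * M, by ring⟩, ⟨_, rfl⟩, ⟨_, rfl⟩, ⟨_, rfl⟩, ?_⟩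
    · have hgg : g * g ≠ 0 := (mul_pos hg hg).ne'
      refine mul_left_cancel₀ hgg ?_
      linear_combination (g * f' * p' * (g * f' * s') - q * (g * e' * f' * M * r')) * hdet +
        g * e' * hdet'
    · have hgR : (0 : ℝ) < g := by exact_mod_cast hg
      have heR : (0 : ℝ) < e' := by exact_mod_cast he'
      have hfR : (0 : ℝ) < f' := by exact_mod_cast hf'
      have hs : (Real.sqrt ((g * e' : ℤ) : ℝ))⁻¹ * (Real.sqrt ((g * f' : ℤ) : ℝ))⁻¹ * g =
          (Real.sqrt ((e' * f' : ℤ) : ℝ))⁻¹ := by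
        push_cast
        rw [Real.sqrt_mul hgR.le, Real.sqrt_mul hgR.le, Real.sqrt_mul heR.le]
        have h1 := Real.mul_self_sqrt hgR.le
        have := (Real.sqrt_pos.2 hgR).ne'
        have := (Real.sqrt_pos.2 heR).ne'
        have := (Real.sqrt_pos.2 hfR).ne'
        field_simp
        nlinarith
      rw [Matrix.SpecialLinearGroup.coe_mul, hγ, hδ, ← hs, Matrix.smul_mul, Matrix.mul_smul,
        smul_smul]
      ext i j
      fin_cases i <;> fin_cases j <;> simp <;> ring

/-- `Γ₀(N)⁺` as a subgroup of `GL(2, ℝ)`, the ambient group of modular and cusp forms. -/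
abbrev Gamma0PlusGL (N : ℕ) : Subgroup (GL (Fin 2) ℝ) :=
  (Gamma0Plus N).map Matrix.SpecialLinearGroup.toGL

/-- `k_N = lcm(4, 2^{r-1} · 24 / (24, σ(N)))`, with `r` the number of prime factors of `N`.
The division by `2` is exact for square-free `N`, see `kroneckerWeight_exact`. -/
def kroneckerWeight (N : ℕ) : ℕ :=
  Nat.lcm 4 (2 ^ N.primeFactors.card * (24 / Nat.gcd 24 (ArithmeticFunction.sigma 1 N)) / 2)

/-- `ℓ_N = 2^{1-r} k_N`, with `r` the number of prime factors of `N`. The division is exact,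
see `kroneckerExponent_exact`. -/
def kroneckerExponent (N : ℕ) : ℕ :=
  2 * kroneckerWeight N / 2 ^ N.primeFactors.card

theorem kroneckerWeight_exact (N : ℕ) (hN : Squarefree N) :
    ((2 ^ N.primeFactors.card *
      (24 / Nat.gcd 24 (ArithmeticFunction.sigma 1 N)) / 2 : ℕ) : ℚ) =
    2 ^ ((N.primeFactors.card : ℤ) - 1) *
      (24 / (Nat.gcd 24 (ArithmeticFunction.sigma 1 N) : ℚ)) := by
  have h2 : 2 ∣ 2 ^ N.primeFactors.card *
      (24 / Nat.gcd 24 (ArithmeticFunction.sigma 1 N)) := by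
    by_cases h : N.primeFactors.card = 0
    · have : N = 1 := by
        rw [Finset.card_eq_zero, Nat.primeFactors_eq_empty] at h
        rcases h with h | h
        · exact absurd h hN.ne_zero
        · exact h
      subst this
      simp
    · exact (dvd_pow_self 2 h).mul_right _
  have hg : ((Nat.gcd 24 (ArithmeticFunction.sigma 1 N) : ℕ) : ℚ) ≠ 0 := by
    exact_mod_cast (Nat.gcd_pos_of_pos_left _ (by norm_num)).ne'
  rw [Nat.cast_div h2 (by norm_num), Nat.cast_mul, Nat.cast_div (Nat.gcd_dvd_left _ _) hg,
    zpow_sub₀ (by norm_num)]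
  push_cast
  rw [zpow_natCast]
  ring

theorem kroneckerExponent_exact (N : ℕ) :
    (kroneckerExponent N : ℚ) =
      2 ^ (1 - (N.primeFactors.card : ℤ)) * (kroneckerWeight N : ℚ) := by
  have h2 : 2 ^ N.primeFactors.card ∣ 2 * kroneckerWeight N := by
    by_cases h : N.primeFactors.card = 0
    · simp [h]
    · obtain ⟨r, hr⟩ := Nat.exists_eq_succ_of_ne_zero h
      have : 2 ^ r ∣ kroneckerWeight N := by
        refine dvd_trans ?_ (Nat.dvd_lcm_right _ _)
        rw [hr, Nat.succ_eq_add_one, pow_succ, mul_assoc, mul_left_comm,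
          Nat.mul_div_cancel_left _ (by norm_num)]
        exact dvd_mul_right _ _
      rw [hr, Nat.succ_eq_add_one, pow_succ, mul_comm]
      exact mul_dvd_mul_left 2 this
  rw [kroneckerExponent, Nat.cast_div h2 (by positivity), zpow_sub₀ (by norm_num)]
  push_cast
  rw [zpow_natCast]
  ring

/-- The Kronecker limit function `Δ_N(z) = (∏_{v ∣ N} η(v z))^{ℓ_N}` on the upper half-plane. -/
def kroneckerLimit (N : ℕ) (z : ℍ) : ℂ :=
  (∏ v ∈ N.divisors, ModularForm.eta ((v : ℂ) * (z : ℂ))) ^ kroneckerExponent N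

/-- A cusp form on `X_N = Γ₀(N)⁺ \ ℍ` (so vanishing at the cusp) that vanishes at the cusp only:
it has no zero in the upper half-plane. -/
def VanishesOnlyAtCusp {N : ℕ} {k : ℤ} (f : CuspForm (Gamma0PlusGL N) k) : Prop :=
  ∀ z : ℍ, f z ≠ 0

/-- The order of vanishing at `i∞` of a `1`-periodic function: the least `n` for which the
coefficient of `q^n`, `q = exp(2πiz)`, in its `q`-expansion is non-zero (`⊤` if there is none). -/
def orderAtImInfty (f : ℍ → ℂ) : ℕ∞ :=
  (UpperHalfPlane.qExpansion 1 f).order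

end

open scoped MatrixGroups

open UpperHalfPlane

noncomputable section

/-! ### The multiplier of the Dedekind eta function -/

section Sqrt

open Complex

theorem csqrt_sq (w : ℂ) : Complex.sqrt w ^ 2 = w := by
  simp [Complex.sqrt]

theorem csqrt_re_nonneg (w : ℂ) : 0 ≤ (Complex.sqrt w).re := by
  rw [Complex.sqrt_eq_real_add_ite]
  split_ifs <;> simp <;> positivity

theorem csqrt_re_im (w : ℂ) : 2 * ((Complex.sqrt w).re * (Complex.sqrt w).im) = w.im := by
  have h := congrArg Complex.im (csqrt_sq w)
  rw [sq, Complex.mul_im] at h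
  linarith

theorem csqrt_re_pos_of_im_ne {w : ℂ} (hw : w.im ≠ 0) : 0 < (Complex.sqrt w).re := by
  refine lt_of_le_of_ne (csqrt_re_nonneg w) fun h => hw ?_
  rw [← csqrt_re_im w, ← h]
  ring

theorem csqrt_im_pos {w : ℂ} (hw : 0 < w.im) : 0 < (Complex.sqrt w).im := by
  have h := csqrt_re_im w
  have h1 := csqrt_re_pos_of_im_ne hw.ne'
  by_contra! h2
  nlinarith [mul_nonneg h1.le (neg_nonneg.2 h2)]

theorem csqrt_im_neg {w : ℂ} (hw : w.im < 0) : (Complex.sqrt w).im < 0 := by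
  have h := csqrt_re_im w
  have h1 := csqrt_re_pos_of_im_ne hw.ne
  by_contra! h2
  nlinarith [mul_nonneg h1.le h2]

theorem csqrt_eq_of_sq {w s : ℂ} (h : s ^ 2 = w) (hs : 0 < s.re) : Complex.sqrt w = s := by
  have h1 : Complex.sqrt w ^ 2 = s ^ 2 := (csqrt_sq w).trans h.symm
  rcases sq_eq_sq_iff_eq_or_eq_neg.1 h1 with h2 | h2
  · exact h2
  · have := csqrt_re_nonneg w
    rw [h2, Complex.neg_re] at this
    linarith

theorem csqrt_ofReal_mul {t : ℝ} (ht : 0 < t) (w : ℂ) (hw : 0 < (Complex.sqrt w).re) :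
    Complex.sqrt ((t : ℂ) * w) = (Real.sqrt t : ℂ) * Complex.sqrt w := by
  refine csqrt_eq_of_sq ?_ ?_
  · rw [mul_pow, csqrt_sq, ← Complex.ofReal_pow, Real.sq_sqrt ht.le]
  · rw [Complex.re_ofReal_mul]
    exact mul_pos (Real.sqrt_pos.2 ht) hw

theorem csqrt_affine_re_pos {c d : ℝ} (hd : 0 < d) {z : ℂ} (hz : 0 < z.im) :
    0 < (Complex.sqrt (c * z + d)).re := by
  rcases eq_or_ne c 0 with rfl | hc
  · rw [Complex.ofReal_zero, zero_mul, zero_add, Complex.re_sqrt_ofReal]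
    exact Real.sqrt_pos.2 hd
  · apply csqrt_re_pos_of_im_ne
    simp [hc, hz.ne']

/-- Compatibility of the principal square roots of the automorphy factors of a matrix with
positive lower right entry `d` and of `z ↦ z / (z + 1)`. -/
theorem csqrt_mul_csqrt_add_one {c d : ℝ} (hd : 0 < d) {z : ℂ} (hz : 0 < z.im) :
    Complex.sqrt (c * (z / (z + 1)) + d) * Complex.sqrt (z + 1) =
      Complex.sqrt ((c + d) * z + d) := by
  have hz1 : z + 1 ≠ 0 := fun h => by
    have := congrArg Complex.im h
    simp at this
    linarith
  have him : 0 < (z / (z + 1)).im := by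
    rw [show z / (z + 1) = 1 - (z + 1)⁻¹ by field_simp; ring, Complex.sub_im, Complex.inv_im]
    simp only [Complex.one_im, Complex.add_im, add_zero]
    have : 0 < Complex.normSq (z + 1) := Complex.normSq_pos.2 hz1
    have := div_pos hz this
    rw [neg_div]
    linarith
  have hq : 0 < (z + 1).im := by simpa using hz
  have hq1 := csqrt_re_pos_of_im_ne hq.ne'
  have hq2 := csqrt_im_pos hq
  have hp1 := csqrt_affine_re_pos (c := c) hd him
  have hsq : (Complex.sqrt (c * (z / (z + 1)) + d) * Complex.sqrt (z + 1)) ^ 2 =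
      (c + d) * z + d := by
    rw [mul_pow, csqrt_sq, csqrt_sq]
    field_simp
    ring
  have hwim : (c * (z / (z + 1)) + d : ℂ).im = c * (z / (z + 1)).im := by simp
  refine (csqrt_eq_of_sq hsq ?_).symm
  rcases le_or_gt c 0 with hc | hc
  · have hp2 : (Complex.sqrt (c * (z / (z + 1)) + d)).im ≤ 0 := by
      rcases hc.eq_or_lt with rfl | hc
      · have h := csqrt_re_im (((0 : ℝ) : ℂ) * (z / (z + 1)) + d)
        rw [hwim, zero_mul] at h
        have := mul_eq_zero.1 ((mul_eq_zero.1 h).resolve_left two_ne_zero)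
        exact (this.resolve_left hp1.ne').le
      · exact (csqrt_im_neg (by rw [hwim]; exact mul_neg_of_neg_of_pos hc him)).le
    rw [Complex.mul_re]
    nlinarith [mul_pos hp1 hq1, mul_nonneg (neg_nonneg.2 hp2) hq2.le]
  · have hp2 := csqrt_im_pos (w := c * (z / (z + 1)) + d) (by rw [hwim]; exact mul_pos hc him)
    set s := Complex.sqrt (c * (z / (z + 1)) + d) * Complex.sqrt (z + 1) with hs
    have hsim : 0 < s.im := by
      rw [hs, Complex.mul_im]
      positivity
    have h2 := congrArg Complex.im hsq
    rw [sq, Complex.mul_im] at h2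
    have h3 : ((c + d) * z + d : ℂ).im = (c + d) * z.im := by
      rw [← Complex.ofReal_add, Complex.add_im, Complex.im_ofReal_mul, Complex.ofReal_im, add_zero]
    rw [h3] at h2
    have h4 : 0 < (c + d) * z.im := by positivity
    by_contra! h5
    nlinarith [mul_nonneg hsim.le (neg_nonneg.2 h5)]

end Sqrt

section Eta

open ModularForm Complex Real

/-- `exp(2πi n / 24)`. -/
def zeta24 (n : ℤ) : ℂ := cexp (2 * π * Complex.I * n / 24)

theorem zeta24_add (m n : ℤ) : zeta24 (m + n) = zeta24 m * zeta24 n := by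
  rw [zeta24, zeta24, zeta24, ← Complex.exp_add]
  push_cast
  ring_nf

theorem zeta24_zero : zeta24 0 = 1 := by simp [zeta24]

theorem zeta24_ne_zero (n : ℤ) : zeta24 n ≠ 0 := Complex.exp_ne_zero _

theorem zeta24_mul_nat (m : ℤ) (n : ℕ) : zeta24 (n * m) = zeta24 m ^ n := by
  rw [zeta24, zeta24, ← Complex.exp_nat_mul]
  push_cast
  ring_nf

theorem zeta24_sum {ι : Type*} (s : Finset ι) (f : ι → ℤ) :
    zeta24 (∑ i ∈ s, f i) = ∏ i ∈ s, zeta24 (f i) := by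
  classical
  induction s using Finset.induction_on with
  | empty => simp [zeta24_zero]
  | insert a s ha ih => rw [Finset.sum_insert ha, Finset.prod_insert ha, zeta24_add, ih]

theorem zeta24_eq_one {n : ℤ} (h : (24 : ℤ) ∣ n) : zeta24 n = 1 := by
  obtain ⟨m, rfl⟩ := h
  rw [zeta24, Complex.exp_eq_one_iff]
  exact ⟨m, by push_cast; ring⟩

theorem dvd_of_zeta24_eq_one {n : ℤ} (h : zeta24 n = 1) : (24 : ℤ) ∣ n := by
  rw [zeta24, Complex.exp_eq_one_iff] at h
  obtain ⟨m, hm⟩ := h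
  refine ⟨m, ?_⟩
  have h2 : (2 * π * Complex.I : ℂ) ≠ 0 := Complex.two_pi_I_ne_zero
  have : (n : ℂ) = 24 * m := by
    have h3 : (2 * π * Complex.I : ℂ) * n = (2 * π * Complex.I) * (24 * m) := by
      linear_combination 24 * hm
    exact mul_left_cancel₀ h2 h3
  exact_mod_cast this

theorem zeta24_twelve : zeta24 12 = -1 := by
  rw [zeta24, ← Complex.exp_pi_mul_I]
  congr 1
  push_cast
  ring

theorem eta_add_one (z : ℂ) : η (z + 1) = zeta24 1 * η z := by
  have h (n : ℕ) : eta_q n (z + 1) = eta_q n z := by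
    have : Function.Periodic.qParam 1 (z + 1) = Function.Periodic.qParam 1 z := by
      rw [Function.Periodic.qParam, Function.Periodic.qParam, Complex.exp_eq_exp_iff_exists_int]
      exact ⟨1, by push_cast; ring⟩
    rw [eta_q, eta_q, this]
  rw [ModularForm.eta, ModularForm.eta]
  simp_rw [h]
  rw [← mul_assoc]
  congr 1
  rw [Function.Periodic.qParam, Function.Periodic.qParam, zeta24, ← Complex.exp_add]
  congr 1
  push_cast
  ring

theorem eta_add_int (z : ℂ) (n : ℤ) : η (z + n) = zeta24 n * η z := by
  induction n using Int.induction_on with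
  | zero => simp [zeta24_zero]
  | succ k ih =>
    rw [zeta24_add, Int.cast_add, ← add_assoc, Int.cast_one, eta_add_one, ih]
    ring
  | pred k ih =>
    have h := eta_add_one (z + ((-(k : ℤ) - 1 : ℤ) : ℂ))
    rw [show z + ((-(k : ℤ) - 1 : ℤ) : ℂ) + 1 = z + ((-(k : ℤ) : ℤ) : ℂ) by push_cast; ring, ih] at h
    have h1 : zeta24 (-(k : ℤ)) = zeta24 1 * zeta24 (-(k : ℤ) - 1) := by
      rw [← zeta24_add]
      ring_nf
    rw [h1, mul_assoc] at h
    exact (mul_left_cancel₀ (zeta24_ne_zero 1) h).symm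

theorem eta_neg_inv {z : ℂ} (hz : 0 < z.im) :
    η (-1 / z) = (Complex.sqrt Complex.I)⁻¹ * (Complex.sqrt z * η z) := by
  simpa using eta_comp_eq_csqrt_I_inv (show z ∈ upperHalfPlaneSet from hz)

theorem eta_div_add_one {z : ℂ} (hz : 0 < z.im) :
    η (z / (z + 1)) = zeta24 (-1) * (Complex.sqrt (z + 1) * η z) := by
  have hz0 : z ≠ 0 := fun h => by simp [h] at hz
  have hz1 : z + 1 ≠ 0 := fun h => by
    have := congrArg Complex.im h
    simp at this
    linarith
  set w : ℂ := -1 / z + ((-1 : ℤ) : ℂ) with hw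
  have hwz : -1 / w = z / (z + 1) := by
    have : w = -(z + 1) / z := by rw [hw]; push_cast; field_simp; ring
    rw [this]
    field_simp
  have hwim : 0 < w.im := by
    rw [hw, Complex.add_im, Complex.intCast_im, add_zero, neg_div, one_div, Complex.neg_im,
      Complex.inv_im, neg_div, neg_neg]
    exact div_pos hz (Complex.normSq_pos.2 hz0)
  have hI : Complex.sqrt Complex.I ^ 2 = Complex.I := csqrt_sq _
  have hI0 : Complex.sqrt Complex.I ≠ 0 := fun h => by
    rw [h, zero_pow two_ne_zero] at hI
    exact Complex.I_ne_zero hI.symm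
  have hs : Complex.sqrt (z + 1) = -Complex.I * (Complex.sqrt w * Complex.sqrt z) := by
    apply csqrt_eq_of_sq
    · rw [mul_pow, mul_pow, csqrt_sq, csqrt_sq, neg_sq, Complex.I_sq, hw]
      push_cast
      field_simp
      ring
    · have h1 := csqrt_re_pos_of_im_ne hwim.ne'
      have h2 := csqrt_im_pos hwim
      have h3 := csqrt_re_pos_of_im_ne hz.ne'
      have h4 := csqrt_im_pos hz
      simp only [Complex.mul_re, Complex.neg_re, Complex.I_re, Complex.neg_im, Complex.I_im,
        Complex.mul_im]
      have := mul_pos h1 h4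
      have := mul_pos h2 h3
      linarith
  rw [← hwz, eta_neg_inv hwim, hs, hw, eta_add_int, ← hw, eta_neg_inv hz]
  have hI2 : (Complex.sqrt Complex.I)⁻¹ * (Complex.sqrt Complex.I)⁻¹ = -Complex.I := by
    rw [← mul_inv, ← sq, hI, Complex.inv_I]
  linear_combination (zeta24 (-1) * Complex.sqrt w * Complex.sqrt z * η z) * hI2

end Eta

section EtaMultiplier

open ModularForm Complex Real
open scoped NumberTheorySymbols

/-- The exponent modulo `24` in the multiplier of `η` at a matrix with odd lower right entry. -/
def etaExp (a b c d : ℤ) : ℤ :=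
  9 * (d * (b - c + 3) - 3) - 8 * ((a + d) * c - b * d * (c ^ 2 - 1))

/-- The transformation formula of `η` under a matrix with odd positive lower right entry. -/
def EtaTransforms (a b c d : ℤ) : Prop :=
  ∀ z : ℂ, 0 < z.im → η ((a * z + b) / (c * z + d)) =
    (J(c | d.toNat) : ℂ) * zeta24 (etaExp a b c d) * (Complex.sqrt (c * z + d) * η z)

theorem dvd_24_of_dvd {x y n : ℤ} (h8 : (8 : ℤ) ∣ x - n) (h3 : (3 : ℤ) ∣ y - n) :
    (24 : ℤ) ∣ 9 * x - 8 * y - n := by omega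

theorem three_dvd_of_intCast_eq_zero {x : ℤ} (h : (x : ZMod 3) = 0) : (3 : ℤ) ∣ x := by
  exact_mod_cast (ZMod.intCast_zmod_eq_zero_iff_dvd x 3).1 h

theorem zeta24_congr {m n : ℤ} (h : (24 : ℤ) ∣ m - n) : zeta24 m = zeta24 n := by
  rw [show m = (m - n) + n by ring, zeta24_add, zeta24_eq_one h, one_mul]

theorem eight_dvd_sq_sub_one {d : ℤ} (hd : Odd d) : (8 : ℤ) ∣ d ^ 2 - 1 := by
  exact Int.eight_dvd_sq_sub_one_of_odd hd

theorem etaExp_right_unipotent {a b c d : ℤ} (hdet : a * d - b * c = 1) (hd : Odd d) :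
    zeta24 (etaExp (a + b) b (c + d) d) = zeta24 (etaExp a b c d - 1) := by
  apply zeta24_congr
  have h3 : (3 : ℤ) ∣ ((a + b + d) * (c + d) - b * d * ((c + d) ^ 2 - 1)) -
      ((a + d) * c - b * d * (c ^ 2 - 1)) - -1 := by
    apply three_dvd_of_intCast_eq_zero
    have := congrArg (Int.cast : ℤ → ZMod 3) hdet
    push_cast at this ⊢
    generalize (a : ZMod 3) = a at *
    generalize (b : ZMod 3) = b at *
    generalize (c : ZMod 3) = c at *
    generalize (d : ZMod 3) = d at *
    revert a b c d
    decide
  have h8 : (8 : ℤ) ∣ (d * (b - (c + d) + 3) - 3) - (d * (b - c + 3) - 3) - -1 := by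
    obtain ⟨k, hk⟩ := eight_dvd_sq_sub_one hd
    exact ⟨-k, by linear_combination -hk⟩
  convert dvd_24_of_dvd h8 h3 using 1
  rw [etaExp, etaExp]
  ring

theorem eta_rhs_unipotent {a b c d : ℤ} (hdet : a * d - b * c = 1) (hd : Odd d) (hd0 : 0 < d)
    {z : ℂ} (hz : 0 < z.im) :
    (J(c + d | d.toNat) : ℂ) * zeta24 (etaExp (a + b) b (c + d) d) *
      (Complex.sqrt (((c + d : ℤ) : ℂ) * z + d) * η z) =
    (J(c | d.toNat) : ℂ) * zeta24 (etaExp a b c d) *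
      (Complex.sqrt (c * (z / (z + 1)) + d) * η (z / (z + 1))) := by
  have hJ : J(c + d | d.toNat) = J(c | d.toNat) := by
    apply jacobiSym.mod_left'
    rw [Int.toNat_of_nonneg hd0.le, Int.add_emod_right]
  have hs := csqrt_mul_csqrt_add_one (c := c) (d := d) (by exact_mod_cast hd0) hz
  push_cast at hs ⊢
  rw [hJ, etaExp_right_unipotent hdet hd, eta_div_add_one hz, ← hs, sub_eq_add_neg, zeta24_add]
  ring

theorem etaTransforms_right_unipotent {a b c d : ℤ} (hdet : a * d - b * c = 1) (hd : Odd d)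
    (hd0 : 0 < d) : EtaTransforms (a + b) b (c + d) d ↔ EtaTransforms a b c d := by
  have key {z : ℂ} (hz : 0 < z.im) : ((a + b : ℤ) * z + b) / ((c + d : ℤ) * z + d) =
      (a * (z / (z + 1)) + b) / (c * (z / (z + 1)) + d) := by
    have hz1 : z + 1 ≠ 0 := fun h => by
      have := congrArg Complex.im h
      simp at this
      linarith
    rw [← mul_div_mul_right _ (c * (z / (z + 1)) + d : ℂ) hz1]
    congr 1 <;> · push_cast; field_simp; ring
  constructor
  · intro h w hw
    have hw1 : 1 - w ≠ 0 := fun h => by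
      have := congrArg Complex.im h
      simp at this
      linarith
    have hz : 0 < (w / (1 - w)).im := by
      rw [show w / (1 - w) = (1 - w)⁻¹ - 1 by field_simp; ring, Complex.sub_im, Complex.inv_im]
      simp only [Complex.one_im, Complex.sub_im, sub_zero, zero_sub, neg_neg]
      exact div_pos hw (Complex.normSq_pos.2 hw1)
    have hzw : (w / (1 - w)) / (w / (1 - w) + 1) = w := by
      field_simp
      ring
    have := h _ hz
    rw [eta_rhs_unipotent hdet hd hd0 hz, key hz, hzw] at this
    exact this
  · intro h z hz
    have hz' : 0 < (z / (z + 1)).im := by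
      have hz1 : z + 1 ≠ 0 := fun h => by
        have := congrArg Complex.im h
        simp at this
        linarith
      rw [show z / (z + 1) = 1 - (z + 1)⁻¹ by field_simp; ring, Complex.sub_im, Complex.inv_im]
      simp only [Complex.one_im, Complex.add_im, add_zero]
      have := div_pos hz (Complex.normSq_pos.2 hz1)
      rw [neg_div]
      linarith
    rw [eta_rhs_unipotent hdet hd hd0 hz, key hz]
    exact h _ hz'

theorem etaTransforms_right_unipotent_zpow {a b c d : ℤ} (hdet : a * d - b * c = 1) (hd : Odd d)
    (hd0 : 0 < d) (n : ℤ) :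
    EtaTransforms (a + n * b) b (c + n * d) d ↔ EtaTransforms a b c d := by
  have h (n : ℤ) : EtaTransforms (a + (n + 1) * b) b (c + (n + 1) * d) d ↔
      EtaTransforms (a + n * b) b (c + n * d) d := by
    have := etaTransforms_right_unipotent (a := a + n * b) (b := b) (c := c + n * d) (d := d)
      (by linear_combination hdet) hd hd0
    rwa [show a + n * b + b = a + (n + 1) * b by ring,
      show c + n * d + d = c + (n + 1) * d by ring] at this
  induction n using Int.induction_on with
  | zero => simp
  | succ k ih => exact (h k).trans ih
  | pred k ih =>
    have := h (-(k : ℤ) - 1)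
    rw [sub_add_cancel] at this
    exact this.symm.trans ih

theorem jacobiSym_add_right {c d : ℤ} (hc : Even c) (hd : Odd d) (hd0 : 0 < d) (hcd : 0 < d + c) :
    J(c | (d + c).toNat) = (if c % 4 = 2 ∧ d % 4 = 1 then -1 else 1) * J(c | d.toNat) := by
  obtain ⟨n, rfl⟩ := Int.eq_ofNat_of_zero_le hd0.le
  obtain ⟨m, hm⟩ := Int.eq_ofNat_of_zero_le hcd.le
  have hn : Odd n := by exact_mod_cast hd
  have hm' : Odd m := by
    have : Odd ((m : ℕ) : ℤ) := by rw [← hm]; exact hd.add_even hc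
    exact_mod_cast this
  rw [hm, Int.toNat_natCast, Int.toNat_natCast]
  have h1 : J(c | m) = J(-n | m) := by
    apply jacobiSym.mod_left'
    rw [← hm]
    exact Int.ModEq.symm (Int.modEq_iff_dvd.2 ⟨1, by ring⟩)
  have h2 : J(c | n) = J(m | n) := by
    apply jacobiSym.mod_left'
    rw [← hm]
    simp
  rw [h1, h2, jacobiSym.neg _ hm']
  have hm4 : (m : ℤ) % 4 = (n + c) % 4 := by rw [← hm]
  rcases Nat.odd_mod_four_iff.1 (Nat.odd_iff.1 hn) with h | h <;>
    rcases Nat.odd_mod_four_iff.1 (Nat.odd_iff.1 hm') with h' | h'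
  · rw [jacobiSym.quadratic_reciprocity_one_mod_four h hm', ZMod.χ₄_nat_one_mod_four h', if_neg]
    omega
  · rw [jacobiSym.quadratic_reciprocity_one_mod_four h hm', ZMod.χ₄_nat_three_mod_four h', if_pos]
    omega
  · rw [jacobiSym.quadratic_reciprocity_one_mod_four' hn h', ZMod.χ₄_nat_one_mod_four h', if_neg]
    omega
  · rw [jacobiSym.quadratic_reciprocity_three_mod_four h h', ZMod.χ₄_nat_three_mod_four h', if_neg]
    · ring
    · omega

theorem etaExp_right_translation {a b c d : ℤ} (hdet : a * d - b * c = 1) (hd : Odd d)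
    (hc : Even c) :
    zeta24 (etaExp a (a + b) c (d + c)) =
      (if c % 4 = 2 ∧ d % 4 = 1 then -1 else 1) * zeta24 (etaExp a b c d + 1) := by
  have h3 : (3 : ℤ) ∣ ((a + (d + c)) * c - (a + b) * (d + c) * (c ^ 2 - 1)) -
      ((a + d) * c - b * d * (c ^ 2 - 1)) - 1 := by
    apply three_dvd_of_intCast_eq_zero
    have := congrArg (Int.cast : ℤ → ZMod 3) hdet
    push_cast at this ⊢
    generalize (a : ZMod 3) = a at *
    generalize (b : ZMod 3) = b at *
    generalize (c : ZMod 3) = c at *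
    generalize (d : ZMod 3) = d at *
    revert a b c d
    decide
  have h8 : ((d + c) * (a + b - c + 3) - 3) - (d * (b - c + 3) - 3) - 1 =
      c * (a + 2 * b - c + 3) := by linear_combination hdet
  obtain ⟨u, rfl⟩ := hc
  obtain ⟨v, rfl⟩ := hd
  have ha : a % 2 = 1 := by
    have : a = 1 + 2 * (b * u - a * v) := by linear_combination hdet
    omega
  obtain ⟨w, rfl⟩ : ∃ w, a = 2 * w + 1 := ⟨a / 2, by omega⟩
  have hwv : w + v = b * u - 2 * (w * v) := by linarith
  split_ifs with h
  · have hu : u % 2 = 1 := by omega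
    have hv : v % 2 = 0 := by omega
    obtain ⟨s, rfl⟩ : ∃ s, u = 2 * s + 1 := ⟨u / 2, by omega⟩
    obtain ⟨t, rfl⟩ : ∃ t, v = 2 * t := ⟨v / 2, by omega⟩
    have hw : (w - b) % 2 = 0 := by
      have : w - b = 2 * (b * s - 2 * (w * t) - t) := by linarith
      omega
    obtain ⟨x, hx⟩ : ∃ x, w - b = 2 * x := ⟨(w - b) / 2, by omega⟩
    obtain rfl : w = b + 2 * x := by linarith
    rw [← zeta24_twelve, ← zeta24_add]
    apply zeta24_congr
    have h8' : (8 : ℤ) ∣ ((2 * (2 * t) + 1 + (2 * s + 1 + (2 * s + 1))) *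
        (2 * (b + 2 * x) + 1 + b - (2 * s + 1 + (2 * s + 1)) + 3) - 3) -
        ((2 * (2 * t) + 1) * (b - (2 * s + 1 + (2 * s + 1)) + 3) - 3) - 1 - 4 := by
      rw [h8]
      refine ⟨(2 * s + 1) * (b + x) - 2 * s ^ 2, ?_⟩
      ring
    rw [etaExp, etaExp]
    omega
  · rw [one_mul]
    apply zeta24_congr
    have h8' : (8 : ℤ) ∣ (2 * v + 1 + (u + u)) * (2 * w + 1 + b - (u + u) + 3) - 3 -
        ((2 * v + 1) * (b - (u + u) + 3) - 3) - 1 := by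
      rw [h8]
      have : Even u ∨ Even (w + b - u + 2) := by
        by_cases hu : u % 2 = 0
        · exact Or.inl (Int.even_iff.2 hu)
        · right
          have hv : v % 2 = 1 := by omega
          obtain ⟨s, rfl⟩ : ∃ s, u = 2 * s + 1 := ⟨u / 2, by omega⟩
          obtain ⟨t, rfl⟩ : ∃ t, v = 2 * t + 1 := ⟨v / 2, by omega⟩
          exact ⟨(b * s + b - 2 * w * t - w - t - s), by linarith⟩
      rcases this with ⟨s, hs⟩ | ⟨s, hs⟩
      · exact ⟨s * (w + b - u + 2), by rw [hs]; ring⟩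
      · refine ⟨u * s, ?_⟩
        linear_combination (4 * u) * hs
    rw [etaExp, etaExp]
    omega

theorem etaTransforms_right_translation {a b c d : ℤ} (hdet : a * d - b * c = 1) (hd : Odd d)
    (hd0 : 0 < d) (hc : Even c) (hcd : 0 < d + c) :
    EtaTransforms a (a + b) c (d + c) ↔ EtaTransforms a b c d := by
  have key (z : ℂ) : (J(c | (d + c).toNat) : ℂ) * zeta24 (etaExp a (a + b) c (d + c)) *
        (Complex.sqrt (c * z + (d + c : ℤ)) * η z) =
      (J(c | d.toNat) : ℂ) * zeta24 (etaExp a b c d) *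
        (Complex.sqrt (c * (z + 1) + d) * η (z + 1)) := by
    rw [eta_add_one, jacobiSym_add_right hc hd hd0 hcd, etaExp_right_translation hdet hd hc,
      zeta24_add]
    have : (c * z + (d + c : ℤ) : ℂ) = c * (z + 1) + d := by push_cast; ring
    rw [this]
    split_ifs <;> push_cast <;> ring
  have key' (z : ℂ) : (a * z + (a + b : ℤ)) / (c * z + (d + c : ℤ) : ℂ) =
      (a * (z + 1) + b) / (c * (z + 1) + d) := by
    push_cast
    ring_nf
  constructor
  · intro h z hz
    have := h (z - 1) (by simpa using hz)
    rwa [key, key', sub_add_cancel] at this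
  · intro h z hz
    rw [key, key']
    exact h (z + 1) (by simpa using hz)

theorem etaTransforms_one (b : ℤ) : EtaTransforms 1 b 0 1 := by
  intro z _
  have : etaExp 1 b 0 1 = b := by rw [etaExp]; ring
  rw [this]
  simp [eta_add_int]

/-- **The transformation formula of the Dedekind eta function** for matrices with odd positive
lower right entry. -/
theorem eta_transforms (a b c d : ℤ) (hdet : a * d - b * c = 1) (hd : Odd d) (hd0 : 0 < d) :
    EtaTransforms a b c d := by
  obtain ⟨n, rfl⟩ := Int.eq_ofNat_of_zero_le hd0.le
  induction n using Nat.strong_induction_on generalizing a b c with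
  | _ n ih =>
    rcases Nat.lt_or_ge 1 n with hn | hn
    · have hodd : n % 2 = 1 := by
        have : Odd n := by exact_mod_cast hd
        exact Nat.odd_iff.1 this
      set r := c % n with hr
      have hr0 : 0 ≤ r := Int.emod_nonneg _ (by omega)
      have hrn : r < n := Int.emod_lt_of_pos _ hd0
      have hc : c = r + (c / n) * n := by
        have := Int.emod_add_mul_ediv c n
        linarith
      have hr1 : r ≠ 0 := by
        intro h0
        have h1 : (n : ℤ) ∣ 1 := by
          rw [← hdet, hc, h0]
          exact ⟨a - b * (c / n), by ring⟩
        have := Int.le_of_dvd one_pos h1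
        omega
      rcases Int.even_or_odd r with he | ho
      · rw [← etaTransforms_right_unipotent_zpow hdet hd hd0 (-(c / n))]
        have h1 : c + -(c / n) * n = r := by linarith
        rw [h1]
        set a' := a + -(c / n) * b
        have hdet' : a' * n - b * r = 1 := by
          rw [← h1]
          linear_combination hdet
        obtain ⟨m, hm⟩ := Int.eq_ofNat_of_zero_le (show 0 ≤ n - r by omega)
        have hmodd : Odd ((m : ℕ) : ℤ) := by
          rw [← hm]
          exact hd.sub_even he
        have hm0 : (0 : ℤ) < m := by omega
        have := ih m (by omega) a' (b - a') r (by
          rw [← hm]; linear_combination hdet') hmodd hm0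
        rw [← etaTransforms_right_translation (by
          rw [← hm]; linear_combination hdet') hmodd hm0 he (by omega)] at this
        rwa [show (m : ℤ) + r = n by omega, show a' + (b - a') = b by ring] at this
      · rw [← etaTransforms_right_unipotent_zpow hdet hd hd0 (-(c / n) - 1)]
        have h1 : c + (-(c / n) - 1) * n = r - n := by linarith
        rw [h1]
        set a' := a + (-(c / n) - 1) * b
        have hdet' : a' * n - b * (r - n) = 1 := by
          rw [← h1]
          linear_combination hdet
        rw [← etaTransforms_right_translation hdet' hd hd0 (ho.sub_odd hd) (by omega)]
        obtain ⟨m, hm⟩ := Int.eq_ofNat_of_zero_le hr0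
        have : (n : ℤ) + (r - n) = m := by rw [← hm]; ring
        rw [this]
        refine ih m (by omega) _ _ _ ?_ ?_ (by omega)
        · rw [← this]
          linear_combination hdet'
        · rw [← this]
          convert ho using 1
          ring
    · obtain rfl : n = 1 := by omega
      rw [← etaTransforms_right_unipotent_zpow hdet hd hd0 (-c)]
      have ha : a + -c * b = 1 := by
        push_cast at hdet
        linear_combination hdet
      rw [ha]
      simpa using etaTransforms_one b

end EtaMultiplier

section Divisors

@[to_additive]
theorem prod_divisors_coprime_mul {α : Type*} [CommMonoid α] {m n : ℕ} (h : m.Coprime n)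
    (f : ℕ → α) :
    ∏ v ∈ (m * n).divisors, f v = ∏ u ∈ m.divisors, ∏ w ∈ n.divisors, f (u * w) := by
  rw [Nat.divisors_mul, ← Finset.image_mul_product, Finset.prod_image h.mul_injOn_divisors,
    Finset.prod_product]

@[to_additive sum_divisors_prime_mul]
theorem prod_divisors_prime_mul {α : Type*} [CommMonoid α] {p m : ℕ} (hp : p.Prime)
    (hpm : ¬ p ∣ m) (f : ℕ → ℕ → α) :
    ∏ v ∈ (p * m).divisors, f v (p * m / v) =
      ∏ u ∈ m.divisors, (f u (p * (m / u)) * f (p * u) (m / u)) := by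
  rw [prod_divisors_coprime_mul (hp.coprime_iff_not_dvd.2 hpm) (fun v => f v (p * m / v)),
    hp.prod_divisors, mul_comm, ← Finset.prod_mul_distrib]
  refine Finset.prod_congr rfl fun u hu => ?_
  have h := Nat.dvd_of_mem_divisors hu
  rw [one_mul, Nat.mul_div_assoc _ h, Nat.mul_div_mul_left _ _ hp.pos]

theorem card_divisors_prime_mul {p m : ℕ} (hp : p.Prime) (hpm : ¬ p ∣ m) :
    (p * m).divisors.card = 2 * m.divisors.card := by
  rw [(hp.coprime_iff_not_dvd.2 hpm).card_divisors_mul, hp.divisors,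
    Finset.card_pair hp.one_lt.ne]

theorem sum_divisors_prime_mul' {p m : ℕ} (hp : p.Prime) (hpm : ¬ p ∣ m) :
    ∑ v ∈ (p * m).divisors, v = (p + 1) * ∑ v ∈ m.divisors, v := by
  rw [(hp.coprime_iff_not_dvd.2 hpm).sum_divisors_mul, hp.sum_divisors, ]

theorem squarefree_induction {P : ℕ → Prop} (one : P 1)
    (mul : ∀ p m : ℕ, p.Prime → ¬ p ∣ m → Squarefree m → P m → P (p * m)) {n : ℕ}
    (hn : Squarefree n) : P n := by
  induction n using Nat.strong_induction_on with
  | _ n ih =>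
    rcases eq_or_ne n 1 with rfl | h1
    · exact one
    · obtain ⟨p, hp, m, rfl⟩ := Nat.exists_prime_and_dvd h1
      have hm := hn.of_mul_right
      have hpm : ¬ p ∣ m := fun h => hp.one_lt.ne' (Nat.isUnit_iff.1 (hn p (mul_dvd_mul_left p h)))
      have hm0 : 0 < m := Nat.pos_of_ne_zero hm.ne_zero
      exact mul p m hp hpm hm (ih m (by nlinarith [hp.two_le]) hm)

theorem card_divisors_of_squarefree {n : ℕ} (hn : Squarefree n) :
    n.divisors.card = 2 ^ n.primeFactors.card := by
  rw [Nat.card_divisors hn.ne_zero, Finset.prod_congr rfl (g := fun _ => 2) fun p hp => by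
    rw [Nat.factorization_eq_one_of_squarefree hn (Nat.prime_of_mem_primeFactors hp)
      (Nat.dvd_of_mem_primeFactors hp)], Finset.prod_const]

theorem exists_prime_of_three_dvd_sum_divisors {n : ℕ} (hn : Squarefree n)
    (h : 3 ∣ ∑ v ∈ n.divisors, v) : ∃ p : ℕ, p.Prime ∧ p ∣ n ∧ 3 ∣ p + 1 := by
  revert h
  refine squarefree_induction (P := fun n => 3 ∣ ∑ v ∈ n.divisors, v →
    ∃ p : ℕ, p.Prime ∧ p ∣ n ∧ 3 ∣ p + 1) ?_ ?_ hn
  · intro h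
    simp at h
  · intro p m hp hpm hm ih h
    rw [sum_divisors_prime_mul' hp hpm, Nat.prime_three.dvd_mul] at h
    rcases h with h | h
    · exact ⟨p, hp, dvd_mul_right _ _, h⟩
    · obtain ⟨q, hq, hqm, h3⟩ := ih h
      exact ⟨q, hq, hqm.mul_left p, h3⟩

theorem card_divisors_dvd_sum_divisors {n : ℕ} (hn : Squarefree n) (ho : Odd n) :
    n.divisors.card ∣ ∑ v ∈ n.divisors, v := by
  revert ho
  refine squarefree_induction (P := fun n => Odd n → n.divisors.card ∣ ∑ v ∈ n.divisors, v)
    (by simp) ?_ hn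
  · intro p m hp hpm hm ih ho
    rw [sum_divisors_prime_mul' hp hpm, card_divisors_prime_mul hp hpm]
    have := Nat.odd_mul.1 ho
    exact mul_dvd_mul this.1.add_one.two_dvd (ih this.2)

theorem prod_divisors_sq (n : ℕ) : (∏ v ∈ n.divisors, v) ^ 2 = n ^ n.divisors.card := by
  have := Nat.prod_div_divisors n (fun v => v)
  rw [sq]
  nth_rw 2 [← this]
  rw [← Finset.prod_mul_distrib, Finset.prod_congr rfl (g := fun _ => n) fun v hv =>
    Nat.mul_div_cancel' (Nat.dvd_of_mem_divisors hv), Finset.prod_const]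

theorem squarefree_prime_factor {n p : ℕ} (hn : Squarefree n) (hp : p.Prime) (h : p ∣ n) :
    ∃ m, n = p * m ∧ ¬ p ∣ m := by
  obtain ⟨m, rfl⟩ := h
  exact ⟨m, rfl, fun h => hp.one_lt.ne' (Nat.isUnit_iff.1 (hn p (mul_dvd_mul_left p h)))⟩

theorem exists_prime_of_four_dvd_card_divisors {n : ℕ} (hn : Squarefree n)
    (h : 4 ∣ n.divisors.card) :
    ∃ p m : ℕ, p.Prime ∧ n = p * m ∧ ¬ p ∣ m ∧ 2 ∣ m.divisors.card := by
  have h1 : n ≠ 1 := by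
    rintro rfl
    simp at h
  obtain ⟨p, hp, hpn⟩ := Nat.exists_prime_and_dvd h1
  obtain ⟨m, rfl, hpm⟩ := squarefree_prime_factor hn hp hpn
  rw [card_divisors_prime_mul hp hpm] at h
  exact ⟨p, m, hp, rfl, hpm, by omega⟩

theorem four_dvd_or_of_eight_dvd_mul {x y : ℕ} (h : 8 ∣ x * y) : 4 ∣ x ∨ 4 ∣ y := by
  by_contra! hc
  have hx : x % 4 = 1 ∨ x % 4 = 2 ∨ x % 4 = 3 := by omega
  have hy : y % 4 = 1 ∨ y % 4 = 2 ∨ y % 4 = 3 := by omega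
  have hxy : (x * y) % 8 = ((x % 8) * (y % 8)) % 8 := Nat.mul_mod _ _ _
  have hx8 : x % 8 < 8 := Nat.mod_lt _ (by norm_num)
  have hy8 : y % 8 < 8 := Nat.mod_lt _ (by norm_num)
  have hx' : x % 8 % 4 = x % 4 := Nat.mod_mod_of_dvd _ (by norm_num)
  have hy' : y % 8 % 4 = y % 4 := Nat.mod_mod_of_dvd _ (by norm_num)
  generalize x % 8 = s at *
  generalize y % 8 = t at *
  have h0 : x * y % 8 = 0 := by omega
  interval_cases s <;> interval_cases t <;> omega

end Divisors

section EtaProduct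

open ModularForm Complex Real
open scoped NumberTheorySymbols

/-- The product of `η(v z)` over the divisors `v` of `N`. -/
def etaProd (N : ℕ) (z : ℂ) : ℂ := ∏ v ∈ N.divisors, η (v * z)

theorem etaProd_ne_zero (N : ℕ) {z : ℂ} (hz : 0 < z.im) : etaProd N z ≠ 0 := by
  refine Finset.prod_ne_zero_iff.2 fun v hv => ?_
  have hv0 : 0 < v := Nat.pos_of_mem_divisors hv
  apply eta_ne_zero
  show 0 < (v * z : ℂ).im
  simp only [Complex.mul_im, Complex.natCast_re, Complex.natCast_im, zero_mul, add_zero]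
  positivity

/-- The exponent `etaExp` of the matrix `(a w', u b; μ c, d w)`. -/
def divExp (a b c d : ℤ) (u μ w w' : ℤ) : ℤ := etaExp (a * w') (u * b) (μ * c) (d * w)

theorem divExp_eq (a b c d u μ w w' : ℤ) : divExp a b c d u μ w w' =
    9 * (d * w * (u * b - μ * c + 3) - 3) -
      8 * ((a * w' + d * w) * (μ * c) - u * b * (d * w) * ((μ * c) ^ 2 - 1)) := rfl

theorem eight_dvd_sum_divExp {M e : ℕ} (he : Odd e) (hs : Squarefree e) (a b c d : ℤ) (l : ℕ)
    (h1 : 8 ∣ l * (M.divisors.card * e.divisors.card))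
    (h2 : 8 ∣ l * ((∑ u ∈ M.divisors, u) * (∑ w ∈ e.divisors, w))) :
    (8 : ℤ) ∣ l * ∑ u ∈ M.divisors, ∑ w ∈ e.divisors,
      divExp a b c d u (M / u : ℕ) w (e / w : ℕ) := by
  have key : ∑ u ∈ M.divisors, ∑ w ∈ e.divisors,
      (d * w * (u * b - (M / u : ℕ) * c + 3) - 3 : ℤ) =
      d * ((∑ w ∈ e.divisors, w : ℕ) : ℤ) * ((b - c) * ((∑ u ∈ M.divisors, u : ℕ) : ℤ) +
        3 * M.divisors.card) - 3 * (M.divisors.card * e.divisors.card) := by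
    have hsum : ∑ u ∈ M.divisors, ((M / u : ℕ) : ℤ) = ((∑ u ∈ M.divisors, u : ℕ) : ℤ) := by
      rw [Nat.sum_div_divisors M (fun u => (u : ℤ))]
      push_cast
      rfl
    have h3 (u : ℕ) : ∑ w ∈ e.divisors, (d * w * (u * b - (M / u : ℕ) * c + 3) - 3 : ℤ) =
        d * ((∑ w ∈ e.divisors, w : ℕ) : ℤ) * (u * b - (M / u : ℕ) * c + 3) -
          3 * e.divisors.card := by
      rw [Finset.sum_sub_distrib, ← Finset.sum_mul, ← Finset.mul_sum, Finset.sum_const,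
        nsmul_eq_mul]
      push_cast
      ring
    simp_rw [h3]
    rw [Finset.sum_sub_distrib, ← Finset.mul_sum, Finset.sum_add_distrib, Finset.sum_sub_distrib,
      ← Finset.sum_mul, ← Finset.sum_mul, hsum, Finset.sum_const, Finset.sum_const, nsmul_eq_mul,
      nsmul_eq_mul]
    push_cast
    ring
  have hsplit : (∑ u ∈ M.divisors, ∑ w ∈ e.divisors,
      divExp a b c d u (M / u : ℕ) w (e / w : ℕ)) =
      9 * (∑ u ∈ M.divisors, ∑ w ∈ e.divisors,
      (d * w * (u * b - (M / u : ℕ) * c + 3) - 3 : ℤ)) - 8 *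
      ∑ u ∈ M.divisors, ∑ w ∈ e.divisors, ((a * (e / w : ℕ) + d * w) * ((M / u : ℕ) * c) -
        u * b * (d * w) * (((M / u : ℕ) * c) ^ 2 - 1) : ℤ) := by
    simp_rw [divExp_eq, Finset.mul_sum]
    rw [← Finset.sum_sub_distrib]
    exact Finset.sum_congr rfl fun u _ => Finset.sum_sub_distrib _ _
  obtain ⟨k, hk⟩ := card_divisors_dvd_sum_divisors hs he
  obtain ⟨x, hx⟩ := h1
  obtain ⟨y, hy⟩ := h2
  have hx' : (l : ℤ) * (M.divisors.card * e.divisors.card) = 8 * x := by exact_mod_cast hx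
  have hy' : (l : ℤ) * (((∑ u ∈ M.divisors, u : ℕ) : ℤ) * ((∑ w ∈ e.divisors, w : ℕ) : ℤ)) =
    8 * y := by exact_mod_cast hy
  have hk' : ((∑ w ∈ e.divisors, w : ℕ) : ℤ) = e.divisors.card * k := by exact_mod_cast hk
  rw [hsplit, key]
  refine ⟨9 * (d * (b - c) * y + 3 * d * k * x - 3 * x) - l *
    ∑ u ∈ M.divisors, ∑ w ∈ e.divisors, ((a * (e / w : ℕ) + d * w) * ((M / u : ℕ) * c) -
        u * b * (d * w) * (((M / u : ℕ) * c) ^ 2 - 1) : ℤ), ?_⟩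
  linear_combination (9 * d * (b - c)) * hy' + (27 * d * k - 27) * hx' +
    27 * l * d * M.divisors.card * hk'

theorem three_dvd_sum_divExp {M e : ℕ} (hs : Squarefree (M * e)) (a b c d : ℤ) (l : ℕ)
    (h2 : 3 ∣ l * (∑ u ∈ (M * e).divisors, u)) :
    (3 : ℤ) ∣ l * ∑ u ∈ M.divisors, ∑ w ∈ e.divisors,
      divExp a b c d u (M / u : ℕ) w (e / w : ℕ) := by
  rcases Nat.prime_three.dvd_mul.1 h2 with h | h
  · exact (Int.natCast_dvd_natCast.2 h).mul_right _
  · obtain ⟨p, hp, hpn, h3⟩ := exists_prime_of_three_dvd_sum_divisors hs h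
    have hpc : (p : ZMod 3) = -1 := by
      have : ((p + 1 : ℕ) : ZMod 3) = 0 := (ZMod.natCast_eq_zero_iff _ _).2 h3
      push_cast at this
      linear_combination this
    have h9 : (9 : ZMod 3) = 0 := by decide
    have h8 : (8 : ZMod 3) = -1 := by decide
    apply Dvd.dvd.mul_left
    apply three_dvd_of_intCast_eq_zero
    rcases hp.dvd_mul.1 hpn with h | h
    · obtain ⟨m, rfl, hpm⟩ := squarefree_prime_factor hs.of_mul_left hp h
      rw [sum_divisors_prime_mul hp hpm (fun u μ => ∑ w ∈ e.divisors,
        divExp a b c d u μ w (e / w : ℕ)), Int.cast_sum]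
      refine Finset.sum_eq_zero fun u _ => ?_
      rw [← Finset.sum_add_distrib, Int.cast_sum]
      refine Finset.sum_eq_zero fun w _ => ?_
      rw [divExp_eq, divExp_eq]
      push_cast
      rw [hpc, h9, h8]
      ring
    · obtain ⟨m, rfl, hpm⟩ := squarefree_prime_factor hs.of_mul_right hp h
      rw [Int.cast_sum]
      refine Finset.sum_eq_zero fun u _ => ?_
      rw [sum_divisors_prime_mul hp hpm (fun w w' => divExp a b c d u (M / u : ℕ) w w'),
        Int.cast_sum]
      refine Finset.sum_eq_zero fun w _ => ?_
      rw [divExp_eq, divExp_eq]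
      push_cast
      rw [hpc, h9, h8]
      ring

theorem zeta24_sum_divExp {M e : ℕ} (he : Odd e) (hs : Squarefree (M * e)) (a b c d : ℤ) (l : ℕ)
    (h1 : 8 ∣ l * (M * e).divisors.card) (h2 : 24 ∣ l * ∑ u ∈ (M * e).divisors, u) :
    (∏ u ∈ M.divisors, ∏ w ∈ e.divisors,
      zeta24 (divExp a b c d u (M / u : ℕ) w (e / w : ℕ))) ^ l = 1 := by
  have hc := (Nat.squarefree_mul_iff.1 hs).1
  have h3 := three_dvd_sum_divExp hs a b c d l (dvd_trans (by norm_num) h2)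
  have h8 := eight_dvd_sum_divExp (M := M) he hs.of_mul_right a b c d l
    (by rwa [← hc.card_divisors_mul])
    (by rw [← hc.sum_divisors_mul]; exact dvd_trans (by norm_num) h2)
  simp_rw [← zeta24_sum]
  rw [← zeta24_mul_nat]
  apply zeta24_eq_one
  omega

theorem sq_eq_one_of_jacobi {a b c d : ℤ} (h : a * d - b * c = 1) (hd : 0 < d) :
    J(c | d.toNat) ^ 2 = 1 := by
  apply jacobiSym.sq_one
  rw [Int.toNat_of_nonneg hd.le]
  exact Int.isCoprime_iff_gcd_eq_one.1 ⟨-b, a, by linear_combination h⟩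

theorem prod_jacobi {M e : ℕ} (hs : Squarefree (M * e)) {a b c d : ℤ}
    (hdet : e * a * d - M * b * c = 1) (hd : 0 < d) (l : ℕ)
    (h1 : 8 ∣ l * (M * e).divisors.card) :
    (∏ u ∈ M.divisors, ∏ w ∈ e.divisors,
      J((M / u : ℕ) * c | (d * w).toNat)) ^ l = 1 := by
  have hc := (Nat.squarefree_mul_iff.1 hs).1
  have hsq {u w : ℕ} (hu : u ∣ M) (hw : w ∣ e) (hM : 0 < M) (he : 0 < e) :
      J((M / u : ℕ) * c | (d * w).toNat) ^ 2 = 1 := by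
    have hw0 : 0 < w := Nat.pos_of_dvd_of_pos hw he
    refine sq_eq_one_of_jacobi (a := a * (e / w : ℕ)) (b := u * b) ?_ (by positivity)
    have hu' : (u : ℤ) * (M / u : ℕ) = M := by exact_mod_cast Nat.mul_div_cancel' hu
    have hw' : (w : ℤ) * (e / w : ℕ) = e := by exact_mod_cast Nat.mul_div_cancel' hw
    linear_combination hdet + a * d * hw' - b * c * hu'
  have hM : 0 < M := Nat.pos_of_ne_zero hs.of_mul_left.ne_zero
  have he : 0 < e := Nat.pos_of_ne_zero hs.of_mul_right.ne_zero
  have toNat_mul (w : ℕ) : (d * w).toNat = d.toNat * w := by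
    rw [Int.toNat_mul hd.le (by positivity), Int.toNat_natCast]
  rcases Nat.even_or_odd l with hl | hl
  · obtain ⟨k, rfl⟩ := hl
    rw [← two_mul, pow_mul, ← Finset.prod_pow, Finset.prod_eq_one, one_pow]
    intro u hu
    rw [← Finset.prod_pow, Finset.prod_eq_one]
    intro w hw
    exact hsq (Nat.dvd_of_mem_divisors hu) (Nat.dvd_of_mem_divisors hw) hM he
  · have h8 : 8 ∣ M.divisors.card * e.divisors.card := by
      rw [← hc.card_divisors_mul]
      refine Nat.Coprime.dvd_of_dvd_mul_left ?_ h1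
      exact Nat.Coprime.pow_left 3 (Nat.coprime_two_left.2 hl)
    suffices h : (∏ u ∈ M.divisors, ∏ w ∈ e.divisors,
        J((M / u : ℕ) * c | (d * w).toNat)) = 1 by rw [h, one_pow]
    rcases four_dvd_or_of_eight_dvd_mul h8 with h4 | h4
    · obtain ⟨p, m, hp, rfl, hpm, hm2⟩ :=
        exists_prime_of_four_dvd_card_divisors hs.of_mul_left h4
      rw [Finset.prod_comm]
      refine Finset.prod_eq_one fun w hw => ?_
      have hwe := Nat.dvd_of_mem_divisors hw
      have hw0 : 0 < w := Nat.pos_of_dvd_of_pos hwe he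
      rw [prod_divisors_prime_mul hp hpm (fun u μ => J(μ * c | (d * w).toNat))]
      have hpair (u : ℕ) (hu : u ∈ m.divisors) : J((p * (m / u) : ℕ) * c | (d * w).toNat) *
          J((m / u : ℕ) * c | (d * w).toNat) = J(p | (d * w).toNat) := by
        have hum := Nat.dvd_of_mem_divisors hu
        have h1 := hsq (u := p * u) (w := w) (mul_dvd_mul_left p hum) hwe hM he
        rw [Nat.mul_div_mul_left _ _ hp.pos] at h1
        rw [Nat.cast_mul, mul_assoc, jacobiSym.mul_left, mul_assoc, ← sq, h1, mul_one]
      rw [Finset.prod_congr rfl hpair, Finset.prod_const]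
      obtain ⟨t, ht⟩ := hm2
      rw [ht, pow_mul]
      have : J(p | (d * w).toNat) ^ 2 = 1 := by
        apply jacobiSym.sq_one
        rw [Int.toNat_of_nonneg (by positivity)]
        refine Int.isCoprime_iff_gcd_eq_one.1 ⟨-m * b * c, a * (e / w : ℕ), ?_⟩
        have hw' : (w : ℤ) * (e / w : ℕ) = e := by exact_mod_cast Nat.mul_div_cancel' hwe
        push_cast at hdet hw' ⊢
        linear_combination hdet + a * d * hw'
      rw [this, one_pow]
    · obtain ⟨p, m, hp, rfl, hpm, hm2⟩ :=
        exists_prime_of_four_dvd_card_divisors hs.of_mul_right h4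
      refine Finset.prod_eq_one fun u hu => ?_
      have huM := Nat.dvd_of_mem_divisors hu
      rw [← prod_divisors_prime_mul hp hpm (fun w w' => J((M / u : ℕ) * c | (d * w).toNat)) |>.symm]
      have hpair (w : ℕ) (hw : w ∈ m.divisors) : J((M / u : ℕ) * c | (d * w).toNat) *
          J((M / u : ℕ) * c | (d * (p * w : ℕ)).toNat) = J((M / u : ℕ) * c | p) := by
        have hwm := Nat.dvd_of_mem_divisors hw
        have hm0 : 0 < m := Nat.pos_of_ne_zero fun h => by simp [h] at hpm
        have hw0 : 0 < w := Nat.pos_of_dvd_of_pos hwm hm0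
        have h1 := hsq (u := u) (w := w) huM (hwm.mul_left p) hM he
        rw [toNat_mul] at h1
        have : NeZero p := ⟨hp.ne_zero⟩
        have : NeZero w := ⟨hw0.ne'⟩
        have : NeZero d.toNat := ⟨(Int.pos_iff_toNat_pos.1 hd).ne'⟩
        rw [toNat_mul, toNat_mul, show d.toNat * (p * w) = (d.toNat * w) * p by ring,
          jacobiSym.mul_right _ (d.toNat * w) p, ← mul_assoc, ← sq, h1, one_mul]
      rw [Finset.prod_congr rfl hpair, Finset.prod_const]
      obtain ⟨t, ht⟩ := hm2
      rw [ht, pow_mul]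
      have : J((M / u : ℕ) * c | p) ^ 2 = 1 := by
        apply jacobiSym.sq_one
        refine Int.isCoprime_iff_gcd_eq_one.1 ⟨-u * b, m * a * d, ?_⟩
        have hu' : (u : ℤ) * (M / u : ℕ) = M := by exact_mod_cast Nat.mul_div_cancel' huM
        push_cast at hdet hu' ⊢
        linear_combination hdet - b * c * hu'
      rw [this, one_pow]

theorem prod_sqrt_divisors (M e l κ : ℕ) (he : 0 < e)
    (h : l * (M.divisors.card * e.divisors.card) = 2 * κ) :
    (∏ _u ∈ M.divisors, ∏ w ∈ e.divisors, Real.sqrt w) ^ l = Real.sqrt e ^ κ := by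
  set X := ∏ w ∈ e.divisors, Real.sqrt w with hX
  have hX0 : 0 ≤ X := Finset.prod_nonneg fun _ _ => Real.sqrt_nonneg _
  have h2 : X ^ 2 = ∏ w ∈ e.divisors, (w : ℝ) := by
    rw [hX, ← Finset.prod_pow]
    exact Finset.prod_congr rfl fun w _ => Real.sq_sqrt (Nat.cast_nonneg w)
  have h4 : (X ^ 2) ^ 2 = (Real.sqrt e ^ e.divisors.card) ^ 2 := by
    rw [h2, ← pow_mul, mul_comm, pow_mul, Real.sq_sqrt (Nat.cast_nonneg e)]
    rw [← Nat.cast_prod]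
    exact_mod_cast prod_divisors_sq e
  have h5 : X ^ 2 = Real.sqrt e ^ e.divisors.card :=
    (pow_left_inj₀ (by positivity) (by positivity) two_ne_zero).1 h4
  rw [Finset.prod_const, ← pow_mul]
  apply (pow_left_inj₀ (by positivity) (by positivity) two_ne_zero).1
  rw [← pow_mul, mul_comm (M.divisors.card * l), pow_mul, h5, ← pow_mul, ← pow_mul]
  congr 1
  linarith

theorem etaProd_pow_transform {M e : ℕ} (he : Odd e) (hs : Squarefree (M * e)) {a b c d : ℤ}
    (hdet : e * a * d - M * b * c = 1) (hd : Odd d) (hd0 : 0 < d) {l κ : ℕ}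
    (h1 : l * (M * e).divisors.card = 2 * κ) (h4 : 4 ∣ κ)
    (h2 : 24 ∣ l * ∑ u ∈ (M * e).divisors, u) {z : ℂ} (hz : 0 < z.im) :
    etaProd (M * e) ((e * a * z + b) / (e * (M * c * z + d))) ^ l =
      (Real.sqrt e * (M * c * z + d)) ^ κ * etaProd (M * e) z ^ l := by
  have hc := (Nat.squarefree_mul_iff.1 hs).1
  have he0 : 0 < e := he.pos
  have h8 : 8 ∣ l * (M * e).divisors.card := by omega
  set s := Complex.sqrt (M * c * z + d) with hsdef
  have hs0 : 0 < s.re := by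
    have := csqrt_affine_re_pos (c := M * c) (d := d) (by exact_mod_cast hd0) hz
    push_cast at this
    exact this
  have hterm (u : ℕ) (hu : u ∈ M.divisors) (w : ℕ) (hw : w ∈ e.divisors) :
      η (((u * (e / w : ℕ) : ℕ) : ℂ) * ((e * a * z + b) / (e * (M * c * z + d)))) =
        (J((M / u : ℕ) * c | (d * w).toNat) : ℂ) *
          zeta24 (divExp a b c d u (M / u : ℕ) w (e / w : ℕ)) *
          ((Real.sqrt w : ℂ) * s * η ((u * w : ℕ) * z)) := by
    have hw0 : 0 < w := Nat.pos_of_mem_divisors hw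
    have hu0 : 0 < u := Nat.pos_of_mem_divisors hu
    have hu' : (u : ℤ) * (M / u : ℕ) = M := by
      exact_mod_cast Nat.mul_div_cancel' (Nat.dvd_of_mem_divisors hu)
    have hw' : (w : ℤ) * (e / w : ℕ) = e := by
      exact_mod_cast Nat.mul_div_cancel' (Nat.dvd_of_mem_divisors hw)
    have hodd : Odd (d * w) := by
      refine hd.mul ?_
      exact_mod_cast he.of_dvd_nat (Nat.dvd_of_mem_divisors hw)
    have hz' : 0 < ((u * w : ℕ) * z : ℂ).im := by
      simp only [Complex.mul_im, Complex.natCast_re, Complex.natCast_im, zero_mul, add_zero]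
      positivity
    have h := eta_transforms (a * (e / w : ℕ)) (u * b) ((M / u : ℕ) * c) (d * w)
      (by linear_combination hdet + a * d * hw' - b * c * hu') hodd (by positivity) _ hz'
    have huC : (u : ℂ) * (M / u : ℕ) = M := by exact_mod_cast hu'
    have hwC : (w : ℂ) * (e / w : ℕ) = e := by exact_mod_cast hw'
    have hden : ((((M / u : ℕ) * c : ℤ) : ℂ) * ((u * w : ℕ) * z) + ((d * w : ℤ) : ℂ)) =
        ((w : ℝ) : ℂ) * (M * c * z + d) := by
      simp only [Int.cast_mul, Int.cast_natCast, Nat.cast_mul, Complex.ofReal_natCast]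
      linear_combination c * w * z * huC
    have hnum : (((a * (e / w : ℕ) : ℤ) : ℂ) * ((u * w : ℕ) * z) + ((u * b : ℤ) : ℂ)) =
        u * (e * a * z + b) := by
      simp only [Int.cast_mul, Int.cast_natCast, Nat.cast_mul]
      linear_combination a * u * z * hwC
    rw [hden, hnum, csqrt_ofReal_mul (by exact_mod_cast hw0) _ hs0, ← hsdef] at h
    rw [divExp, ← h]
    congr 1
    have hwne : (w : ℂ) ≠ 0 := by exact_mod_cast hw0.ne'
    rw [← hwC]
    push_cast
    rcases eq_or_ne (M * c * z + d : ℂ) 0 with h0 | h0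
    · simp [h0]
    · have he'ne : ((e / w : ℕ) : ℂ) ≠ 0 := by
        intro h
        rw [h, mul_zero] at hwC
        exact he0.ne' (by exact_mod_cast hwC.symm)
      field_simp
  have hreindex (z' : ℂ) : etaProd (M * e) z' =
      ∏ u ∈ M.divisors, ∏ w ∈ e.divisors, η (((u * (e / w : ℕ) : ℕ) : ℂ) * z') := by
    rw [etaProd, prod_divisors_coprime_mul hc (fun v => η (v * z'))]
    exact Finset.prod_congr rfl fun u _ =>
      (Nat.prod_div_divisors e (fun w => η (((u * w : ℕ) : ℂ) * z'))).symm
  rw [hreindex, Finset.prod_congr rfl fun u hu => Finset.prod_congr rfl (hterm u hu)]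
  simp only [Finset.prod_mul_distrib, mul_pow]
  rw [zeta24_sum_divExp he hs a b c d l h8 h2]
  have hJ := congrArg (Int.cast : ℤ → ℂ) (prod_jacobi hs hdet hd0 l h8)
  simp only [Int.cast_pow, Int.cast_prod, Int.cast_one] at hJ
  rw [hJ]
  have hS := congrArg (Complex.ofReal) (prod_sqrt_divisors M e l κ he0
    (by rw [← hc.card_divisors_mul]; exact h1))
  push_cast at hS
  rw [hS, etaProd, prod_divisors_coprime_mul hc (fun v => η (v * z))]
  have hs2 : (∏ _u ∈ M.divisors, ∏ _w ∈ e.divisors, s) ^ l = (M * c * z + d) ^ κ := by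
    rw [Finset.prod_const, Finset.prod_const, ← pow_mul, ← pow_mul]
    rw [show e.divisors.card * (M.divisors.card * l) = 2 * κ by
      rw [← h1, hc.card_divisors_mul]; ring, pow_mul, csqrt_sq]
  rw [hs2]
  ring

end EtaProduct

section SlashSL

open Matrix
open scoped ModularForm

theorem sigma_toGL (γ : SL(2, ℝ)) : σ (SpecialLinearGroup.toGL γ) = ContinuousAlgEquiv.refl ℝ ℂ := by
  rw [σ, if_pos]
  simp

theorem slash_toGL_apply (f : ℍ → ℂ) (k : ℤ) (γ : SL(2, ℝ)) (z : ℍ) :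
    (f ∣[k] SpecialLinearGroup.toGL γ) z =
      f (SpecialLinearGroup.toGL γ • z) * denom (SpecialLinearGroup.toGL γ) z ^ (-k) := by
  rw [ModularForm.slash_apply, sigma_toGL]
  simp

theorem coe_smul_of_coe_eq {γ : SL(2, ℝ)} {t a b c d : ℝ} (ht : t ≠ 0)
    (hγ : (γ : Matrix (Fin 2) (Fin 2) ℝ) = t • !![a, b; c, d]) (z : ℍ) :
    ((SpecialLinearGroup.toGL γ • z : ℍ) : ℂ) = (a * z + b) / (c * z + d) := by
  rw [coe_smul_of_det_pos (by simp), num, denom]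
  have ht' : (t : ℂ) ≠ 0 := by exact_mod_cast ht
  simp only [SpecialLinearGroup.toGL, hγ, MonoidHom.coe_mk, OneHom.coe_mk]
  rw [← mul_div_mul_left (a * z + b : ℂ) _ ht']
  simp
  ring_nf

theorem denom_of_coe_eq {γ : SL(2, ℝ)} {t a b c d : ℝ}
    (hγ : (γ : Matrix (Fin 2) (Fin 2) ℝ) = t • !![a, b; c, d]) (z : ℂ) :
    denom (SpecialLinearGroup.toGL γ) z = t * (c * z + d) := by
  rw [denom]
  simp only [SpecialLinearGroup.toGL, hγ, MonoidHom.coe_mk, OneHom.coe_mk]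
  simp
  ring

theorem slash_eq_iff (f : ℍ → ℂ) (k : ℕ) (γ : SL(2, ℝ)) :
    f ∣[(k : ℤ)] SpecialLinearGroup.toGL γ = f ↔
      ∀ z : ℍ, f (SpecialLinearGroup.toGL γ • z) = denom (SpecialLinearGroup.toGL γ) z ^ k * f z := by
  rw [funext_iff]
  refine forall_congr' fun z => ?_
  have h0 := denom_ne_zero (SpecialLinearGroup.toGL γ) z
  rw [slash_toGL_apply, _root_.zpow_neg, zpow_natCast]
  constructor
  · intro h
    rw [← h]
    field_simp
  · intro h
    rw [h]
    field_simp

/-- The subgroup of `SL(2, ℝ)` fixing a function under the slash action of weight `k`. -/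
def slashStabilizer (f : ℍ → ℂ) (k : ℤ) : Subgroup SL(2, ℝ) where
  carrier := {γ | f ∣[k] SpecialLinearGroup.toGL γ = f}
  one_mem' := by simp
  mul_mem' := by
    intro a b ha hb
    rw [Set.mem_ofPred_eq] at *
    rw [map_mul, SlashAction.slash_mul, ha, hb]
  inv_mem' := by
    intro a ha
    rw [Set.mem_ofPred_eq] at *
    nth_rw 1 [← ha]
    rw [← SlashAction.slash_mul, ← map_mul, mul_inv_cancel, map_one, SlashAction.slash_one]

theorem mem_slashStabilizer {f : ℍ → ℂ} {k : ℤ} {γ : SL(2, ℝ)} :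
    γ ∈ slashStabilizer f k ↔ f ∣[k] SpecialLinearGroup.toGL γ = f := Iff.rfl

end SlashSL

section Invariance

open ModularForm Complex Real Matrix

theorem etaProd_add_int {N l : ℕ} (h : 24 ∣ l * ∑ v ∈ N.divisors, v) (z : ℂ) (n : ℤ) :
    etaProd N (z + n) ^ l = etaProd N z ^ l := by
  have h1 (v : ℕ) : η (v * (z + n)) = zeta24 (v * n) * η (v * z) := by
    rw [mul_add, ← eta_add_int]
    push_cast
    rfl
  rw [etaProd, etaProd, Finset.prod_congr rfl fun v _ => h1 v, Finset.prod_mul_distrib, mul_pow,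
    ← zeta24_sum, ← zeta24_mul_nat, zeta24_eq_one, one_mul]
  rw [← Finset.sum_mul, ← mul_assoc]
  apply Dvd.dvd.mul_right
  rw [← Nat.cast_sum]
  exact_mod_cast h

theorem etaProd_fricke {N l κ : ℕ} (hN : 0 < N) (h1 : l * N.divisors.card = 2 * κ) (h4 : 4 ∣ κ)
    {z : ℂ} (hz : 0 < z.im) :
    etaProd N (-1 / (N * z)) ^ l = (Real.sqrt N * z) ^ κ * etaProd N z ^ l := by
  have hz0 : z ≠ 0 := fun h => by simp [h] at hz
  have hterm (v : ℕ) (hv : v ∈ N.divisors) : η ((N / v : ℕ) * (-1 / (N * z))) =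
      (Real.sqrt v : ℂ) * ((Complex.sqrt Complex.I)⁻¹ * Complex.sqrt z) * η (v * z) := by
    have hv0 : 0 < v := Nat.pos_of_mem_divisors hv
    have hvC : (v : ℂ) * (N / v : ℕ) = N := by
      exact_mod_cast Nat.mul_div_cancel' (Nat.dvd_of_mem_divisors hv)
    have hvz : 0 < ((v : ℂ) * z).im := by
      simp only [Complex.mul_im, Complex.natCast_re, Complex.natCast_im, zero_mul, add_zero]
      positivity
    have : ((N / v : ℕ) : ℂ) * (-1 / (N * z)) = -1 / (v * z) := by
      rw [← hvC]
      have h2 : ((N / v : ℕ) : ℂ) ≠ 0 := by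
        intro h
        rw [h, mul_zero] at hvC
        exact hN.ne' (by exact_mod_cast hvC.symm)
      have h3 : (v : ℂ) ≠ 0 := by exact_mod_cast hv0.ne'
      field_simp
    rw [this, eta_neg_inv hvz]
    have := csqrt_ofReal_mul (t := v) (by exact_mod_cast hv0) z (csqrt_re_pos_of_im_ne hz.ne')
    rw [Complex.ofReal_natCast] at this
    rw [this]
    ring
  rw [etaProd, ← Nat.prod_div_divisors N (fun v => η (v * (-1 / (N * z)))),
    Finset.prod_congr rfl hterm, Finset.prod_mul_distrib, Finset.prod_mul_distrib, mul_pow, mul_pow,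
    etaProd, Finset.prod_const, ← pow_mul, mul_comm N.divisors.card, h1, pow_mul]
  have hS := congrArg (Complex.ofReal) (prod_sqrt_divisors 1 N l κ hN (by simpa using h1))
  rw [Nat.divisors_one, Finset.prod_singleton] at hS
  push_cast at hS
  rw [hS, mul_pow, csqrt_sq, inv_pow, csqrt_sq]
  obtain ⟨m, rfl⟩ := h4
  rw [mul_pow (Complex.I⁻¹), pow_mul Complex.I⁻¹, inv_pow, Complex.I_pow_four, inv_one, one_pow]
  ring

theorem exists_odd_pos_shift {d m : ℤ} (h : Odd d ∨ Odd m) (hm : m ≠ 0) :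
    ∃ j : ℤ, Odd (d + j * m) ∧ 0 < d + j * m := by
  have hm2 : 1 ≤ m * m := by
    have := mul_self_pos.2 hm
    omega
  have hpos (J : ℤ) (hJ : |d| + 1 ≤ J) : 0 < d + J * m * m := by
    have h1 := neg_abs_le d
    have : J ≤ J * (m * m) := le_mul_of_one_le_right (by have := abs_nonneg d; omega) hm2
    linarith
  rcases Int.even_or_odd m with he | ho
  · refine ⟨(|d| + 1) * m, ?_, hpos _ le_rfl⟩
    have hd := h.resolve_right (Int.not_odd_iff_even.2 he)
    exact hd.add_even (he.mul_left _)
  · rcases Int.even_or_odd (d + (|d| + 1)) with h1 | h1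
    · refine ⟨(|d| + 2) * m, ?_, hpos _ (by omega)⟩
      have : d + (|d| + 2) * m * m = (d + (|d| + 1)) + 1 + (|d| + 2) * (m * m - 1) := by ring
      rw [this]
      exact h1.add_one.add_even (((ho.mul ho).sub_odd odd_one).mul_left _)
    · refine ⟨(|d| + 1) * m, ?_, hpos _ le_rfl⟩
      have : d + (|d| + 1) * m * m = (d + (|d| + 1)) + (|d| + 1) * (m * m - 1) := by ring
      rw [this]
      exact h1.add_even (((ho.mul ho).sub_odd odd_one).mul_left _)

/-- The function `z ↦ (∏_{v ∣ N} η(v z)) ^ l` on the upper half-plane. -/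
def etaProdPow (N l : ℕ) (z : ℍ) : ℂ := etaProd N z ^ l

variable {N l κ : ℕ}

theorem transvection_mem (h2 : 24 ∣ l * ∑ u ∈ N.divisors, u) (n : ℤ) {γ : SL(2, ℝ)}
    (hγ : (γ : Matrix (Fin 2) (Fin 2) ℝ) = !![1, (n : ℝ); 0, 1]) :
    γ ∈ slashStabilizer (etaProdPow N l) (κ : ℤ) := by
  have hγ' : (γ : Matrix (Fin 2) (Fin 2) ℝ) = (1 : ℝ) • !![1, (n : ℝ); 0, 1] := by
    rw [one_smul, hγ]
  rw [mem_slashStabilizer, slash_eq_iff]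
  intro z
  rw [etaProdPow, etaProdPow, coe_smul_of_coe_eq one_ne_zero hγ', denom_of_coe_eq hγ']
  simpa using etaProd_add_int h2 z n

theorem neg_one_mem_slashStabilizer (f : ℍ → ℂ) (hκ : Even κ) :
    (-1 : SL(2, ℝ)) ∈ slashStabilizer f (κ : ℤ) := by
  have hγ' : ((-1 : SL(2, ℝ)) : Matrix (Fin 2) (Fin 2) ℝ) = (1 : ℝ) • !![(-1 : ℝ), 0; 0, -1] := by
    ext i j
    fin_cases i <;> fin_cases j <;> simp
  rw [mem_slashStabilizer, slash_eq_iff]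
  intro z
  have : SpecialLinearGroup.toGL (-1 : SL(2, ℝ)) • z = z := by
    ext
    rw [coe_smul_of_coe_eq one_ne_zero hγ']
    simp
  rw [this, denom_of_coe_eq hγ']
  simp [hκ.neg_one_pow]

/-- The Fricke involution `(0 -1; N 0) / √N`. -/
def fricke (N : ℕ) (hN : 0 < N) : SL(2, ℝ) :=
  ⟨(Real.sqrt N)⁻¹ • !![0, -1; (N : ℝ), 0], by
    have : (0 : ℝ) < N := by exact_mod_cast hN
    rw [det_smul]
    simp [inv_pow, Real.sq_sqrt this.le, this.ne']⟩

theorem coe_fricke (hN : 0 < N) : (fricke N hN : Matrix (Fin 2) (Fin 2) ℝ) =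
    (Real.sqrt N)⁻¹ • !![0, -1; (N : ℝ), 0] := rfl

theorem fricke_mem (hN : 0 < N) (h1 : l * N.divisors.card = 2 * κ) (h4 : 4 ∣ κ) :
    fricke N hN ∈ slashStabilizer (etaProdPow N l) (κ : ℤ) := by
  have hs : Real.sqrt N ≠ 0 := (Real.sqrt_pos.2 (by exact_mod_cast hN)).ne'
  rw [mem_slashStabilizer, slash_eq_iff]
  intro z
  rw [etaProdPow, etaProdPow, coe_smul_of_coe_eq (inv_ne_zero hs) (coe_fricke hN),
    denom_of_coe_eq (coe_fricke hN)]
  have := etaProd_fricke hN h1 h4 z.im_pos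
  have hsN : (Real.sqrt N : ℂ) * Real.sqrt N = N := by
    rw [← Complex.ofReal_mul, Real.mul_self_sqrt (Nat.cast_nonneg N), Complex.ofReal_natCast]
  have hsC : (Real.sqrt N : ℂ) ≠ 0 := by exact_mod_cast hs
  have h3 : (((Real.sqrt N)⁻¹ : ℝ) : ℂ) * (((N : ℝ) : ℂ) * z + ((0 : ℝ) : ℂ)) = Real.sqrt N * z := by
    rw [Complex.ofReal_natCast, ← hsN]
    push_cast
    field_simp
    ring
  rw [h3, ← this]
  simp

theorem atkinLehner_odd_pos_mem {M e : ℕ} (he : Odd e) (hs : Squarefree (M * e)) {a b c d : ℤ}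
    (hdet : e * a * d - M * b * c = 1) (hd : Odd d) (hd0 : 0 < d)
    (h1 : l * (M * e).divisors.card = 2 * κ) (h4 : 4 ∣ κ)
    (h2 : 24 ∣ l * ∑ u ∈ (M * e).divisors, u) {γ : SL(2, ℝ)}
    (hγ : (γ : Matrix (Fin 2) (Fin 2) ℝ) =
      (Real.sqrt e)⁻¹ • !![(e * a : ℝ), (b : ℝ); (e * (M * c) : ℝ), (e * d : ℝ)]) :
    γ ∈ slashStabilizer (etaProdPow (M * e) l) (κ : ℤ) := by
  have hse : Real.sqrt e ≠ 0 := (Real.sqrt_pos.2 (by exact_mod_cast he.pos)).ne'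
  rw [mem_slashStabilizer, slash_eq_iff]
  intro z
  rw [etaProdPow, etaProdPow, coe_smul_of_coe_eq (inv_ne_zero hse) hγ, denom_of_coe_eq hγ]
  have := etaProd_pow_transform he hs hdet hd hd0 h1 h4 h2 z.im_pos
  have hsN : (Real.sqrt e : ℂ) * Real.sqrt e = e := by
    rw [← Complex.ofReal_mul, Real.mul_self_sqrt (Nat.cast_nonneg e), Complex.ofReal_natCast]
  have hsC : (Real.sqrt e : ℂ) ≠ 0 := by exact_mod_cast hse
  have h3 : (((Real.sqrt e)⁻¹ : ℝ) : ℂ) * (((e * (M * c) : ℝ) : ℂ) * z + ((e * d : ℝ) : ℂ)) =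
      Real.sqrt e * (M * c * z + d) := by
    push_cast
    rw [← hsN]
    field_simp
  rw [h3, ← this]
  push_cast
  congr 2
  ring

theorem atkinLehner_odd_mem {M e : ℕ} (he : Odd e) (hs : Squarefree (M * e)) {a b c d : ℤ}
    (hdet : e * a * d - M * b * c = 1)
    (h1 : l * (M * e).divisors.card = 2 * κ) (h4 : 4 ∣ κ)
    (h2 : 24 ∣ l * ∑ u ∈ (M * e).divisors, u) {γ : SL(2, ℝ)}
    (hγ : (γ : Matrix (Fin 2) (Fin 2) ℝ) =
      (Real.sqrt e)⁻¹ • !![(e * a : ℝ), (b : ℝ); (e * (M * c) : ℝ), (e * d : ℝ)]) :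
    γ ∈ slashStabilizer (etaProdPow (M * e) l) (κ : ℤ) := by
  have hκ : Even κ := (even_iff_two_dvd.2 (dvd_trans (by norm_num) h4))
  rcases eq_or_ne (M * c) 0 with h0 | h0
  · have hunit : (d * (e * a) : ℤ) = 1 := by linear_combination hdet + b * h0
    rcases Int.eq_one_or_neg_one_of_mul_eq_one hunit with rfl | rfl
    · exact atkinLehner_odd_pos_mem he hs hdet odd_one one_pos h1 h4 h2 hγ
    · rw [← neg_neg γ, ← neg_one_mul (-γ)]
      refine mul_mem (neg_one_mem_slashStabilizer _ hκ) ?_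
      refine atkinLehner_odd_pos_mem (a := -a) (b := -b) (c := -c) (d := 1) he hs
        (by linear_combination hdet) odd_one one_pos h1 h4 h2 ?_
      rw [SpecialLinearGroup.coe_neg, hγ]
      ext i j
      fin_cases i <;> fin_cases j <;> simp
  · have hodd : Odd d ∨ Odd (M * c) := by
      by_contra! hc
      rw [Int.not_odd_iff_even, Int.not_odd_iff_even] at hc
      have h3 : Even ((e : ℤ) * a * d - M * b * c) := by
        rw [show (e : ℤ) * a * d - M * b * c = (e * a) * d - b * (M * c) by ring]
        exact (hc.1.mul_left _).sub (hc.2.mul_left _)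
      rw [hdet] at h3
      exact absurd h3 (by decide)
    obtain ⟨j, hj1, hj2⟩ := exists_odd_pos_shift hodd h0
    let T : SL(2, ℝ) := ⟨!![1, (j : ℝ); 0, 1], by simp⟩
    have hT : T ∈ slashStabilizer (etaProdPow (M * e) l) (κ : ℤ) := transvection_mem h2 j rfl
    rw [← Subgroup.mul_mem_cancel_right _ hT]
    refine atkinLehner_odd_pos_mem (a := a) (b := b + j * (e * a)) (c := c) (d := d + j * (M * c))
      he hs (by linear_combination hdet) hj1 hj2 h1 h4 h2 ?_
    have hmul : ((γ * T : SL(2, ℝ)) : Matrix (Fin 2) (Fin 2) ℝ) =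
      (γ : Matrix (Fin 2) (Fin 2) ℝ) * (T : Matrix (Fin 2) (Fin 2) ℝ) :=
      Matrix.SpecialLinearGroup.coe_mul γ T
    refine hmul.trans ?_
    rw [hγ]
    ext i k
    fin_cases i <;> fin_cases k <;> simp [T] <;> ring

theorem atkinLehner_mem {M e : ℕ} (hs : Squarefree (M * e)) {a b c d : ℤ}
    (hdet : e * a * d - M * b * c = 1)
    (h1 : l * (M * e).divisors.card = 2 * κ) (h4 : 4 ∣ κ)
    (h2 : 24 ∣ l * ∑ u ∈ (M * e).divisors, u) {γ : SL(2, ℝ)}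
    (hγ : (γ : Matrix (Fin 2) (Fin 2) ℝ) =
      (Real.sqrt e)⁻¹ • !![(e * a : ℝ), (b : ℝ); (e * (M * c) : ℝ), (e * d : ℝ)]) :
    γ ∈ slashStabilizer (etaProdPow (M * e) l) (κ : ℤ) := by
  rcases Nat.even_or_odd e with he | he
  · have hM : Odd M := by
      by_contra! h
      rw [Nat.not_odd_iff_even] at h
      exact absurd (hs 2 (mul_dvd_mul h.two_dvd he.two_dvd)) (by decide)
    have he0 : 0 < e := Nat.pos_of_ne_zero hs.of_mul_right.ne_zero
    have hpos : 0 < M * e := Nat.mul_pos hM.pos he0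
    have hW := fricke_mem (N := M * e) hpos h1 h4
    rw [← Subgroup.mul_mem_cancel_right _ hW]
    have heR : (0 : ℝ) < e := by exact_mod_cast he0
    have hMR : (0 : ℝ) < M := by exact_mod_cast hM.pos
    have hes0 := (Real.sqrt_pos.2 heR).ne'
    have hMs0 := (Real.sqrt_pos.2 hMR).ne'
    generalize hf : fricke (M * e) hpos = W at *
    have hWc := coe_fricke hpos
    rw [hf] at hWc
    clear hf
    rw [mul_comm M e] at hs h1 h2 hW ⊢
    refine atkinLehner_odd_mem (a := b) (b := -a) (c := d) (d := -c) hM hs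
      (by linear_combination hdet) h1 h4 h2 ?_
    have hmul : ((γ * W : SL(2, ℝ)) : Matrix (Fin 2) (Fin 2) ℝ) =
      (γ : Matrix (Fin 2) (Fin 2) ℝ) * (W : Matrix (Fin 2) (Fin 2) ℝ) :=
      Matrix.SpecialLinearGroup.coe_mul γ W
    refine hmul.trans ?_
    rw [hγ, hWc, Nat.cast_mul, Real.sqrt_mul hMR.le,
      Matrix.smul_mul, Matrix.mul_smul, smul_smul]
    ext i k
    fin_cases i <;> fin_cases k <;> simp <;> field_simp <;> rw [Real.sq_sqrt heR.le] <;> ring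
  · exact atkinLehner_odd_mem he hs hdet h1 h4 h2 hγ

theorem exists_of_mem_gamma0Plus {N : ℕ} {γ : SL(2, ℝ)} (h : γ ∈ Gamma0Plus N) (hN : Squarefree N) :
    ∃ (M e : ℕ) (a b c d : ℤ), N = M * e ∧ (e * a * d - M * b * c = 1) ∧
      (γ : Matrix (Fin 2) (Fin 2) ℝ) =
      (Real.sqrt e)⁻¹ • !![(e * a : ℝ), (b : ℝ); (e * (M * c) : ℝ), (e * d : ℝ)] := by
  obtain ⟨a, b, c, d, e, he, hdet, heN, ⟨a', rfl⟩, ⟨d', rfl⟩, ⟨c', rfl⟩, hγ⟩ := h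
  obtain ⟨e, rfl⟩ := Int.eq_ofNat_of_zero_le he.le
  obtain ⟨M, rfl⟩ := Int.natCast_dvd_natCast.1 heN
  refine ⟨M, e, a', b, c', d', mul_comm _ _, ?_, ?_⟩
  · apply mul_left_cancel₀ he.ne'
    push_cast at hdet
    linear_combination hdet
  · rw [hγ]
    have h3 : (((e * M : ℕ) : ℤ) * c' : ℤ) = (e * (M * c') : ℤ) := by
      push_cast
      ring
    rw [h3]
    push_cast
    rfl

theorem gamma0Plus_le_slashStabilizer (hN : Squarefree N)
    (h1 : l * N.divisors.card = 2 * κ) (h4 : 4 ∣ κ)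
    (h2 : 24 ∣ l * ∑ u ∈ N.divisors, u) :
    Gamma0Plus N ≤ slashStabilizer (etaProdPow N l) (κ : ℤ) := by
  intro γ hγ
  obtain ⟨M, e, a, b, c, d, rfl, hdet, hcoe⟩ := exists_of_mem_gamma0Plus hγ hN
  exact atkinLehner_mem hN hdet h1 h4 h2 hcoe

end Invariance

section CuspConditions

open Matrix OnePoint
open scoped ModularForm Manifold

theorem mapGL_apply_eq (γ : SL(2, ℤ)) :
    (SpecialLinearGroup.mapGL ℝ γ : Matrix (Fin 2) (Fin 2) ℝ) =
      !![(γ 0 0 : ℝ), (γ 0 1 : ℝ); (γ 1 0 : ℝ), (γ 1 1 : ℝ)] := by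
  ext i k
  fin_cases i <;> fin_cases k <;> simp

theorem mapGL_eq_toGL_mul {γ : SL(2, ℤ)} {W U : SL(2, ℝ)}
    (h : (W : Matrix (Fin 2) (Fin 2) ℝ) * (U : Matrix (Fin 2) (Fin 2) ℝ) =
      !![(γ 0 0 : ℝ), (γ 0 1 : ℝ); (γ 1 0 : ℝ), (γ 1 1 : ℝ)]) :
    SpecialLinearGroup.mapGL ℝ γ = SpecialLinearGroup.toGL W * SpecialLinearGroup.toGL U :=
  Units.ext ((mapGL_apply_eq γ).trans h.symm)

/-- Every element of `SL(2, ℤ)` is the product of an element of `Γ₀(N)⁺` and an upper triangular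
matrix `(1 j; 0 e) / √e`. -/
theorem exists_gamma0Plus_mul_upperTriangular {N : ℕ} (hN : Squarefree N) (γ : SL(2, ℤ)) :
    ∃ (W U : SL(2, ℝ)) (e : ℕ) (j : ℤ), W ∈ Gamma0Plus N ∧ 0 < e ∧ (e = 1 → (N : ℤ) ∣ γ 1 0) ∧
      (U : Matrix (Fin 2) (Fin 2) ℝ) = (Real.sqrt e)⁻¹ • !![1, (j : ℝ); 0, (e : ℝ)] ∧
      SpecialLinearGroup.mapGL ℝ γ = SpecialLinearGroup.toGL W * SpecialLinearGroup.toGL U := by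
  have hN0 : 0 < N := Nat.pos_of_ne_zero hN.ne_zero
  set c := γ 1 0 with hc
  have hdet : γ 0 0 * γ 1 1 - γ 0 1 * c = 1 := by
    have := γ.det_coe
    rwa [det_fin_two] at this
  obtain ⟨e, he⟩ := Nat.gcd_dvd_right c.natAbs N
  set g := Nat.gcd c.natAbs N with hg
  have he0 : 0 < e := Nat.pos_of_ne_zero fun h => by simp [h] at he; omega
  have hgc : (g : ℤ) ∣ c := Int.natCast_dvd.2 (Nat.gcd_dvd_left _ _)
  have hcop : IsCoprime c (e : ℤ) := by
    rw [Int.isCoprime_iff_gcd_eq_one, Int.gcd, Int.natAbs_natCast]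
    set x := Nat.gcd c.natAbs e with hx
    have h1 : x ∣ g := Nat.dvd_gcd (Nat.gcd_dvd_left _ _)
      ((Nat.gcd_dvd_right _ _).trans ⟨g, by rw [he, mul_comm]⟩)
    have h2 : x * x ∣ N := he ▸ mul_dvd_mul h1 (Nat.gcd_dvd_right _ _)
    exact Nat.isUnit_iff.1 (hN x h2)
  obtain ⟨u, v, huv⟩ := hcop
  have heR : (0 : ℝ) < e := by exact_mod_cast he0
  have hse := Real.sq_sqrt heR.le
  have hs0 := (Real.sqrt_pos.2 heR).ne'
  have hdetR : (γ 0 0 : ℝ) * γ 1 1 - γ 0 1 * c = 1 := by exact_mod_cast hdet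
  refine ⟨⟨(Real.sqrt e)⁻¹ • !![(e * γ 0 0 : ℝ), ((γ 0 1 - u * γ 1 1 * γ 0 0 : ℤ) : ℝ);
    (e * c : ℝ), ((γ 1 1 - u * γ 1 1 * c : ℤ) : ℝ)], ?_⟩,
    ⟨(Real.sqrt e)⁻¹ • !![1, ((u * γ 1 1 : ℤ) : ℝ); 0, (e : ℝ)], ?_⟩, e, u * γ 1 1,
    ?_, he0, ?_, rfl, ?_⟩
  · rw [det_smul, det_fin_two]
    simp only [Fintype.card_fin, inv_pow, hse]
    simp only [of_apply, cons_val', cons_val_zero, cons_val_one, cons_val_fin_one]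
    push_cast
    field_simp
    linear_combination hdetR
  · rw [det_smul, det_fin_two]
    simp only [Fintype.card_fin, inv_pow, hse]
    simp [heR.ne']
  · refine ⟨e * γ 0 0, γ 0 1 - u * γ 1 1 * γ 0 0, e * c, γ 1 1 - u * γ 1 1 * c, e,
      by exact_mod_cast he0, ?_, ?_, dvd_mul_right _ _, ?_, ?_, ?_⟩
    · linear_combination e * hdet
    · exact_mod_cast Dvd.intro_left g he.symm
    · exact ⟨v * γ 1 1, by linear_combination (-γ 1 1) * huv⟩
    · rw [he]
      push_cast
      rw [mul_comm (g : ℤ)]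
      exact mul_dvd_mul_left _ hgc
    · push_cast
      rfl
  · rintro rfl
    rw [he, mul_one]
    exact hgc
  · apply mapGL_eq_toGL_mul
    rw [← hc]
    simp only [Matrix.smul_mul, Matrix.mul_smul, smul_smul, ← mul_inv, Real.mul_self_sqrt heR.le]
    ext i k
    fin_cases i <;> fin_cases k <;> simp <;> field_simp <;> ring

theorem slash_mapGL_of_invariant {N : ℕ} (hN : Squarefree N) {f : ℍ → ℂ} {k : ℤ}
    (hf : Gamma0Plus N ≤ slashStabilizer f k) (γ : SL(2, ℤ)) :
    ∃ (U : SL(2, ℝ)) (e : ℕ) (j : ℤ), 0 < e ∧ (e = 1 → (N : ℤ) ∣ γ 1 0) ∧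
      (U : Matrix (Fin 2) (Fin 2) ℝ) = (Real.sqrt e)⁻¹ • !![1, (j : ℝ); 0, (e : ℝ)] ∧
      f ∣[k] γ = f ∣[k] SpecialLinearGroup.toGL U := by
  obtain ⟨W, U, e, j, hW, he, h1, hU, h⟩ := exists_gamma0Plus_mul_upperTriangular hN γ
  refine ⟨U, e, j, he, h1, hU, ?_⟩
  rw [ModularForm.SL_slash]
  have : (γ : GL (Fin 2) ℝ) = SpecialLinearGroup.mapGL ℝ γ := rfl
  rw [this, h, SlashAction.slash_mul, mem_slashStabilizer.1 (hf hW)]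

theorem toGL_apply_one_zero {U : SL(2, ℝ)} {t b d : ℝ}
    (hU : (U : Matrix (Fin 2) (Fin 2) ℝ) = t • !![1, b; 0, d]) :
    (SpecialLinearGroup.toGL U) 1 0 = 0 := by
  have : (SpecialLinearGroup.toGL U) 1 0 = (U : Matrix (Fin 2) (Fin 2) ℝ) 1 0 := rfl
  rw [this, hU]
  simp

theorem isZeroAt_of_invariant {N : ℕ} (hN : Squarefree N) {f : ℍ → ℂ} {k : ℤ}
    (hf : Gamma0Plus N ≤ slashStabilizer f k) (h : IsZeroAtImInfty f) {c : OnePoint ℝ}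
    (hc : IsCusp c 𝒮ℒ) : c.IsZeroAt f k := by
  rw [isZeroAt_iff_forall_SL2Z hc]
  intro γ _
  obtain ⟨U, e, j, -, -, hU, hγ⟩ := slash_mapGL_of_invariant hN hf γ
  rw [hγ]
  exact h.slash _ (toGL_apply_one_zero hU)

theorem isBoundedAt_of_invariant {N : ℕ} (hN : Squarefree N) {f : ℍ → ℂ} {k : ℤ}
    (hf : Gamma0Plus N ≤ slashStabilizer f k) (h : IsBoundedAtImInfty f) {c : OnePoint ℝ}
    (hc : IsCusp c 𝒮ℒ) : c.IsBoundedAt f k := by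
  rw [isBoundedAt_iff_forall_SL2Z hc]
  intro γ _
  obtain ⟨U, e, j, -, -, hU, hγ⟩ := slash_mapGL_of_invariant hN hf γ
  rw [hγ]
  exact h.slash _ (toGL_apply_one_zero hU)

/-- Squares of elements of `Γ₀(N)⁺` are integral. -/
theorem sq_mem_range_of_mem_gamma0Plus {N : ℕ} (hN : Squarefree N) {γ : SL(2, ℝ)}
    (h : γ ∈ Gamma0Plus N) : (SpecialLinearGroup.toGL γ) ^ 2 ∈ 𝒮ℒ := by
  obtain ⟨M, e, a, b, c, d, rfl, hdet, hγ⟩ := exists_of_mem_gamma0Plus h hN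
  have he0 : 0 < e := Nat.pos_of_ne_zero hN.of_mul_right.ne_zero
  have heR : (0 : ℝ) < e := by exact_mod_cast he0
  refine ⟨⟨!![e * a ^ 2 + b * (M * c), a * b + b * d; e * a * (M * c) + M * c * (e * d),
    b * (M * c) + e * d ^ 2], ?_⟩, ?_⟩
  · rw [det_fin_two]
    simp only [of_apply, cons_val', cons_val_zero, cons_val_one, cons_val_fin_one]
    linear_combination (e * a * d - M * b * c + 1) * hdet
  · refine Eq.trans ?_ (pow_two _).symm
    apply mapGL_eq_toGL_mul
    rw [hγ]
    simp only [Matrix.smul_mul, Matrix.mul_smul, smul_smul, ← mul_inv, Real.mul_self_sqrt heR.le]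
    ext i k
    fin_cases i <;> fin_cases k <;> simp <;> field_simp

theorem isCusp_SL2Z_of_isCusp_gamma0Plus {N : ℕ} (hN : Squarefree N) {c : OnePoint ℝ}
    (hc : IsCusp c (Gamma0PlusGL N)) : IsCusp c 𝒮ℒ := by
  obtain ⟨g, hg, hp, hgc⟩ := hc
  obtain ⟨γ, hγ, rfl⟩ := Subgroup.mem_map.1 hg
  exact ⟨_, sq_mem_range_of_mem_gamma0Plus hN hγ, hp.pow two_ne_zero,
    by rw [sq, SemigroupAction.mul_smul, hgc, hgc]⟩

theorem gamma0_le_gamma0PlusGL (N : ℕ) :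
    ((CongruenceSubgroup.Gamma0 N : Subgroup SL(2, ℤ)) : Subgroup (GL (Fin 2) ℝ)) ≤
      Gamma0PlusGL N := by
  rintro _ ⟨γ, hγ, rfl⟩
  rw [SetLike.mem_coe, CongruenceSubgroup.Gamma0_mem, ZMod.intCast_zmod_eq_zero_iff_dvd] at hγ
  refine ⟨SpecialLinearGroup.map (Int.castRingHom ℝ) γ, ?_, rfl⟩
  refine ⟨γ 0 0, γ 0 1, γ 1 0, γ 1 1, 1, one_pos, ?_, one_dvd _, one_dvd _, one_dvd _, hγ, ?_⟩
  · have := γ.det_coe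
    rwa [det_fin_two] at this
  · ext i k
    fin_cases i <;> fin_cases k <;> simp

/-- A cusp form for `Γ₀(N)⁺` from a function with the right invariance, vanishing at `i∞`. -/
def cuspFormOfInvariant {N : ℕ} (hN : Squarefree N) (f : ℍ → ℂ) (k : ℤ)
    (hf : Gamma0Plus N ≤ slashStabilizer f k) (hol : MDiff f) (h : IsZeroAtImInfty f) :
    CuspForm (Gamma0PlusGL N) k where
  toFun := f
  slash_action_eq' := by
    rintro _ ⟨γ, hγ, rfl⟩
    exact hf hγ
  holo' := hol
  zero_at_cusps' hc := isZeroAt_of_invariant hN hf h (isCusp_SL2Z_of_isCusp_gamma0Plus hN hc)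

/-- A modular form for `Γ₀(N)` from a function invariant under `Γ₀(N)⁺`, bounded at `i∞`. -/
def modularFormOfInvariant {N : ℕ} [NeZero N] (hN : Squarefree N) (f : ℍ → ℂ) (k : ℤ)
    (hf : Gamma0Plus N ≤ slashStabilizer f k) (hol : MDiff f) (h : IsBoundedAtImInfty f) :
    ModularForm ((CongruenceSubgroup.Gamma0 N : Subgroup SL(2, ℤ)) : Subgroup (GL (Fin 2) ℝ)) k where
  toFun := f
  slash_action_eq' := by
    intro g hg
    obtain ⟨γ, hγ, rfl⟩ := gamma0_le_gamma0PlusGL N hg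
    exact hf hγ
  holo' := hol
  bdd_at_cusps' hc := isBoundedAt_of_invariant hN hf h
    ((Subgroup.IsArithmetic.isCusp_iff_isCusp_SL2Z _).1 hc)

theorem eq_const_of_invariant {N : ℕ} (hN : Squarefree N) (f : ℍ → ℂ)
    (hf : Gamma0Plus N ≤ slashStabilizer f 0) (hol : MDiff f) (h : IsBoundedAtImInfty f) :
    ∃ c, ∀ z, f z = c := by
  have : NeZero N := ⟨hN.ne_zero⟩
  obtain ⟨c, hc⟩ := ModularForm.eq_const_of_weight_zero (modularFormOfInvariant hN f 0 hf hol h)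
  exact ⟨c, fun z => congrFun hc z⟩

theorem eq_zero_of_invariant_of_neg {N : ℕ} (hN : Squarefree N) (f : ℍ → ℂ) {k : ℤ} (hk : k < 0)
    (hf : Gamma0Plus N ≤ slashStabilizer f k) (hol : MDiff f) (h : IsBoundedAtImInfty f) (z : ℍ) :
    f z = 0 := by
  have : NeZero N := ⟨hN.ne_zero⟩
  have := ModularForm.isZero_of_neg_weight hk (modularFormOfInvariant hN f k hf hol h)
  exact DFunLike.congr_fun this z

end CuspConditions

section QAnalytic

open Function Filter Topology
open scoped Manifold PowerSeries

local notation "𝕢" => Periodic.qParam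

/-- Holomorphic `1`-periodic functions on the upper half-plane which are bounded at `i∞`. -/
structure QAnalytic (f : ℍ → ℂ) : Prop where
  periodic : Periodic (f ∘ ofComplex) (1 : ℝ)
  mdiff : MDiff f
  bdd : IsBoundedAtImInfty f

namespace QAnalytic

variable {f g : ℍ → ℂ}

theorem analyticAt (hf : QAnalytic f) : AnalyticAt ℂ (cuspFunction 1 f) 0 :=
  analyticAt_cuspFunction_zero one_pos hf.periodic hf.mdiff hf.bdd

theorem hasSum (hf : QAnalytic f) (τ : ℍ) :
    HasSum (fun m : ℕ => (qExpansion 1 f).coeff m • 𝕢 1 τ ^ m) (f τ) :=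
  hasSum_qExpansion one_pos hf.periodic hf.mdiff hf.bdd τ

theorem qExpansion_unique (hf : QAnalytic f) {c : ℕ → ℂ}
    (h : ∀ τ : ℍ, HasSum (fun m => c m • 𝕢 1 τ ^ m) (f τ)) : qExpansion 1 f = PowerSeries.mk c := by
  have h1 := (hasFPowerSeriesOnBall_cuspFunction one_pos hf.analyticAt h).hasFPowerSeriesAt
  have h2 := (hasFPowerSeriesOnBall_cuspFunction one_pos hf.analyticAt hf.hasSum).hasFPowerSeriesAt
  ext m
  rw [PowerSeries.coeff_mk]
  simpa [FormalMultilinearSeries.coeff_ofScalars] using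
    congr_arg (FormalMultilinearSeries.coeff · m) (h2.eq_formalMultilinearSeries h1)

theorem mul (hf : QAnalytic f) (hg : QAnalytic g) : QAnalytic (f * g) where
  periodic z := by
    have h1 := hf.periodic z
    have h2 := hg.periodic z
    simp only [Function.comp_apply, Pi.mul_apply] at *
    rw [h1, h2]
  mdiff := MDifferentiable.mul hf.mdiff hg.mdiff
  bdd := (boundedAtImInftySubalgebra ℂ).mul_mem hf.bdd hg.bdd

theorem add (hf : QAnalytic f) (hg : QAnalytic g) : QAnalytic (f + g) where
  periodic z := by
    have h1 := hf.periodic z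
    have h2 := hg.periodic z
    simp only [Function.comp_apply, Pi.add_apply] at *
    rw [h1, h2]
  mdiff := MDifferentiable.add hf.mdiff hg.mdiff
  bdd := (boundedAtImInftySubalgebra ℂ).add_mem hf.bdd hg.bdd

theorem const (c : ℂ) : QAnalytic (fun _ => c) where
  periodic _ := rfl
  mdiff := mdifferentiable_const
  bdd := (boundedAtImInftySubalgebra ℂ).algebraMap_mem c

theorem one : QAnalytic 1 := const 1

theorem pow (hf : QAnalytic f) (n : ℕ) : QAnalytic (f ^ n) := by
  induction n with
  | zero => simpa using one
  | succ n ih =>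
    rw [pow_succ]
    exact ih.mul hf

theorem prod {ι : Type*} {s : Finset ι} {F : ι → ℍ → ℂ} (h : ∀ i ∈ s, QAnalytic (F i)) :
    QAnalytic (∏ i ∈ s, F i) := by
  classical
  induction s using Finset.induction_on with
  | empty => simpa using one
  | insert a s ha ih =>
    rw [Finset.prod_insert ha]
    exact (h a (Finset.mem_insert_self a s)).mul
      (ih fun i hi => h i (Finset.mem_insert_of_mem hi))

theorem qExpansion_mul (hf : QAnalytic f) (hg : QAnalytic g) :
    qExpansion 1 (f * g) = qExpansion 1 f * qExpansion 1 g :=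
  UpperHalfPlane.qExpansion_mul hf.analyticAt hg.analyticAt

theorem qExpansion_pow (hf : QAnalytic f) (n : ℕ) : qExpansion 1 (f ^ n) = qExpansion 1 f ^ n := by
  induction n with
  | zero => simpa using qExpansion_one 1
  | succ n ih => rw [pow_succ, (hf.pow n).qExpansion_mul hf, ih, pow_succ]

theorem qExpansion_prod {ι : Type*} {s : Finset ι} {F : ι → ℍ → ℂ}
    (h : ∀ i ∈ s, QAnalytic (F i)) :
    qExpansion 1 (∏ i ∈ s, F i) = ∏ i ∈ s, qExpansion 1 (F i) := by
  classical
  induction s using Finset.induction_on with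
  | empty => simpa using qExpansion_one 1
  | insert a s ha ih =>
    rw [Finset.prod_insert ha, Finset.prod_insert ha, (h a (Finset.mem_insert_self a s)).qExpansion_mul
      (prod fun i hi => h i (Finset.mem_insert_of_mem hi)),
      ih fun i hi => h i (Finset.mem_insert_of_mem hi)]

theorem smul (hf : QAnalytic f) (c : ℂ) : QAnalytic (c • f) :=
  (const c).mul hf

theorem qExpansion_smul (hf : QAnalytic f) (c : ℂ) : qExpansion 1 (c • f) = c • qExpansion 1 f :=
  UpperHalfPlane.qExpansion_smul hf.analyticAt c

theorem qExpansion_add (hf : QAnalytic f) (hg : QAnalytic g) :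
    qExpansion 1 (f + g) = qExpansion 1 f + qExpansion 1 g :=
  UpperHalfPlane.qExpansion_add hf.analyticAt hg.analyticAt

theorem eq_zero_of_qExpansion (hf : QAnalytic f) (h : qExpansion 1 f = 0) : f = 0 :=
  (qExpansion_eq_zero_iff one_pos hf.periodic hf.mdiff hf.bdd).1 h

theorem tendsto (hf : QAnalytic f) : Tendsto f atImInfty (𝓝 ((qExpansion 1 f).coeff 0)) := by
  have h0 : (qExpansion 1 f).coeff 0 = cuspFunction 1 f 0 := by
    simp [qExpansion_coeff]
  rw [h0]
  refine (hf.analyticAt.continuousAt.tendsto.comp (qParam_tendsto_atImInfty one_pos)).congr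
    fun τ => ?_
  exact eq_cuspFunction τ one_ne_zero hf.periodic

end QAnalytic

theorem periodic_comp_ofComplex_of_vadd {f : ℍ → ℂ} (h : ∀ z : ℍ, f ((1 : ℝ) +ᵥ z) = f z) :
    Periodic (f ∘ ofComplex) (1 : ℝ) := by
  intro w
  by_cases! hw : 0 < w.im
  · have h1 : 0 < (w + (1 : ℝ)).im := by simpa using hw
    have : (⟨w + (1 : ℝ), h1⟩ : ℍ) = (1 : ℝ) +ᵥ (⟨w, hw⟩ : ℍ) := by
      ext
      simp [add_comm]
    simp only [Function.comp_apply, ofComplex_apply_of_im_pos h1, ofComplex_apply_of_im_pos hw]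
    rw [this, h]
  · have h1 : (w + (1 : ℝ)).im ≤ 0 := by simpa using hw
    simp only [Function.comp_apply, ofComplex_apply_of_im_nonpos h1,
      ofComplex_apply_of_im_nonpos hw]

theorem qParam_one_vadd (z : ℍ) : 𝕢 1 (((1 : ℝ) +ᵥ z : ℍ) : ℂ) = 𝕢 1 (z : ℂ) := by
  rw [Periodic.qParam, Periodic.qParam, Complex.exp_eq_exp_iff_exists_int]
  exact ⟨1, by rw [UpperHalfPlane.coe_vadd]; push_cast; ring⟩

/-- A function given by a power series in `q` is holomorphic, periodic and bounded at `i∞`. -/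
theorem qAnalytic_of_differentiableOn {P : ℂ → ℂ} (hP : DifferentiableOn ℂ P (Metric.ball 0 1)) :
    QAnalytic (fun z : ℍ => P (𝕢 1 z)) where
  periodic := periodic_comp_ofComplex_of_vadd fun z => by rw [qParam_one_vadd]
  mdiff := by
    rw [UpperHalfPlane.mdifferentiable_iff]
    have : DifferentiableOn ℂ (fun w : ℂ => P (𝕢 1 w)) {w | 0 < w.im} := by
      refine hP.comp (by fun_prop) fun w hw => ?_
      rw [mem_ball_zero_iff]
      exact Periodic.norm_qParam_lt_one one_pos hw
    refine this.congr fun w hw => ?_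
    have hw' : 0 < w.im := hw
    simp [ofComplex_apply_of_im_pos hw']
  bdd := by
    have h0 : ContinuousAt P 0 := (hP.differentiableAt (Metric.ball_mem_nhds 0 one_pos)).continuousAt
    exact (h0.tendsto.comp (qParam_tendsto_atImInfty one_pos)).isBigO_one ℝ

theorem qAnalytic_qParam : QAnalytic (fun z : ℍ => 𝕢 1 z) :=
  qAnalytic_of_differentiableOn (P := fun q => q) differentiableOn_id

theorem qExpansion_qParam : qExpansion 1 (fun z : ℍ => 𝕢 1 z) = PowerSeries.X := by
  rw [qAnalytic_qParam.qExpansion_unique (c := fun n => if n = 1 then 1 else 0)]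
  · ext n
    rw [PowerSeries.coeff_mk, PowerSeries.coeff_X]
  · intro τ
    have := hasSum_ite_eq (1 : ℕ) (𝕢 1 (τ : ℂ))
    refine this.congr_fun ?_
    intro n
    split_ifs with h
    · simp [h]
    · simp

end QAnalytic

section EulerFunction

open Filter Topology Polynomial
open scoped PowerSeries

/-- Euler's function `∏ (1 - q ^ n)`. -/
def eulerPhi (q : ℂ) : ℂ := ∏' n : ℕ, (1 - q ^ (n + 1))

theorem iteratedDeriv_polynomial_eval (p : ℂ[X]) (n : ℕ) :
    iteratedDeriv n (fun x => p.eval x) = fun x => (derivative^[n] p).eval x := by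
  induction n with
  | zero => simp
  | succ n ih =>
    rw [iteratedDeriv_succ, ih, Function.iterate_succ_apply']
    ext x
    exact Polynomial.deriv _

theorem iteratedDeriv_polynomial_zero (p : ℤ[X]) (n : ℕ) :
    iteratedDeriv n (fun x => (p.map (Int.castRingHom ℂ)).eval x) 0 =
      (n.factorial : ℂ) * (p.coeff n : ℂ) := by
  rw [iteratedDeriv_polynomial_eval]
  simp only
  rw [← coeff_zero_eq_eval_zero, coeff_iterate_derivative, zero_add, Nat.descFactorial_self,
    coeff_map, nsmul_eq_mul, eq_intCast]

theorem tendstoLocallyUniformlyOn_iteratedDeriv {F : ℕ → ℂ → ℂ} {f : ℂ → ℂ} {U : Set ℂ}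
    (hU : IsOpen U) (h : TendstoLocallyUniformlyOn F f atTop U)
    (hF : ∀ n, DifferentiableOn ℂ (F n) U) (m : ℕ) :
    TendstoLocallyUniformlyOn (fun n => iteratedDeriv m (F n)) (iteratedDeriv m f) atTop U ∧
      ∀ n, DifferentiableOn ℂ (iteratedDeriv m (F n)) U := by
  induction m with
  | zero => simpa using ⟨h, hF⟩
  | succ m ih =>
    simp only [iteratedDeriv_succ]
    exact ⟨ih.1.deriv (.of_forall ih.2) hU, fun n => (ih.2 n).deriv hU⟩

/-- The partial products of Euler's function. -/
def eulerPoly (n : ℕ) : ℤ[X] := ∏ i ∈ Finset.range n, (1 - X ^ (i + 1))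

theorem coeff_eulerPoly (n : ℕ) (hn : 1 ≤ n) :
    (eulerPoly n).coeff 0 = 1 ∧ (eulerPoly n).coeff 1 = -1 := by
  induction n, hn using Nat.le_induction with
  | base => simp [eulerPoly, coeff_one]
  | succ n hn ih =>
    rw [eulerPoly, Finset.prod_range_succ, ← eulerPoly, mul_sub, mul_one, coeff_sub, coeff_sub,
      coeff_mul_X_pow', coeff_mul_X_pow', if_neg (by omega), if_neg (by omega), ih.1, ih.2]
    simp

theorem differentiableOn_eulerPhi : DifferentiableOn ℂ eulerPhi (Metric.ball 0 1) :=
  ModularForm.differentiableOn_tprod_one_sub_pow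

theorem tendsto_coeff_eulerPoly (m : ℕ) :
    Tendsto (fun n => (m.factorial : ℂ) * ((eulerPoly n).coeff m : ℂ)) atTop
      (𝓝 (iteratedDeriv m eulerPhi 0)) := by
  have h := ModularForm.multipliableLocallyUniformlyOn_one_sub_pow.hasProdLocallyUniformlyOn
    |>.tendstoLocallyUniformlyOn_finsetRange
  have h2 (n : ℕ) (q : ℂ) : ∏ i ∈ Finset.range n, (1 - q ^ (i + 1)) =
      ((eulerPoly n).map (Int.castRingHom ℂ)).eval q := by
    rw [eulerPoly, Polynomial.map_prod, eval_prod]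
    simp
  simp only [h2] at h
  have h3 := (tendstoLocallyUniformlyOn_iteratedDeriv Metric.isOpen_ball h
    (fun n => (Polynomial.differentiable _).differentiableOn) m).1
  have h4 := h3.tendsto_at (Metric.mem_ball_self one_pos)
  simp only [iteratedDeriv_polynomial_zero] at h4
  exact h4

theorem exists_int_coeff_eulerPhi (m : ℕ) :
    ∃ a : ℤ, iteratedDeriv m eulerPhi 0 = (m.factorial : ℂ) * a := by
  have hm : (m.factorial : ℂ) ≠ 0 := by exact_mod_cast m.factorial_ne_zero
  have h := (tendsto_coeff_eulerPoly m).const_mul ((m.factorial : ℂ)⁻¹)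
  have h2 : (m.factorial : ℂ)⁻¹ * iteratedDeriv m eulerPhi 0 ∈ Set.range (Int.cast : ℤ → ℂ) := by
    refine Complex.isClosed_range_intCast.mem_of_tendsto h (.of_forall fun n => ?_)
    exact ⟨(eulerPoly n).coeff m, by field_simp⟩
  obtain ⟨a, ha⟩ := h2
  exact ⟨a, by rw [ha]; field_simp⟩

/-- The power series of Euler's function. -/
def eulerSeries : ℤ⟦X⟧ := PowerSeries.mk fun m => (exists_int_coeff_eulerPhi m).choose

theorem coeff_eulerSeries (m : ℕ) :
    iteratedDeriv m eulerPhi 0 = (m.factorial : ℂ) * (eulerSeries.coeff m : ℤ) := by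
  rw [eulerSeries, PowerSeries.coeff_mk]
  exact (exists_int_coeff_eulerPhi m).choose_spec

theorem hasSum_eulerSeries {q : ℂ} (hq : ‖q‖ < 1) :
    HasSum (fun m => ((eulerSeries.coeff m : ℤ) : ℂ) * q ^ m) (eulerPhi q) := by
  have := Complex.hasSum_taylorSeries_on_ball differentiableOn_eulerPhi (mem_ball_zero_iff.2 hq)
  refine this.congr_fun fun m => ?_
  rw [coeff_eulerSeries, sub_zero, smul_eq_mul, smul_eq_mul]
  have hm : (m.factorial : ℂ) ≠ 0 := by exact_mod_cast m.factorial_ne_zero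
  field_simp

theorem coeff_eulerSeries_eq {m : ℕ} {a : ℤ} (h : ∀ n, 1 ≤ n → (eulerPoly n).coeff m = a) :
    eulerSeries.coeff m = a := by
  have h1 : Tendsto (fun n => (m.factorial : ℂ) * ((eulerPoly n).coeff m : ℂ)) atTop
      (𝓝 ((m.factorial : ℂ) * (a : ℂ))) :=
    tendsto_const_nhds.congr' (by
      filter_upwards [eventually_ge_atTop 1] with n hn
      rw [h n hn])
  have h2 := tendsto_nhds_unique h1 (tendsto_coeff_eulerPoly m)
  rw [coeff_eulerSeries] at h2
  have hm : (m.factorial : ℂ) ≠ 0 := by exact_mod_cast m.factorial_ne_zero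
  exact_mod_cast (mul_left_cancel₀ hm h2).symm

theorem coeff_zero_eulerSeries : eulerSeries.coeff 0 = 1 :=
  coeff_eulerSeries_eq fun n hn => (coeff_eulerPoly n hn).1

theorem coeff_one_eulerSeries : eulerSeries.coeff 1 = -1 :=
  coeff_eulerSeries_eq fun n hn => (coeff_eulerPoly n hn).2

/-- The power series of `q ↦ eulerPhi (q ^ v)`. -/
def eulerSeriesPow (v : ℕ) : ℤ⟦X⟧ :=
  PowerSeries.mk fun n => if v ∣ n then eulerSeries.coeff (n / v) else 0

theorem hasSum_eulerSeriesPow {v : ℕ} (hv : 0 < v) {q : ℂ} (hq : ‖q‖ < 1) :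
    HasSum (fun m => (((eulerSeriesPow v).coeff m : ℤ) : ℂ) * q ^ m) (eulerPhi (q ^ v)) := by
  have h := hasSum_eulerSeries (q := q ^ v)
    (by rw [norm_pow]; exact pow_lt_one₀ (norm_nonneg _) hq hv.ne')
  have hinj : Function.Injective (fun n : ℕ => v * n) := fun a b h => Nat.eq_of_mul_eq_mul_left hv h
  rw [← hinj.hasSum_iff]
  · refine h.congr_fun fun n => ?_
    simp only [Function.comp_apply, eulerSeriesPow, PowerSeries.coeff_mk, dvd_mul_right, if_true,
      Nat.mul_div_cancel_left _ hv, pow_mul]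
  · intro n hn
    have : ¬ v ∣ n := fun ⟨k, hk⟩ => hn ⟨k, hk.symm⟩
    simp [eulerSeriesPow, this]

theorem coeff_zero_eulerSeriesPow (v : ℕ) : (eulerSeriesPow v).coeff 0 = 1 := by
  simp [eulerSeriesPow, coeff_zero_eulerSeries]

theorem coeff_one_eulerSeriesPow (v : ℕ) :
    (eulerSeriesPow v).coeff 1 = if v = 1 then -1 else 0 := by
  simp only [eulerSeriesPow, PowerSeries.coeff_mk, Nat.dvd_one]
  split_ifs with h
  · rw [h, Nat.div_one, coeff_one_eulerSeries]
  · rfl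

end EulerFunction

section EtaProductExpansion

open Function Filter Topology
open scoped Manifold PowerSeries

local notation "𝕢" => Periodic.qParam

theorem coeff_one_mul_of_coeff_zero {R : Type*} [CommRing R] {f g : R⟦X⟧} (hf : f.coeff 0 = 1)
    (hg : g.coeff 0 = 1) :
    (f * g).coeff 0 = 1 ∧ (f * g).coeff 1 = f.coeff 1 + g.coeff 1 := by
  rw [PowerSeries.coeff_mul, PowerSeries.coeff_mul, Finset.Nat.antidiagonal_succ]
  simp only [Finset.Nat.antidiagonal_zero]
  simp [hf, hg, add_comm]

theorem coeff_one_pow_of_coeff_zero {R : Type*} [CommRing R] {f : R⟦X⟧} (hf : f.coeff 0 = 1)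
    (n : ℕ) : (f ^ n).coeff 0 = 1 ∧ (f ^ n).coeff 1 = n * f.coeff 1 := by
  induction n with
  | zero => simp [PowerSeries.coeff_one]
  | succ n ih =>
    have := coeff_one_mul_of_coeff_zero ih.1 hf
    rw [pow_succ]
    refine ⟨this.1, this.2.trans ?_⟩
    rw [ih.2]
    push_cast
    ring

theorem coeff_one_prod_of_coeff_zero {R ι : Type*} [CommRing R] {s : Finset ι} {f : ι → R⟦X⟧}
    (hf : ∀ i ∈ s, (f i).coeff 0 = 1) :
    (∏ i ∈ s, f i).coeff 0 = 1 ∧ (∏ i ∈ s, f i).coeff 1 = ∑ i ∈ s, (f i).coeff 1 := by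
  classical
  induction s using Finset.induction_on with
  | empty => simp [PowerSeries.coeff_one]
  | insert a s ha ih =>
    have h1 := ih fun i hi => hf i (Finset.mem_insert_of_mem hi)
    have := coeff_one_mul_of_coeff_zero (hf a (Finset.mem_insert_self a s)) h1.1
    rw [Finset.prod_insert ha, Finset.sum_insert ha]
    exact ⟨this.1, by rw [this.2, h1.2]⟩

/-- The power series of `∏_{v ∣ N} eulerPhi (q ^ v) ^ l`. -/
def eulerProdSeries (N l : ℕ) : ℤ⟦X⟧ := ∏ v ∈ N.divisors, eulerSeriesPow v ^ l

theorem coeff_zero_eulerProdSeries (N l : ℕ) : (eulerProdSeries N l).coeff 0 = 1 :=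
  (coeff_one_prod_of_coeff_zero fun v _ =>
    (coeff_one_pow_of_coeff_zero (coeff_zero_eulerSeriesPow v) l).1).1

theorem coeff_one_eulerProdSeries {N : ℕ} (hN : N ≠ 0) (l : ℕ) :
    (eulerProdSeries N l).coeff 1 = -l := by
  rw [eulerProdSeries, (coeff_one_prod_of_coeff_zero fun v _ =>
    (coeff_one_pow_of_coeff_zero (coeff_zero_eulerSeriesPow v) l).1).2]
  rw [Finset.sum_congr rfl fun v _ =>
    (coeff_one_pow_of_coeff_zero (coeff_zero_eulerSeriesPow v) l).2]
  simp_rw [coeff_one_eulerSeriesPow]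
  rw [Finset.sum_eq_single 1]
  · simp
  · intro v _ hv
    simp [hv]
  · intro h
    simp [hN] at h

/-- The function `∏_{v ∣ N} eulerPhi (q ^ v) ^ l` on the upper half-plane. -/
def eulerProd (N l : ℕ) : ℍ → ℂ := ∏ v ∈ N.divisors, (fun z : ℍ => eulerPhi (𝕢 1 z ^ v)) ^ l

theorem qAnalytic_eulerPhi_pow {v : ℕ} (hv : 0 < v) :
    QAnalytic (fun z : ℍ => eulerPhi (𝕢 1 z ^ v)) := by
  refine qAnalytic_of_differentiableOn (P := fun q => eulerPhi (q ^ v)) ?_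
  refine differentiableOn_eulerPhi.comp (by fun_prop) fun q hq => ?_
  rw [mem_ball_zero_iff] at *
  rw [norm_pow]
  exact pow_lt_one₀ (norm_nonneg _) hq hv.ne'

theorem qExpansion_eulerPhi_pow {v : ℕ} (hv : 0 < v) :
    qExpansion 1 (fun z : ℍ => eulerPhi (𝕢 1 z ^ v)) =
      (eulerSeriesPow v).map (Int.castRingHom ℂ) := by
  rw [(qAnalytic_eulerPhi_pow hv).qExpansion_unique
    (c := fun n => (((eulerSeriesPow v).coeff n : ℤ) : ℂ))]
  · ext n
    simp
  · intro τ
    exact hasSum_eulerSeriesPow hv (Periodic.norm_qParam_lt_one one_pos τ.im_pos)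

theorem qAnalytic_eulerProd (N l : ℕ) : QAnalytic (eulerProd N l) :=
  .prod fun _ hv => (qAnalytic_eulerPhi_pow (Nat.pos_of_mem_divisors hv)).pow l

theorem qExpansion_eulerProd (N l : ℕ) :
    qExpansion 1 (eulerProd N l) = (eulerProdSeries N l).map (Int.castRingHom ℂ) := by
  rw [eulerProd, QAnalytic.qExpansion_prod fun v hv =>
    (qAnalytic_eulerPhi_pow (Nat.pos_of_mem_divisors hv)).pow l, eulerProdSeries, map_prod]
  refine Finset.prod_congr rfl fun v hv => ?_
  have hv0 := Nat.pos_of_mem_divisors hv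
  rw [(qAnalytic_eulerPhi_pow hv0).qExpansion_pow, qExpansion_eulerPhi_pow hv0, map_pow]

theorem eta_natCast_mul (v : ℕ) (z : ℂ) :
    ModularForm.eta (v * z) = 𝕢 24 (v * z) * eulerPhi (𝕢 1 z ^ v) := by
  have h : 𝕢 1 (v * z) = 𝕢 1 z ^ v := by
    rw [Periodic.qParam, Periodic.qParam, ← Complex.exp_nat_mul]
    congr 1
    ring
  simp only [ModularForm.eta, ModularForm.eta_q, eulerPhi, h]

theorem etaProdPow_eq {N l m : ℕ} (h : 24 * m = l * ∑ v ∈ N.divisors, v) :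
    etaProdPow N l = (fun z : ℍ => 𝕢 1 z) ^ m * eulerProd N l := by
  ext z
  simp only [etaProdPow, etaProd, eta_natCast_mul, Finset.prod_mul_distrib, mul_pow, eulerProd,
    Pi.mul_apply, Pi.pow_apply, Finset.prod_apply, Finset.prod_pow]
  congr 1
  simp only [Periodic.qParam]
  rw [← Complex.exp_sum, ← Complex.exp_nat_mul, ← Complex.exp_nat_mul]
  congr 1
  have h' : (24 * m : ℂ) = l * ∑ v ∈ N.divisors, (v : ℂ) := by rw [← Nat.cast_sum]; exact_mod_cast h
  have h2 : ∑ i ∈ N.divisors, 2 * (Real.pi : ℂ) * Complex.I * (i * z) / ((24 : ℝ) : ℂ) =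
      (∑ v ∈ N.divisors, (v : ℂ)) * (2 * Real.pi * Complex.I * z / 24) := by
    rw [Finset.sum_mul]
    refine Finset.sum_congr rfl fun i _ => ?_
    push_cast
    ring
  rw [h2]
  push_cast
  linear_combination (-(2 * Real.pi * Complex.I * z / 24)) * h'

theorem qAnalytic_etaProdPow {N l m : ℕ} (h : 24 * m = l * ∑ v ∈ N.divisors, v) :
    QAnalytic (etaProdPow N l) := by
  rw [etaProdPow_eq h]
  exact (qAnalytic_qParam.pow m).mul (qAnalytic_eulerProd N l)

theorem qExpansion_etaProdPow {N l m : ℕ} (h : 24 * m = l * ∑ v ∈ N.divisors, v) :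
    qExpansion 1 (etaProdPow N l) =
      (PowerSeries.X ^ m * eulerProdSeries N l).map (Int.castRingHom ℂ) := by
  rw [etaProdPow_eq h, (qAnalytic_qParam.pow m).qExpansion_mul (qAnalytic_eulerProd N l),
    qAnalytic_qParam.qExpansion_pow, qExpansion_qParam, qExpansion_eulerProd, map_mul, map_pow,
    PowerSeries.map_X]

theorem order_qExpansion_etaProdPow {N l m : ℕ} (h : 24 * m = l * ∑ v ∈ N.divisors, v) :
    (qExpansion 1 (etaProdPow N l)).order = m := by
  rw [qExpansion_etaProdPow h, PowerSeries.order_eq_nat]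
  constructor
  · rw [PowerSeries.coeff_map, PowerSeries.coeff_X_pow_mul', if_pos le_rfl, Nat.sub_self,
      coeff_zero_eulerProdSeries]
    simp
  · intro i hi
    rw [PowerSeries.coeff_map, PowerSeries.coeff_X_pow_mul', if_neg (by omega), map_zero]

theorem tendsto_etaProdPow_div {N l m : ℕ} (h : 24 * m = l * ∑ v ∈ N.divisors, v) :
    Tendsto (fun z : ℍ => etaProdPow N l z / 𝕢 1 z ^ m) atImInfty (𝓝 1) := by
  have h1 := (qAnalytic_eulerProd N l).tendsto
  rw [qExpansion_eulerProd, PowerSeries.coeff_map, coeff_zero_eulerProdSeries, map_one] at h1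
  refine h1.congr fun z => ?_
  rw [etaProdPow_eq h, Pi.mul_apply, Pi.pow_apply,
    mul_div_cancel_left₀ _ (pow_ne_zero _ (Periodic.qParam_ne_zero _))]

theorem isZeroAtImInfty_etaProdPow {N l m : ℕ} (h : 24 * m = l * ∑ v ∈ N.divisors, v)
    (hm : 0 < m) : IsZeroAtImInfty (etaProdPow N l) := by
  have h1 := (qAnalytic_etaProdPow h).tendsto
  rw [qExpansion_etaProdPow h, PowerSeries.coeff_map, PowerSeries.coeff_X_pow_mul',
    if_neg (by omega), map_zero] at h1
  exact h1

theorem mdifferentiable_etaProd (N : ℕ) : MDiff (fun z : ℍ => etaProd N z) := by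
  rw [UpperHalfPlane.mdifferentiable_iff]
  have : DifferentiableOn ℂ (etaProd N) {w | 0 < w.im} := by
    intro w hw
    have hw' : 0 < w.im := hw
    refine DifferentiableAt.differentiableWithinAt ?_
    unfold etaProd
    refine DifferentiableAt.fun_finsetProd fun v hv => ?_
    have hv0 : 0 < v := Nat.pos_of_mem_divisors hv
    have h1 : DifferentiableAt ℂ ModularForm.eta (v * w) := by
      apply ModularForm.differentiableAt_eta_of_mem_upperHalfPlaneSet
      show 0 < ((v : ℂ) * w).im
      simp only [Complex.mul_im, Complex.natCast_re, Complex.natCast_im, zero_mul, add_zero]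
      positivity
    exact h1.comp w (by fun_prop)
  refine this.congr fun w hw => ?_
  have hw' : 0 < w.im := hw
  simp [ofComplex_apply_of_im_pos hw']

theorem mdifferentiable_etaProdPow (N l : ℕ) : MDiff (etaProdPow N l) :=
  MDifferentiable.pow (mdifferentiable_etaProd N) l

theorem etaProdPow_ne_zero (N l : ℕ) (z : ℍ) : etaProdPow N l z ≠ 0 :=
  pow_ne_zero _ (etaProd_ne_zero N z.im_pos)

/-- The leading term of a `q`-expansion. -/
theorem QAnalytic.exists_tendsto_div {f : ℍ → ℂ} (hf : QAnalytic f) (h0 : f ≠ 0) :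
    ∃ (n : ℕ) (a : ℂ), a ≠ 0 ∧ Tendsto (fun z : ℍ => f z / 𝕢 1 z ^ n) atImInfty (𝓝 a) := by
  have han := hf.analyticAt
  have hne : ¬ ∀ᶠ q in 𝓝 0, cuspFunction 1 f q = 0 := by
    intro h
    refine h0 (hf.eq_zero_of_qExpansion ?_)
    ext n
    have h2 : cuspFunction 1 f =ᶠ[𝓝 0] fun _ => 0 := h
    rw [qExpansion_coeff, h2.iteratedDeriv_eq]
    simp
  obtain ⟨n, g, hg, hg0, hfg⟩ := han.exists_eventuallyEq_pow_smul_nonzero_iff.2 hne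
  refine ⟨n, g 0, hg0, ?_⟩
  refine (hg.continuousAt.tendsto.comp (qParam_tendsto_atImInfty one_pos)).congr' ?_
  filter_upwards [(qParam_tendsto_atImInfty one_pos).eventually hfg] with z hz
  rw [eq_cuspFunction z one_ne_zero hf.periodic, sub_zero, smul_eq_mul] at hz
  rw [hz, mul_div_cancel_left₀ _ (pow_ne_zero _ (Periodic.qParam_ne_zero _))]
  rfl

end EtaProductExpansion

section Comparison

open Function Filter Topology Matrix
open scoped Manifold PowerSeries ModularForm

local notation "𝕢" => Periodic.qParam

theorem MDifferentiable.div_of_ne_zero {f g : ℍ → ℂ} (hf : MDiff f) (hg : MDiff g)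
    (h0 : ∀ z, g z ≠ 0) : MDiff (f / g) := by
  rw [UpperHalfPlane.mdifferentiable_iff] at *
  exact hf.div hg fun z _ => h0 _

theorem div_pow_mem_slashStabilizer {f F : ℍ → ℂ} {k l : ℕ} {γ : SL(2, ℝ)}
    (hf : γ ∈ slashStabilizer f k) (hF : γ ∈ slashStabilizer F l) :
    γ ∈ slashStabilizer (f ^ l / F ^ k) 0 := by
  rw [mem_slashStabilizer, slash_eq_iff] at hf hF
  rw [mem_slashStabilizer, ← Nat.cast_zero, slash_eq_iff]
  intro z
  simp only [Pi.div_apply, Pi.pow_apply]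
  rw [hf, hF, mul_pow, mul_pow, ← pow_mul, ← pow_mul, mul_comm l k,
    mul_div_mul_left _ _ (pow_ne_zero _ (denom_ne_zero _ z)), pow_zero, one_mul]

theorem pow_mem_slashStabilizer {f : ℍ → ℂ} {k : ℕ} {γ : SL(2, ℝ)}
    (hf : γ ∈ slashStabilizer f k) (n : ℕ) : γ ∈ slashStabilizer (f ^ n) (k * n : ℕ) := by
  rw [mem_slashStabilizer, slash_eq_iff] at *
  intro z
  simp only [Pi.pow_apply]
  rw [hf, mul_pow, pow_mul]

theorem exists_pow_eq_mul_pow_of_le {N : ℕ} (hN : Squarefree N) {f F : ℍ → ℂ} {k l n m : ℕ} {a b : ℂ}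
    (hf : Gamma0Plus N ≤ slashStabilizer f k) (hF : Gamma0Plus N ≤ slashStabilizer F l)
    (hfa : MDiff f) (hFa : MDiff F) (hF0 : ∀ z, F z ≠ 0)
    (hfn : Tendsto (fun z : ℍ => f z / 𝕢 1 z ^ n) atImInfty (𝓝 a))
    (hFm : Tendsto (fun z : ℍ => F z / 𝕢 1 z ^ m) atImInfty (𝓝 b)) (hb : b ≠ 0)
    (h : m * k ≤ n * l) : ∃ c : ℂ, ∀ z, f z ^ l = c * F z ^ k := by
  have hlim : Tendsto (f ^ l / F ^ k) atImInfty (𝓝 (a ^ l / b ^ k * 0 ^ (n * l - m * k))) := by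
    have hq : Tendsto (fun z : ℍ => 𝕢 1 z) atImInfty (𝓝 0) :=
      qParam_tendsto_atImInfty one_pos
    refine (((hfn.pow l).div (hFm.pow k) (pow_ne_zero _ hb)).mul (hq.pow (n * l - m * k))).congr
      fun z => ?_
    have h0 : 𝕢 1 (z : ℂ) ≠ 0 := Periodic.qParam_ne_zero _
    have h1 : 𝕢 1 (z : ℂ) ^ (n * l) = 𝕢 1 (z : ℂ) ^ (n * l - m * k) * 𝕢 1 (z : ℂ) ^ (m * k) := by
      rw [← pow_add, Nat.sub_add_cancel h]
    have h2 := hF0 z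
    simp only [Pi.div_apply, Pi.pow_apply, div_pow, ← pow_mul, h1]
    field_simp
  obtain ⟨c, hc⟩ := eq_const_of_invariant hN (f ^ l / F ^ k)
    (fun γ hγ => div_pow_mem_slashStabilizer (hf hγ) (hF hγ))
    (MDifferentiable.div_of_ne_zero (hfa.pow l) (hFa.pow k) fun z => pow_ne_zero _ (hF0 z))
    (hlim.isBigO_one ℝ)
  refine ⟨c, fun z => ?_⟩
  rw [← hc z]
  exact (div_mul_cancel₀ _ (pow_ne_zero _ (hF0 z))).symm

/-- Forms for `Γ₀(N)⁺` without zeros in the upper half-plane are multiplicatively dependent. -/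
theorem exists_pow_eq_mul_pow {N : ℕ} (hN : Squarefree N) {f F : ℍ → ℂ} {k l : ℕ}
    (hf : Gamma0Plus N ≤ slashStabilizer f k) (hF : Gamma0Plus N ≤ slashStabilizer F l)
    (hfa : QAnalytic f) (hFa : QAnalytic F) (hf0 : ∀ z, f z ≠ 0) (hF0 : ∀ z, F z ≠ 0) :
    ∃ c : ℂ, c ≠ 0 ∧ ∀ z, f z ^ l = c * F z ^ k := by
  obtain ⟨n, a, ha, hfn⟩ := hfa.exists_tendsto_div fun h => hf0 UpperHalfPlane.I (congrFun h _)
  obtain ⟨m, b, hb, hFm⟩ := hFa.exists_tendsto_div fun h => hF0 UpperHalfPlane.I (congrFun h _)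
  rcases le_total (m * k) (n * l) with h | h
  · obtain ⟨c, hc⟩ := exists_pow_eq_mul_pow_of_le hN hf hF hfa.mdiff hFa.mdiff hF0 hfn hFm hb h
    refine ⟨c, ?_, hc⟩
    rintro rfl
    exact pow_ne_zero l (hf0 UpperHalfPlane.I) (by simpa using hc UpperHalfPlane.I)
  · obtain ⟨c, hc⟩ := exists_pow_eq_mul_pow_of_le hN hF hf hFa.mdiff hfa.mdiff hf0 hFm hfn ha h
    have hc0 : c ≠ 0 := by
      rintro rfl
      exact pow_ne_zero k (hF0 UpperHalfPlane.I) (by simpa using hc UpperHalfPlane.I)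
    exact ⟨c⁻¹, inv_ne_zero hc0, fun z => by rw [hc z, inv_mul_cancel_left₀ hc0]⟩

theorem le_slashStabilizer_of_cuspForm {N : ℕ} {k : ℤ} (g : CuspForm (Gamma0PlusGL N) k) :
    Gamma0Plus N ≤ slashStabilizer g k := fun γ hγ =>
  g.slash_action_eq' _ ⟨γ, hγ, rfl⟩

theorem isCusp_infty_gamma0Plus {N : ℕ} (hN : 0 < N) : IsCusp OnePoint.infty (Gamma0PlusGL N) := by
  have : NeZero N := ⟨hN.ne'⟩
  refine IsCusp.mono (gamma0_le_gamma0PlusGL N) ?_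
  rw [Subgroup.IsArithmetic.isCusp_iff_isCusp_SL2Z]
  exact isCusp_SL2Z_iff.2 ⟨OnePoint.infty, rfl⟩

theorem isZeroAtImInfty_of_cuspForm {N : ℕ} (hN : 0 < N) {k : ℤ} (g : CuspForm (Gamma0PlusGL N) k) :
    IsZeroAtImInfty g :=
  OnePoint.isZeroAt_infty_iff.1 (g.zero_at_cusps' (isCusp_infty_gamma0Plus hN))

theorem vadd_one_of_invariant {N : ℕ} {f : ℍ → ℂ} {k : ℤ}
    (hf : Gamma0Plus N ≤ slashStabilizer f k) (z : ℍ) : f ((1 : ℝ) +ᵥ z) = f z := by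
  let T : SL(2, ℝ) := ⟨!![1, 1; 0, 1], by simp⟩
  have hT' : (T : Matrix (Fin 2) (Fin 2) ℝ) = (1 : ℝ) • !![1, 1; 0, 1] := by rw [one_smul]
  have hT : T ∈ Gamma0Plus N := by
    refine ⟨1, 1, 0, 1, 1, one_pos, by norm_num, one_dvd _, one_dvd _, one_dvd _, dvd_zero _, ?_⟩
    rw [hT']
    simp
  have h := congrFun (mem_slashStabilizer.1 (hf hT)) z
  rw [slash_toGL_apply, denom_of_coe_eq hT'] at h
  have h2 : SpecialLinearGroup.toGL T • z = (1 : ℝ) +ᵥ z := by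
    ext
    rw [coe_smul_of_coe_eq one_ne_zero hT', UpperHalfPlane.coe_vadd]
    simp [add_comm]
  rw [h2] at h
  simpa using h

theorem qAnalytic_of_cuspForm {N : ℕ} (hN : 0 < N) {k : ℤ} (g : CuspForm (Gamma0PlusGL N) k) :
    QAnalytic g where
  periodic := periodic_comp_ofComplex_of_vadd
    (vadd_one_of_invariant (le_slashStabilizer_of_cuspForm g))
  mdiff := g.holo'
  bdd := (isZeroAtImInfty_of_cuspForm hN g).isBoundedAtImInfty

/-- The weight of a cusp form for `Γ₀(N)⁺` without zeros in the upper half-plane is positive and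
divisible by four. -/
theorem exists_weight_eq_of_vanishesOnlyAtCusp {N : ℕ} (hN : Squarefree N) {k : ℤ}
    (g : CuspForm (Gamma0PlusGL N) k) (hg : VanishesOnlyAtCusp g) :
    ∃ n : ℕ, 0 < n ∧ 4 ∣ n ∧ k = n := by
  have hN0 : 0 < N := Nat.pos_of_ne_zero hN.ne_zero
  have hinv := le_slashStabilizer_of_cuspForm g
  have hz := isZeroAtImInfty_of_cuspForm hN0 g
  have hk : 0 < k := by
    rcases lt_trichotomy k 0 with h | h | h
    · exact absurd (eq_zero_of_invariant_of_neg hN g h hinv g.holo' hz.isBoundedAtImInfty I) (hg I)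
    · subst h
      obtain ⟨c, hc⟩ := eq_const_of_invariant hN g hinv g.holo' hz.isBoundedAtImInfty
      have h1 : Tendsto (g : ℍ → ℂ) atImInfty (𝓝 c) :=
        tendsto_const_nhds.congr fun z => (hc z).symm
      exact absurd ((hc I).trans (tendsto_nhds_unique h1 hz)) (hg I)
    · exact h
  lift k to ℕ using hk.le
  refine ⟨k, by exact_mod_cast hk, ?_, rfl⟩
  have hNR : (0 : ℝ) < N := by exact_mod_cast hN0
  have hs : Real.sqrt N ≠ 0 := (Real.sqrt_pos.2 hNR).ne'
  have hsC : (Real.sqrt N : ℂ) ≠ 0 := by exact_mod_cast hs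
  have hsN : (Real.sqrt N : ℂ) * Real.sqrt N = N := by
    rw [← Complex.ofReal_mul, Real.mul_self_sqrt hNR.le, Complex.ofReal_natCast]
  have hW : fricke N hN0 ∈ Gamma0Plus N := by
    refine ⟨0, -1, N, 0, N, by exact_mod_cast hN0, by ring, dvd_rfl, dvd_zero _, dvd_zero _,
      dvd_rfl, ?_⟩
    rw [coe_fricke]
    simp
  let z : ℍ := ⟨Complex.I / Real.sqrt N, by
    rw [Complex.div_ofReal_im, Complex.I_im]
    positivity⟩
  have hzz : (z : ℂ) = Complex.I / Real.sqrt N := rfl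
  have h1 := (slash_eq_iff g k _).1 (hinv hW) z
  have h2 : SpecialLinearGroup.toGL (fricke N hN0) • z = z := by
    ext
    rw [coe_smul_of_coe_eq (inv_ne_zero hs) (coe_fricke hN0), hzz, Complex.ofReal_natCast, ← hsN]
    have := Complex.I_ne_zero
    have hI := Complex.I_mul_I
    push_cast
    field_simp
    linear_combination (-(Real.sqrt N : ℂ)) * hI
  have h3 : denom (SpecialLinearGroup.toGL (fricke N hN0)) z = Complex.I := by
    rw [denom_of_coe_eq (coe_fricke hN0), hzz, Complex.ofReal_natCast, ← hsN]
    push_cast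
    field_simp
    simp
  rw [h2, h3] at h1
  have h4 : Complex.I ^ k = 1 := mul_right_cancel₀ (hg z) (by rw [one_mul]; exact h1.symm)
  rw [Complex.I_pow_eq_pow_mod] at h4
  have h5 : k % 4 < 4 := Nat.mod_lt _ (by norm_num)
  rw [Nat.dvd_iff_mod_eq_zero]
  interval_cases k % 4
  · rfl
  · simp [Complex.ext_iff] at h4
  · norm_num [Complex.ext_iff] at h4
  · norm_num [Complex.ext_iff] at h4

end Comparison

section Weights

variable {N : ℕ}

theorem kroneckerExponent_mul_two_pow (N : ℕ) :
    kroneckerExponent N * 2 ^ N.primeFactors.card = 2 * kroneckerWeight N := by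
  have h := kroneckerExponent_exact N
  rw [zpow_sub₀ two_ne_zero, zpow_one, zpow_natCast, div_mul_eq_mul_div, eq_div_iff (by positivity)]
    at h
  exact_mod_cast h

theorem kroneckerWeight_dvd_iff (hN : Squarefree N) {s k : ℕ}
    (h : s * 2 ^ N.primeFactors.card = 2 * k) (h4 : 4 ∣ k) :
    kroneckerWeight N ∣ k ↔ 24 ∣ s * ∑ v ∈ N.divisors, v := by
  rw [kroneckerWeight, Nat.lcm_dvd_iff, ArithmeticFunction.sigma_one_apply]
  set σ := ∑ v ∈ N.divisors, v with hσ
  set t := 24 / Nat.gcd 24 σ with ht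
  have hg : 0 < Nat.gcd 24 σ := Nat.gcd_pos_of_pos_left _ (by norm_num)
  have ht24 : t * Nat.gcd 24 σ = 24 := Nat.div_mul_cancel (Nat.gcd_dvd_left _ _)
  have h2 : 2 ∣ 2 ^ N.primeFactors.card * t := by
    by_cases h : N.primeFactors.card = 0
    · rw [Finset.card_eq_zero, Nat.primeFactors_eq_empty] at h
      have h1 : N = 1 := h.resolve_left hN.ne_zero
      subst h1
      simp [ht, hσ]
    · exact (dvd_pow_self 2 h).mul_right _
  have key : 2 ^ N.primeFactors.card * t / 2 ∣ k ↔ t ∣ s := by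
    rw [← Nat.mul_dvd_mul_iff_left two_pos, Nat.mul_div_cancel' h2, ← h, mul_comm s]
    exact Nat.mul_dvd_mul_iff_left (by positivity)
  rw [key]
  constructor
  · rintro ⟨-, hs⟩
    rw [← ht24]
    exact mul_dvd_mul hs (Nat.gcd_dvd_right _ _)
  · intro hs
    refine ⟨h4, ?_⟩
    have := Nat.gcd_dvd_right 24 σ
    have hcop : Nat.Coprime t (σ / Nat.gcd 24 σ) := Nat.coprime_div_gcd_div_gcd hg
    refine hcop.dvd_of_dvd_mul_right ?_
    refine (Nat.mul_dvd_mul_iff_right hg).1 ?_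
    rwa [ht24, mul_assoc, Nat.div_mul_cancel this]

theorem four_dvd_kroneckerWeight (N : ℕ) : 4 ∣ kroneckerWeight N := Nat.dvd_lcm_left _ _

theorem dvd_kroneckerExponent_mul (hN : Squarefree N) :
    24 ∣ kroneckerExponent N * ∑ v ∈ N.divisors, v :=
  (kroneckerWeight_dvd_iff hN (kroneckerExponent_mul_two_pow N)
    (four_dvd_kroneckerWeight N)).1 dvd_rfl

theorem kroneckerWeight_pos (hN : Squarefree N) : 0 < kroneckerWeight N := by
  refine Nat.pos_of_ne_zero fun h => ?_
  have h0 := (kroneckerWeight_dvd_iff hN (k := 2 ^ N.primeFactors.card * 24) (s := 48)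
    (by ring) (by omega)).2 (by omega)
  rw [h, zero_dvd_iff] at h0
  simp at h0

end Weights

section EtaPowers

open Function Filter Topology
open scoped Manifold

theorem exists_eq_mul_of_pow_eq {f F : ℍ → ℂ} (hf : Continuous f) (hF : Continuous F)
    (hF0 : ∀ z, F z ≠ 0) {n : ℕ} (hn : 0 < n) {c : ℂ} (h : ∀ z, f z ^ n = c * F z ^ n) :
    ∃ c' : ℂ, ∀ z, f z = c' * F z := by
  have hfin : {w : ℂ | w ^ n = c}.Finite :=
    (Polynomial.nthRoots n c).toFinset.finite_toSet.subset fun w hw => by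
      simpa [Polynomial.mem_nthRoots hn] using hw
  have hmaps : Set.MapsTo (fun z => f z / F z) Set.univ {w : ℂ | w ^ n = c} := fun z _ => by
    show (f z / F z) ^ n = c
    rw [div_pow, h, mul_div_cancel_right₀ _ (pow_ne_zero _ (hF0 z))]
  have hconst (z : ℍ) : f z / F z = f I / F I :=
    isPreconnected_univ.constant_of_mapsTo
      ⟨@Finite.instDiscreteTopology _ _ _ hfin.to_subtype⟩ (hf.div hF hF0).continuousOn hmaps
      (Set.mem_univ z) (Set.mem_univ I)
  exact ⟨f I / F I, fun z => by rw [← hconst z, div_mul_cancel₀ _ (hF0 z)]⟩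

variable {N : ℕ}

theorem etaProdPow_kroneckerExponent_invariant (hN : Squarefree N) :
    Gamma0Plus N ≤ slashStabilizer (etaProdPow N (kroneckerExponent N)) (kroneckerWeight N : ℤ) :=
  gamma0Plus_le_slashStabilizer hN
    (by rw [card_divisors_of_squarefree hN, kroneckerExponent_mul_two_pow])
    (four_dvd_kroneckerWeight N) (dvd_kroneckerExponent_mul hN)

theorem exists_order_kronecker (hN : Squarefree N) :
    ∃ m : ℕ, 24 * m = kroneckerExponent N * ∑ v ∈ N.divisors, v :=
  (dvd_kroneckerExponent_mul hN).imp fun _ h => h.symm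

/-- Forms for `Γ₀(N)⁺` without zeros whose weight is divisible by `2 ^ (r - 1)` are eta products. -/
theorem exists_eq_mul_etaProdPow (hN : Squarefree N) {g : ℍ → ℂ} {k s : ℕ}
    (hg : Gamma0Plus N ≤ slashStabilizer g k) (hq : QAnalytic g) (hg0 : ∀ z, g z ≠ 0)
    (hs : s * 2 ^ N.primeFactors.card = 2 * k) :
    ∃ c : ℂ, c ≠ 0 ∧ ∀ z, g z = c * etaProdPow N s z := by
  obtain ⟨m, hm⟩ := exists_order_kronecker hN
  obtain ⟨c, -, h⟩ := exists_pow_eq_mul_pow hN hg (etaProdPow_kroneckerExponent_invariant hN) hq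
    (qAnalytic_etaProdPow hm) hg0 (etaProdPow_ne_zero N _)
  have hexp : kroneckerExponent N * k = s * kroneckerWeight N := by
    have h2 : 0 < 2 ^ N.primeFactors.card := by positivity
    refine Nat.eq_of_mul_eq_mul_right h2 ?_
    have := kroneckerExponent_mul_two_pow N
    calc _ = kroneckerExponent N * 2 ^ N.primeFactors.card * k := by ring
      _ = kroneckerWeight N * (2 * k) := by rw [this]; ring
      _ = _ := by rw [← hs]; ring
  obtain ⟨c', hc'⟩ := exists_eq_mul_of_pow_eq hq.mdiff.continuous
    (mdifferentiable_etaProdPow N s).continuous (etaProdPow_ne_zero N s) (kroneckerWeight_pos hN)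
    (c := c) fun z => by
      rw [h z, etaProdPow, etaProdPow, ← pow_mul, ← pow_mul, hexp]
  refine ⟨c', ?_, hc'⟩
  rintro rfl
  exact hg0 I (by simpa using hc' I)

theorem dvd_of_etaProdPow_periodic {s : ℕ}
    (h : ∀ z : ℍ, etaProdPow N s ((1 : ℝ) +ᵥ z) = etaProdPow N s z) :
    24 ∣ s * ∑ v ∈ N.divisors, v := by
  have h1 (v : ℕ) (z : ℂ) : ModularForm.eta (v * (z + 1)) =
      zeta24 v * ModularForm.eta (v * z) := by
    rw [mul_add, ← eta_add_int]
    push_cast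
    rw [mul_one]
  have h2 (z : ℂ) : etaProd N (z + 1) ^ s =
      zeta24 (s * ∑ v ∈ N.divisors, (v : ℤ)) * etaProd N z ^ s := by
    rw [etaProd, etaProd, Finset.prod_congr rfl fun v _ => h1 v z, Finset.prod_mul_distrib, mul_pow,
      ← zeta24_sum, ← zeta24_mul_nat]
  have h3 := h I
  rw [etaProdPow, etaProdPow, UpperHalfPlane.coe_vadd, Complex.ofReal_one, add_comm, h2] at h3
  have h4 := dvd_of_zeta24_eq_one
    (mul_right_cancel₀ (etaProdPow_ne_zero N s I) (h3.trans (one_mul _).symm))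
  rw [← Nat.cast_sum] at h4
  exact_mod_cast h4

theorem dvd_of_eq_mul_etaProdPow {g : ℍ → ℂ} {k s : ℕ}
    (hg : Gamma0Plus N ≤ slashStabilizer g k) {c : ℂ} (hc : c ≠ 0)
    (h : ∀ z, g z = c * etaProdPow N s z) : 24 ∣ s * ∑ v ∈ N.divisors, v := by
  refine dvd_of_etaProdPow_periodic fun z => mul_left_cancel₀ hc ?_
  rw [← h, ← h, vadd_one_of_invariant hg]

/-- A power of an exceptional form is a square root of an odd power of the eta product. -/
theorem exists_sq_eq_etaProdPow (hN : Squarefree N) {g : ℍ → ℂ} {k : ℕ}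
    (hg : Gamma0Plus N ≤ slashStabilizer g k) (hq : QAnalytic g) (hg0 : ∀ z, g z ≠ 0)
    (hk : 0 < k) (h4 : 4 ∣ k) (h : ¬ 2 ^ N.primeFactors.card ∣ 2 * k) :
    ∃ (f : ℍ → ℂ) (n a m : ℕ), Gamma0Plus N ≤ slashStabilizer f (12 * n : ℕ) ∧ QAnalytic f ∧
      Odd a ∧ 24 * m = a * ∑ v ∈ N.divisors, v ∧ f ^ 2 = etaProdPow N a := by
  obtain ⟨e, b, hb, hkb⟩ := Nat.exists_eq_two_pow_mul_odd (show 2 * k ≠ 0 by omega)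
  set r := N.primeFactors.card with hr
  have he3 : 3 ≤ e := by
    have h8 : 2 ^ 3 ∣ 2 ^ e * b := by rw [← hkb]; omega
    exact (Nat.pow_dvd_pow_iff_le_right (by norm_num)).1
      (((Nat.coprime_two_left.2 hb).pow_left 3).dvd_of_dvd_mul_right h8)
  have her : e < r := by
    by_contra! hre
    exact h (hkb ▸ (pow_dvd_pow 2 hre).mul_right b)
  obtain ⟨j, hj⟩ := Nat.exists_eq_add_of_lt her
  obtain ⟨i, hi⟩ := Nat.exists_eq_add_of_le he3
  have hinv (p : ℕ) : Gamma0Plus N ≤ slashStabilizer (g ^ p) (k * p : ℕ) := fun γ hγ =>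
    pow_mem_slashStabilizer (hg hγ) p
  have hwt : k * (3 * 2 ^ j) = 12 * (2 ^ i * b * 2 ^ j) := by
    have : 2 * k = 2 * (4 * (2 ^ i * b)) := by rw [hkb, hi]; ring
    rw [Nat.eq_of_mul_eq_mul_left two_pos this]
    ring
  obtain ⟨c, hc, hcz⟩ := exists_eq_mul_etaProdPow hN (hinv (3 * 2 ^ j * 2)) (hq.pow _)
    (fun z => pow_ne_zero _ (hg0 z)) (s := 3 * b) (by
      rw [← hr, hj]
      calc _ = 2 ^ e * b * (3 * 2 ^ j * 2) := by ring
        _ = _ := by rw [← hkb]; ring)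
  obtain ⟨d, hd⟩ := IsAlgClosed.exists_pow_nat_eq c two_pos
  obtain ⟨m, hm⟩ := dvd_of_eq_mul_etaProdPow (hinv (3 * 2 ^ j * 2)) hc hcz
  have hd0 : d ≠ 0 := by
    rintro rfl
    exact hc (by simpa using hd.symm)
  refine ⟨d⁻¹ • g ^ (3 * 2 ^ j), 2 ^ i * b * 2 ^ j, 3 * b, m, ?_, (hq.pow _).smul _,
    Odd.mul (by decide) hb, hm.symm, ?_⟩
  · intro γ hγ
    have := hinv (3 * 2 ^ j) hγ
    rw [hwt, mem_slashStabilizer, slash_eq_iff] at this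
    rw [mem_slashStabilizer, slash_eq_iff]
    intro z
    simp only [Pi.smul_apply, smul_eq_mul]
    rw [this]
    ring
  · ext z
    have := hcz z
    simp only [Pi.pow_apply, Pi.smul_apply, smul_eq_mul] at this ⊢
    rw [pow_mul, ← hd] at this
    rw [mul_pow, this, ← mul_assoc, ← mul_pow, inv_mul_cancel₀ hd0, one_pow, one_mul]

end EtaPowers

section UnboundedDenominators

open PowerSeries

theorem PowerSeries.two_dvd_of_map_eq_zero {A : ℤ⟦X⟧} (h : A.map (Int.castRingHom (ZMod 2)) = 0) :
    ∃ B : ℤ⟦X⟧, A = 2 * B := by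
  have h1 (n : ℕ) : ∃ b : ℤ, A.coeff n = 2 * b := by
    have := congrArg (PowerSeries.coeff n) h
    rw [coeff_map, map_zero, eq_intCast, ZMod.intCast_zmod_eq_zero_iff_dvd] at this
    exact this
  choose b hb using h1
  refine ⟨mk b, ?_⟩
  ext n
  rw [hb, show (2 : ℤ⟦X⟧) = C 2 from (map_ofNat C 2).symm, coeff_C_mul, coeff_mk]

/-- Modulo two, a series with two consecutive lowest coefficients is not a quotient of squares. -/
theorem PowerSeries.eq_zero_of_sq_mul_eq_sq {a b u : (ZMod 2)⟦X⟧} {m : ℕ}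
    (h0 : u.coeff 0 = 1) (h1 : u.coeff 1 = 1) (h : a ^ 2 * (X ^ m * u) = b ^ 2) : a = 0 := by
  by_contra ha
  have h2 (c : (ZMod 2)⟦X⟧) : derivative (ZMod 2) (c ^ 2) = 0 := by
    rw [Derivation.leibniz_pow, ← Nat.cast_smul_eq_nsmul (ZMod 2)]
    have : ((2 : ℕ) : ZMod 2) = 0 := rfl
    rw [this, zero_smul]
  have h3 : derivative (ZMod 2) (X ^ m * u) = 0 := by
    have := congrArg (derivative (ZMod 2)) h
    rw [Derivation.leibniz, h2, h2, smul_zero, add_zero, smul_eq_mul] at this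
    exact (mul_eq_zero.1 this).resolve_left (pow_ne_zero 2 ha)
  have hm : (m : ZMod 2) = 0 := by
    rcases Nat.eq_zero_or_pos m with rfl | hm
    · simp
    · obtain ⟨j, rfl⟩ := Nat.exists_eq_add_of_lt hm
      have := congrArg (PowerSeries.coeff (0 + j)) h3
      rw [coeff_derivative, coeff_X_pow_mul', if_pos le_rfl, Nat.sub_self, h0, map_zero] at this
      push_cast at this ⊢
      simpa using this
  have h4 := congrArg (PowerSeries.coeff m) h3
  rw [coeff_derivative, coeff_X_pow_mul', if_pos (by omega), Nat.add_sub_cancel_left, h1, map_zero,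
    hm] at h4
  exact absurd h4 (by decide)

theorem PowerSeries.eq_zero_of_int_sq_mul_eq_sq {A B U : ℤ⟦X⟧} {m : ℕ}
    (h0 : U.coeff 0 = 1) (h1 : Odd (U.coeff 1)) (h : A ^ 2 * (X ^ m * U) = B ^ 2) : A = 0 := by
  have key (t : ℕ) : ∀ A B : ℤ⟦X⟧, A ^ 2 * (X ^ m * U) = B ^ 2 → ∀ n, (2 : ℤ) ^ t ∣ A.coeff n := by
    induction t with
    | zero => simp
    | succ t ih =>
      intro A B h n
      set f := PowerSeries.map (Int.castRingHom (ZMod 2)) with hf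
      have h2 := congrArg f h
      rw [map_mul, map_mul, map_pow, map_pow, map_pow, hf, map_X, ← hf] at h2
      have hA : f A = 0 := by
        refine eq_zero_of_sq_mul_eq_sq (u := f U) ?_ ?_ h2
        · rw [coeff_map, h0, map_one]
        · rw [coeff_map, eq_intCast]
          exact ZMod.intCast_eq_one_iff_odd.2 h1
      have hB : f B = 0 := by
        rw [hA, zero_pow two_ne_zero, zero_mul] at h2
        exact pow_eq_zero_iff two_ne_zero |>.1 h2.symm
      obtain ⟨A', rfl⟩ := two_dvd_of_map_eq_zero hA
      obtain ⟨B', rfl⟩ := two_dvd_of_map_eq_zero hB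
      have h4 : (4 : ℤ⟦X⟧) ≠ 0 := by
        rw [show (4 : ℤ⟦X⟧) = C 4 from (map_ofNat C 4).symm]
        exact (map_ne_zero_iff _ C_injective).2 four_ne_zero
      have := ih A' B' (mul_left_cancel₀ h4 (by linear_combination h)) n
      rw [show (2 : ℤ⟦X⟧) = C 2 from (map_ofNat C 2).symm, coeff_C_mul, pow_succ, mul_comm]
      exact mul_dvd_mul_left 2 this
  ext n
  rw [map_zero]
  by_contra hn
  set t := (A.coeff n).natAbs with ht
  have h2 := Int.natAbs_dvd_natAbs.2 (key t A B h n)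
  rw [Int.natAbs_pow] at h2
  have h3 := Nat.le_of_dvd (Int.natAbs_pos.2 hn) h2
  have h4 : t < 2 ^ t := Nat.lt_two_pow_self
  exact absurd (h4.trans_le h3) (lt_irrefl t)

theorem PowerSeries.coeff_mem_of_sq {K : Subfield ℂ} {T U : ℂ⟦X⟧} (h : T ^ 2 = U)
    (hU : ∀ n, U.coeff n ∈ K) (h0 : T.coeff 0 ≠ 0) (h0K : T.coeff 0 ∈ K) (n : ℕ) :
    T.coeff n ∈ K := by
  induction n using Nat.strong_induction_on with
  | _ n ih =>
    rcases n with _ | n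
    · exact h0K
    · have h1 : U.coeff (n + 1) = 2 * T.coeff 0 * T.coeff (n + 1) +
          ∑ k ∈ Finset.range n, T.coeff (k + 1) * T.coeff (n - k) := by
        rw [← h, sq, PowerSeries.coeff_mul, Finset.Nat.sum_antidiagonal_eq_sum_range_succ
          (fun i j => T.coeff i * T.coeff j), Nat.succ_eq_add_one, Finset.sum_range_succ,
          Finset.sum_range_succ', Nat.sub_self, Nat.sub_zero]
        simp only [Nat.add_sub_add_right]
        ring
      have h2 : T.coeff (n + 1) = (U.coeff (n + 1) -
          ∑ k ∈ Finset.range n, T.coeff (k + 1) * T.coeff (n - k)) / (2 * T.coeff 0) := by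
        rw [h1]
        field_simp
        ring
      rw [h2]
      refine K.div_mem (K.sub_mem (hU _) (K.sum_mem fun k hk => K.mul_mem (ih _ ?_) (ih _ ?_)))
        (K.mul_mem (ofNat_mem K 2) h0K)
      · have := Finset.mem_range.1 hk
        omega
      · omega

theorem PowerSeries.exists_rat_of_sq {R : ℂ⟦X⟧} {U : ℤ⟦X⟧} {m : ℕ} (h0 : U.coeff 0 = 1)
    (h : R ^ 2 = (X ^ m * U).map (Int.castRingHom ℂ)) :
    ∃ S : ℚ⟦X⟧, R = S.map (algebraMap ℚ ℂ) := by
  set f := PowerSeries.map (Int.castRingHom ℂ) with hf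
  have hU0 : (f U).coeff 0 = 1 := by rw [coeff_map, h0, map_one]
  have hUne : f U ≠ 0 := fun h => by simp [h] at hU0
  rw [map_mul, map_pow, hf, map_X, ← hf] at h
  have hR : R ≠ 0 := by
    rintro rfl
    rw [zero_pow two_ne_zero] at h
    exact mul_ne_zero (pow_ne_zero m X_ne_zero) hUne h.symm
  obtain ⟨d, T, hT0, rfl⟩ : ∃ (d : ℕ) (T : ℂ⟦X⟧), T.coeff 0 ≠ 0 ∧ R = X ^ d * T := by
    refine ⟨R.order.toNat, R.divXPowOrder, ?_, (X_pow_order_mul_divXPowOrder).symm⟩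
    rw [coeff_zero_eq_constantCoeff_apply, constantCoeff_divXPowOrder]
    exact coeff_order hR
  have hdm : 2 * d = m := by
    have h1 : ((X : ℂ⟦X⟧) ^ (2 * d) * T ^ 2).order = (2 * d : ℕ) := by
      rw [order_eq_nat]
      constructor
      · rw [coeff_X_pow_mul', if_pos le_rfl, Nat.sub_self, coeff_zero_eq_constantCoeff_apply,
          map_pow]
        exact pow_ne_zero 2 (by rwa [coeff_zero_eq_constantCoeff_apply] at hT0)
      · intro i hi
        rw [coeff_X_pow_mul', if_neg (by omega)]
    have h2 : ((X : ℂ⟦X⟧) ^ m * f U).order = m := by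
      rw [order_eq_nat]
      constructor
      · rw [coeff_X_pow_mul', if_pos le_rfl, Nat.sub_self, hU0]
        exact one_ne_zero
      · intro i hi
        rw [coeff_X_pow_mul', if_neg (by omega)]
    rw [← h, mul_pow, ← pow_mul, mul_comm d, h1] at h2
    exact_mod_cast h2
  have hTU : T ^ 2 = f U := by
    refine mul_left_cancel₀ (pow_ne_zero m X_ne_zero) ?_
    rw [← h, mul_pow, ← pow_mul, mul_comm d, hdm]
  have hT1 : T.coeff 0 = 1 ∨ T.coeff 0 = -1 := by
    rw [← sq_eq_one_iff, ← hU0, ← hTU]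
    simp
  have hmem := coeff_mem_of_sq (K := (algebraMap ℚ ℂ).fieldRange) hTU
    (fun n => ⟨U.coeff n, by simp [hf]⟩) hT0 (by
      rcases hT1 with h | h <;> rw [h]
      · exact one_mem _
      · exact neg_mem (one_mem _))
  choose s hs using hmem
  refine ⟨X ^ d * mk s, ?_⟩
  rw [map_mul, map_pow, map_X]
  congr 1
  ext n
  rw [coeff_map, coeff_mk, hs]

/-- Applying a `ℚ`-linear map to the coefficients. -/
def PowerSeries.mapLinear (φ : ℂ →ₗ[ℚ] ℚ) : ℂ⟦X⟧ →ₗ[ℚ] ℚ⟦X⟧ where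
  toFun P := mk fun n => φ (P.coeff n)
  map_add' P Q := by ext n; simp
  map_smul' c P := by ext n; simp

theorem PowerSeries.mapLinear_mul_map (φ : ℂ →ₗ[ℚ] ℚ) (P : ℂ⟦X⟧) (S : ℚ⟦X⟧) :
    mapLinear φ (P * S.map (algebraMap ℚ ℂ)) = mapLinear φ P * S := by
  ext n
  simp only [mapLinear, LinearMap.coe_mk, AddHom.coe_mk, coeff_mk, PowerSeries.coeff_mul, map_sum,
    coeff_map]
  refine Finset.sum_congr rfl fun p _ => ?_
  rw [mul_comm, ← Algebra.smul_def, map_smul, smul_eq_mul, mul_comm]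

theorem PowerSeries.exists_smul_mapLinear_eq (φ : ℂ →ₗ[ℚ] ℚ) {P : ℂ⟦X⟧}
    (hP : P ∈ Submodule.span ℂ (Set.range (PowerSeries.map (Int.castRingHom ℂ)))) :
    ∃ (D : ℤ) (A : ℤ⟦X⟧), D ≠ 0 ∧ (D : ℚ⟦X⟧) * mapLinear φ P = A.map (Int.castRingHom ℚ) := by
  suffices h : ∀ c : ℂ, ∃ (D : ℤ) (A : ℤ⟦X⟧), D ≠ 0 ∧
      (D : ℚ⟦X⟧) * mapLinear φ (c • P) = A.map (Int.castRingHom ℚ) by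
    simpa using h 1
  induction hP using Submodule.span_induction with
  | mem x hx =>
    obtain ⟨p, rfl⟩ := hx
    intro c
    refine ⟨(φ c).den, C (φ c).num * p, by exact_mod_cast (φ c).den_ne_zero, ?_⟩
    have h1 : mapLinear φ (c • p.map (Int.castRingHom ℂ)) = C (φ c) * p.map (Int.castRingHom ℚ) := by
      ext n
      simp only [mapLinear, LinearMap.coe_mk, AddHom.coe_mk, coeff_mk, coeff_smul, coeff_C_mul,
        coeff_map, eq_intCast, smul_eq_mul]
      rw [mul_comm, ← zsmul_eq_mul, map_zsmul, zsmul_eq_mul, mul_comm]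
    rw [h1, map_mul, map_C, ← mul_assoc]
    congr 1
    rw [← map_intCast (C (R := ℚ)), ← map_mul]
    congr 1
    rw [eq_intCast, Int.cast_natCast, mul_comm]
    exact Rat.mul_den_eq_num _
  | zero => exact fun c => ⟨1, 0, one_ne_zero, by simp⟩
  | add x y _ _ hx hy =>
    intro c
    obtain ⟨D, A, hD, hA⟩ := hx c
    obtain ⟨D', A', hD', hA'⟩ := hy c
    refine ⟨D * D', D' * A + D * A', mul_ne_zero hD hD', ?_⟩
    rw [smul_add, map_add, map_add, map_mul, map_mul, ← hA, ← hA', map_intCast, map_intCast]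
    push_cast
    ring
  | smul a x _ hx =>
    intro c
    rw [smul_smul]
    exact hx _

/-- The square root of an integral power series `X ^ m (1 + u X + ⋯)` with `u` odd is not a
quotient of power series with bounded denominators. -/
theorem PowerSeries.mul_sqrt_ne {R P Q : ℂ⟦X⟧} {U : ℤ⟦X⟧} {m : ℕ}
    (h0 : U.coeff 0 = 1) (h1 : Odd (U.coeff 1))
    (h : R ^ 2 = (X ^ m * U).map (Int.castRingHom ℂ))
    (hP : P ∈ Submodule.span ℂ (Set.range (PowerSeries.map (Int.castRingHom ℂ))))
    (hQ : Q ∈ Submodule.span ℂ (Set.range (PowerSeries.map (Int.castRingHom ℂ))))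
    (hP0 : P ≠ 0) : P * R ≠ Q := by
  intro hPQ
  obtain ⟨S, rfl⟩ := exists_rat_of_sq h0 h
  obtain ⟨n, hn⟩ := exists_coeff_ne_zero_iff_ne_zero.2 hP0
  obtain ⟨φ, hφ⟩ := Module.Projective.exists_dual_ne_zero ℚ hn
  obtain ⟨D, A, hD, hA⟩ := exists_smul_mapLinear_eq φ hP
  obtain ⟨D', B, hD', hB⟩ := exists_smul_mapLinear_eq φ hQ
  set f := PowerSeries.map (Int.castRingHom ℚ) with hf
  have hinj : Function.Injective f := map_injective _ Int.cast_injective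
  have hS : S ^ 2 = f (X ^ m * U) := by
    apply map_injective (algebraMap ℚ ℂ) (algebraMap ℚ ℂ).injective
    rw [map_pow, h]
    rw [hf, ← RingHom.comp_apply, ← map_comp]
    congr 2
  rw [← hPQ, mapLinear_mul_map] at hB
  have hAB : ((D' : ℤ⟦X⟧) * A) ^ 2 * (X ^ m * U) = ((D : ℤ⟦X⟧) * B) ^ 2 := by
    apply hinj
    rw [map_mul, ← hS, map_pow, map_pow, map_mul, map_mul, ← hA, ← hB, map_intCast, map_intCast]
    ring
  have hA0 := eq_zero_of_int_sq_mul_eq_sq h0 h1 hAB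
  have h2 : f A = 0 := by
    rw [(mul_eq_zero.1 hA0).resolve_left, map_zero]
    exact_mod_cast fun h => hD' (by simpa using congrArg constantCoeff h)
  rw [h2] at hA
  have h3 := congrArg (PowerSeries.coeff n) hA
  rw [← map_intCast (C (R := ℚ)), coeff_C_mul, map_zero, mul_eq_zero] at h3
  rcases h3 with h3 | h3
  · exact hD (by exact_mod_cast h3)
  · exact hφ (by simpa [mapLinear] using h3)

end UnboundedDenominators

section IntegralSpan

open PowerSeries ModularForm
open scoped Manifold

/-- The complex power series spanned by power series with integral coefficients. -/
def integralSpan : Subalgebra ℂ ℂ⟦X⟧ :=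
  Algebra.adjoin ℂ (Set.range (PowerSeries.map (Int.castRingHom ℂ)))

theorem map_mem_integralSpan (p : ℤ⟦X⟧) : p.map (Int.castRingHom ℂ) ∈ integralSpan :=
  Algebra.subset_adjoin ⟨p, rfl⟩

theorem mem_span_of_mem_integralSpan {P : ℂ⟦X⟧} (h : P ∈ integralSpan) :
    P ∈ Submodule.span ℂ (Set.range (PowerSeries.map (Int.castRingHom ℂ))) := by
  have h1 : P ∈ Subalgebra.toSubmodule integralSpan := h
  rw [integralSpan, Algebra.adjoin_eq_span] at h1
  have h2 : (Set.range (PowerSeries.map (Int.castRingHom ℂ))) =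
      (MonoidHom.mrange (PowerSeries.map (Int.castRingHom ℂ)).toMonoidHom : Set ℂ⟦X⟧) := rfl
  rw [h2, Submonoid.closure_eq] at h1
  exact h1

theorem qExpansion_discriminant_mem : qExpansion 1 ModularForm.discriminant ∈ integralSpan := by
  have h : ModularForm.discriminant = etaProdPow 1 24 := by
    ext z
    simp [ModularForm.discriminant, etaProdPow, etaProd]
  rw [h, qExpansion_etaProdPow (N := 1) (l := 24) (m := 1) (by simp)]
  exact map_mem_integralSpan _

theorem qExpansion_E_mem {k : ℕ} (hk : 3 ≤ k) (hk2 : Even k) :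
    qExpansion 1 (E hk) ∈ integralSpan := by
  have h : qExpansion 1 (E hk) = (1 : ℤ⟦X⟧).map (Int.castRingHom ℂ) +
      (-(2 * k / bernoulli k : ℂ)) • (PowerSeries.mk fun m : ℕ =>
        (ArithmeticFunction.sigma (k - 1) m : ℤ)).map (Int.castRingHom ℂ) := by
    ext m
    rw [EisensteinSeries.E_qExpansion_coeff hk hk2, map_add, coeff_smul, coeff_map, coeff_map,
      coeff_mk, coeff_one]
    rcases eq_or_ne m 0 with rfl | hm
    · simp
    · simp [hm]
  rw [h]
  exact add_mem (map_mem_integralSpan _) (Subalgebra.smul_mem _ (map_mem_integralSpan _) _)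

theorem qExpansion_mem_integralSpan (M : ℕ) : ∀ {k : ℤ}, k = ((12 * M : ℕ) : ℤ) →
    ∀ f : ModularForm 𝒮ℒ k, qExpansion 1 f ∈ integralSpan := by
  induction M with
  | zero =>
    rintro k rfl f
    obtain ⟨c, hc⟩ := ModularFormClass.levelOne_weight_zero_const f
    have h1 : (f : ℍ → ℂ) = c • 1 := by
      rw [hc]
      ext z
      simp
    rw [h1, QAnalytic.one.qExpansion_smul, qExpansion_one, ← map_one (PowerSeries.map
      (Int.castRingHom ℂ))]
    exact Subalgebra.smul_mem _ (map_mem_integralSpan 1) _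
  | succ M ih =>
    rintro k rfl f
    have hk : 3 ≤ 12 * (M + 1) := by omega
    have hk2 : Even (12 * (M + 1)) := ⟨6 * (M + 1), by ring⟩
    set c := (qExpansion 1 f).coeff 0 with hc
    set g := f - c • E hk with hg
    have hq : qExpansion 1 g = qExpansion 1 f - c • qExpansion 1 (E hk) := by
      rw [hg, FunLike.coe_sub, ModularForm.qExpansion_sub, FunLike.coe_smul,
        ModularForm.qExpansion_smul]
      all_goals simp
    have hg0 : (qExpansion 1 g).coeff 0 = 0 := by
      rw [hq, map_sub, coeff_smul, EisensteinSeries.E_qExpansion_coeff_zero hk hk2, ← hc,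
        smul_eq_mul, mul_one, sub_self]
    have h1 := qExpansion_eq_qExpansion_discriminant_mul g hg0
    have h2 := ih (by push_cast; ring) (CuspForm.discriminantEquiv (toCuspForm g hg0))
    rw [eq_sub_iff_add_eq.1 hq |>.symm]
    refine add_mem ?_ (Subalgebra.smul_mem _ (qExpansion_E_mem hk hk2) _)
    rw [h1]
    exact mul_mem qExpansion_discriminant_mem h2

/-- Level one forms, as functions: their weights are multiples of twelve here. -/
theorem qExpansion_mem_of_levelOne {f : ℍ → ℂ} {k : ℕ} (h12 : 12 ∣ k)
    (hf : ∀ (γ : SL(2, ℤ)) (z : ℍ), f (γ • z) = denom γ z ^ k * f z) (hol : MDiff f)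
    (hb : IsBoundedAtImInfty f) : QAnalytic f ∧ qExpansion 1 f ∈ integralSpan := by
  have hslash (γ : SL(2, ℤ)) : f ∣[(k : ℤ)] γ = f := by
    ext z
    rw [SL_slash_apply, hf, zpow_neg, zpow_natCast, mul_comm (_ ^ k), mul_assoc,
      mul_inv_cancel₀ (pow_ne_zero _ (denom_ne_zero _ z)), mul_one]
  let F : ModularForm 𝒮ℒ (k : ℤ) :=
    { toFun := f
      slash_action_eq' := by
        rintro _ ⟨γ, rfl⟩
        exact hslash γ
      holo' := hol
      bdd_at_cusps' := fun {c} hc => by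
        rw [Subgroup.IsArithmetic.isCusp_iff_isCusp_SL2Z] at hc
        rw [OnePoint.isBoundedAt_iff_forall_SL2Z hc]
        intro γ _
        rw [hslash γ]
        exact hb }
  obtain ⟨M, rfl⟩ := h12
  refine ⟨⟨?_, hol, hb⟩, qExpansion_mem_integralSpan M rfl F⟩
  refine periodic_comp_ofComplex_of_vadd fun z => ?_
  have := hf ModularGroup.T z
  rw [modular_T_smul, ModularGroup.denom_apply] at this
  simpa [ModularGroup.T] using this

end IntegralSpan

section Lagrange

variable {ι A : Type*} [Fintype ι] [DecidableEq ι] [CommRing A]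

/-- The coefficients of `∑ i, y i ∏ j ≠ i, (X - x j)`, from the top degree downwards. -/
def lagrangeCoeff (y x : ι → A) (k : ℕ) : A :=
  ∑ i, y i * ∑ t ∈ Finset.powersetCard k (Finset.univ.erase i), ∏ j ∈ t, -x j

theorem sum_mul_prod_erase_sub (y x : ι → A) (e : A) :
    ∑ i, y i * ∏ j ∈ Finset.univ.erase i, (e - x j) =
      ∑ k ∈ Finset.range (Fintype.card ι),
        lagrangeCoeff y x k * e ^ (Fintype.card ι - 1 - k) := by
  simp only [lagrangeCoeff, Finset.sum_mul]
  rw [Finset.sum_comm]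
  refine Finset.sum_congr rfl fun i _ => ?_
  have hc : (Finset.univ.erase i).card = Fintype.card ι - 1 := by
    rw [Finset.card_erase_of_mem (Finset.mem_univ i), Finset.card_univ]
  have hpos : 0 < Fintype.card ι := Fintype.card_pos_iff.2 ⟨i⟩
  have h1 : ∏ j ∈ Finset.univ.erase i, (e - x j) = ∏ j ∈ Finset.univ.erase i, (-x j + e) :=
    Finset.prod_congr rfl fun j _ => by ring
  rw [h1, Finset.prod_add, Finset.sum_powerset, hc, Nat.sub_add_cancel hpos, Finset.mul_sum]
  refine Finset.sum_congr rfl fun k _ => ?_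
  rw [mul_assoc, Finset.sum_mul]
  congr 1
  refine Finset.sum_congr rfl fun t ht => ?_
  obtain ⟨hts, htk⟩ := Finset.mem_powersetCard.1 ht
  rw [Finset.prod_const, Finset.card_sdiff_of_subset hts, hc, htk]

theorem sum_mul_prod_erase_self_sub (y x : ι → A) (i : ι) :
    ∑ i', y i' * ∏ j ∈ Finset.univ.erase i', (x i - x j) =
      y i * ∏ j ∈ Finset.univ.erase i, (x i - x j) := by
  refine Finset.sum_eq_single i (fun i' _ hi' => ?_) fun h => absurd (Finset.mem_univ i) h
  rw [Finset.prod_eq_zero (Finset.mem_erase.2 ⟨hi'.symm, Finset.mem_univ i⟩) (sub_self _), mul_zero]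

theorem lagrangeCoeff_mul (y x : ι → A) (a b : A) (k : ℕ) :
    lagrangeCoeff (fun i => a * y i) (fun i => b * x i) k = a * b ^ k * lagrangeCoeff y x k := by
  rw [lagrangeCoeff, lagrangeCoeff, Finset.mul_sum]
  refine Finset.sum_congr rfl fun i _ => ?_
  have : ∑ t ∈ Finset.powersetCard k (Finset.univ.erase i), ∏ j ∈ t, -(b * x j) =
      b ^ k * ∑ t ∈ Finset.powersetCard k (Finset.univ.erase i), ∏ j ∈ t, -x j := by
    rw [Finset.mul_sum]
    refine Finset.sum_congr rfl fun t ht => ?_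
    rw [← (Finset.mem_powersetCard.1 ht).2, ← Finset.prod_const, ← Finset.prod_mul_distrib]
    exact Finset.prod_congr rfl fun j _ => by ring
  rw [this]
  ring

theorem lagrangeCoeff_comp_equiv (y x : ι → A) (σ : ι ≃ ι) (k : ℕ) :
    lagrangeCoeff (y ∘ σ) (x ∘ σ) k = lagrangeCoeff y x k := by
  rw [lagrangeCoeff, lagrangeCoeff]
  conv_rhs => rw [← Equiv.sum_comp σ]
  refine Finset.sum_congr rfl fun i _ => ?_
  have : Finset.univ.erase (σ i) = (Finset.univ.erase i).map σ.toEmbedding := by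
    rw [Finset.map_erase, Finset.map_univ_equiv]
    rfl
  rw [this, Finset.powersetCard_map, Finset.sum_map]
  simp [Finset.prod_map]

theorem lagrangeCoeff_apply {α : Type*} (y x : ι → α → A) (k : ℕ) (z : α) :
    lagrangeCoeff y x k z = lagrangeCoeff (fun i => y i z) (fun i => x i z) k := by
  simp [lagrangeCoeff, Finset.sum_apply, Finset.prod_apply]

end Lagrange

section Conjugates

open Filter Topology Matrix ModularForm
open scoped Manifold PowerSeries

local notation "𝕢" => Function.Periodic.qParam

/-- The conjugates of a function under `SL(2, ℤ) / Γ₀(N)`. -/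
def conjugate (N : ℕ) (f : ℍ → ℂ) (k : ℤ) (q : SL(2, ℤ) ⧸ CongruenceSubgroup.Gamma0 N) : ℍ → ℂ :=
  f ∣[k] (q.out)⁻¹

variable {N : ℕ} {f : ℍ → ℂ} {k : ℤ}

theorem slash_eq_of_mem_gamma0 (hf : Gamma0Plus N ≤ slashStabilizer f k) {γ : SL(2, ℤ)}
    (hγ : γ ∈ CongruenceSubgroup.Gamma0 N) : f ∣[k] γ = f := by
  obtain ⟨δ, hδ, h⟩ := gamma0_le_gamma0PlusGL N ⟨γ, hγ, rfl⟩
  rw [SL_slash]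
  exact (congrArg (fun g : GL (Fin 2) ℝ => f ∣[k] g) h.symm).trans (hf hδ)

theorem conjugate_mk (hf : Gamma0Plus N ≤ slashStabilizer f k) (γ : SL(2, ℤ)) :
    conjugate N f k (γ : SL(2, ℤ) ⧸ CongruenceSubgroup.Gamma0 N) = f ∣[k] γ⁻¹ := by
  obtain ⟨h, hh⟩ := QuotientGroup.mk_out_eq_mul (CongruenceSubgroup.Gamma0 N) γ
  rw [conjugate, hh, _root_.mul_inv_rev, SlashAction.slash_mul, slash_eq_of_mem_gamma0 hf (inv_mem h.2)]

theorem conjugate_slash (hf : Gamma0Plus N ≤ slashStabilizer f k) (γ : SL(2, ℤ))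
    (q : SL(2, ℤ) ⧸ CongruenceSubgroup.Gamma0 N) :
    conjugate N f k q ∣[k] γ = conjugate N f k (γ⁻¹ • q) := by
  obtain ⟨δ, rfl⟩ := QuotientGroup.mk_surjective q
  rw [conjugate_mk hf, ← SlashAction.slash_mul, MulAction.Quotient.smul_coe, conjugate_mk hf]
  simp

theorem conjugate_smul {k : ℕ} (hf : Gamma0Plus N ≤ slashStabilizer f k) (γ : SL(2, ℤ)) (z : ℍ)
    (q : SL(2, ℤ) ⧸ CongruenceSubgroup.Gamma0 N) :
    conjugate N f k q (γ • z) = denom γ z ^ k * conjugate N f k (γ⁻¹ • q) z := by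
  rw [← conjugate_slash hf, SL_slash_apply, _root_.zpow_neg, zpow_natCast, mul_left_comm,
    mul_inv_cancel₀ (pow_ne_zero _ (denom_ne_zero _ z)), mul_one]

theorem pow_slash (f : ℍ → ℂ) (k n : ℕ) (γ : SL(2, ℤ)) :
    (f ^ n) ∣[((k * n : ℕ) : ℤ)] γ = (f ∣[(k : ℤ)] γ) ^ n := by
  ext z
  rw [Pi.pow_apply, SL_slash_apply, SL_slash_apply, Pi.pow_apply, mul_pow, _root_.zpow_neg,
    _root_.zpow_neg, zpow_natCast, zpow_natCast, inv_pow, pow_mul]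

theorem mdifferentiable_conjugate (hol : MDiff f)
    (q : SL(2, ℤ) ⧸ CongruenceSubgroup.Gamma0 N) : MDiff (conjugate N f k q) :=
  hol.slash k _

theorem isBoundedAtImInfty_conjugate (hN : Squarefree N)
    (hf : Gamma0Plus N ≤ slashStabilizer f k) (h : IsBoundedAtImInfty f)
    (q : SL(2, ℤ) ⧸ CongruenceSubgroup.Gamma0 N) : IsBoundedAtImInfty (conjugate N f k q) := by
  obtain ⟨U, e, j, -, -, hU, hγ⟩ := slash_mapGL_of_invariant hN hf (q.out)⁻¹
  rw [conjugate, hγ]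
  exact h.slash _ (toGL_apply_one_zero hU)

/-- The conjugates of a function whose leading exponent at `i∞` is positive are distinct. -/
theorem mem_gamma0_of_slash_eq {k : ℕ} (hN : Squarefree N)
    (hf : Gamma0Plus N ≤ slashStabilizer f k)
    {m : ℕ} (hm : 0 < m) {a : ℂ} (ha : a ≠ 0)
    (hlim : Tendsto (fun z : ℍ => f z / 𝕢 1 z ^ m) atImInfty (𝓝 a)) {γ : SL(2, ℤ)}
    (h : f ∣[(k : ℤ)] γ = f) : γ ∈ CongruenceSubgroup.Gamma0 N := by
  obtain ⟨U, e, j, he, h1, hU, hγ⟩ := slash_mapGL_of_invariant hN hf γ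
  rw [CongruenceSubgroup.Gamma0_mem, ZMod.intCast_zmod_eq_zero_iff_dvd]
  refine h1 ?_
  by_contra he1
  have heR : (0 : ℝ) < e := by exact_mod_cast he
  have heR1 : (1 : ℝ) < e := by exact_mod_cast (show 1 < e by omega)
  have hs : (Real.sqrt e)⁻¹ ≠ 0 := inv_ne_zero (Real.sqrt_pos.2 heR).ne'
  rw [hγ, slash_eq_iff] at h
  set J : ℂ := (((Real.sqrt e)⁻¹ : ℝ) : ℂ) * e with hJ
  have hJ0 : J ≠ 0 := mul_ne_zero (by exact_mod_cast hs) (by exact_mod_cast he.ne')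
  have hden (z : ℍ) : denom (SpecialLinearGroup.toGL U) z = J := by
    rw [denom_of_coe_eq hU]
    simp [hJ]
  have hcoe (z : ℍ) : ((SpecialLinearGroup.toGL U • z : ℍ) : ℂ) = (z + j) / e := by
    rw [coe_smul_of_coe_eq hs hU]
    simp
  have him (z : ℍ) : (SpecialLinearGroup.toGL U • z : ℍ).im = z.im / e := by
    rw [← coe_im, hcoe, Complex.div_natCast_im]
    simp
  have htop : Tendsto (fun z : ℍ => SpecialLinearGroup.toGL U • z) atImInfty atImInfty := by
    rw [atImInfty, tendsto_comap_iff]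
    refine (tendsto_comap.atTop_div_const heR).congr fun z => ?_
    exact (him z).symm
  have hlim2 := (hlim.div (hlim.comp htop) ha).norm
  have hr : Tendsto (fun z : ℍ => ‖𝕢 1 (z : ℂ) ^ m /
      𝕢 1 ((SpecialLinearGroup.toGL U • z : ℍ) : ℂ) ^ m‖) atImInfty (𝓝 0) := by
    have h2 : Tendsto (fun z : ℍ => Real.exp (-(2 * Real.pi * (1 - 1 / e) * m * z.im)))
        atImInfty (𝓝 0) := by
      have hpos : 0 < 2 * Real.pi * (1 - 1 / e) * m := by
        have : (0 : ℝ) < m := by exact_mod_cast hm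
        have : 0 < 1 - 1 / (e : ℝ) := by rw [sub_pos, div_lt_one heR]; exact heR1
        have := Real.pi_pos
        positivity
      exact Real.tendsto_exp_neg_atTop_nhds_zero.comp (tendsto_comap.const_mul_atTop hpos)
    refine h2.congr fun z => ?_
    rw [norm_div, norm_pow, norm_pow, Function.Periodic.norm_qParam,
      Function.Periodic.norm_qParam, coe_im, coe_im, him, ← Real.exp_nat_mul, ← Real.exp_nat_mul,
      ← Real.exp_sub]
    congr 1
    field_simp
    ring
  have h3 := (hlim2.mul hr).congr' (f₂ := fun _ => ‖(J ^ k)⁻¹‖) (by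
    have hev : ∀ᶠ z : ℍ in atImInfty, f z / 𝕢 1 z ^ m ≠ 0 := hlim.eventually_ne ha
    filter_upwards [hev] with z hz
    have hz0 : f z ≠ 0 := fun h => hz (by rw [h, zero_div])
    have hq1 : 𝕢 1 (z : ℂ) ≠ 0 := Function.Periodic.qParam_ne_zero _
    have hq2 : 𝕢 1 ((SpecialLinearGroup.toGL U • z : ℍ) : ℂ) ≠ 0 :=
      Function.Periodic.qParam_ne_zero _
    rw [← norm_mul, Pi.div_apply, Function.comp_apply, h z, hden]
    congr 1
    field_simp)
  rw [mul_zero] at h3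
  have h4 := tendsto_nhds_unique tendsto_const_nhds h3
  exact inv_ne_zero (pow_ne_zero k hJ0) (norm_eq_zero.1 h4)

/-- Functions whose `q`-expansion is spanned by integral power series. -/
def HasIntegralSpan (f : ℍ → ℂ) : Prop := QAnalytic f ∧ qExpansion 1 f ∈ integralSpan

theorem HasIntegralSpan.mul {f g : ℍ → ℂ} (hf : HasIntegralSpan f) (hg : HasIntegralSpan g) :
    HasIntegralSpan (f * g) :=
  ⟨hf.1.mul hg.1, by rw [hf.1.qExpansion_mul hg.1]; exact mul_mem hf.2 hg.2⟩

theorem HasIntegralSpan.one : HasIntegralSpan 1 :=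
  ⟨.one, by rw [qExpansion_one]; exact one_mem _⟩

theorem HasIntegralSpan.pow {f : ℍ → ℂ} (hf : HasIntegralSpan f) (n : ℕ) :
    HasIntegralSpan (f ^ n) := by
  induction n with
  | zero => simpa using HasIntegralSpan.one
  | succ n ih =>
    rw [pow_succ]
    exact ih.mul hf

theorem HasIntegralSpan.sum {ι : Type*} {s : Finset ι} {F : ι → ℍ → ℂ}
    (h : ∀ i ∈ s, HasIntegralSpan (F i)) : HasIntegralSpan (∑ i ∈ s, F i) := by
  refine Finset.sum_induction _ HasIntegralSpan (fun f g hf hg => ?_) ?_ h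
  · exact ⟨hf.1.add hg.1, by rw [hf.1.qExpansion_add hg.1]; exact add_mem hf.2 hg.2⟩
  · exact ⟨.const 0, by rw [qExpansion_zero]; exact zero_mem _⟩

section LagrangeForms

variable {ι : Type} [Fintype ι] [DecidableEq ι] [MulAction SL(2, ℤ) ι] {y x : ι → ℍ → ℂ}
  {w v : ℕ}

theorem hasIntegralSpan_lagrangeCoeff (hw : 12 ∣ w) (hv : 12 ∣ v)
    (hy : ∀ (γ : SL(2, ℤ)) z i, y i (γ • z) = denom γ z ^ w * y (γ⁻¹ • i) z)
    (hx : ∀ (γ : SL(2, ℤ)) z i, x i (γ • z) = denom γ z ^ v * x (γ⁻¹ • i) z)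
    (hy1 : ∀ i, MDiff (y i)) (hx1 : ∀ i, MDiff (x i)) (hy2 : ∀ i, IsBoundedAtImInfty (y i))
    (hx2 : ∀ i, IsBoundedAtImInfty (x i)) (k : ℕ) : HasIntegralSpan (lagrangeCoeff y x k) := by
  refine qExpansion_mem_of_levelOne (k := w + v * k) (dvd_add hw (hv.mul_right k)) ?_ ?_ ?_
  · intro γ z
    rw [lagrangeCoeff_apply, lagrangeCoeff_apply]
    simp only [hy, hx]
    rw [lagrangeCoeff_mul, pow_add, pow_mul]
    congr 1
    exact lagrangeCoeff_comp_equiv (fun i => y i z) (fun i => x i z) (MulAction.toPerm γ⁻¹) k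
  · have h1 (i : ι) : MDiff (∑ t ∈ Finset.powersetCard k (Finset.univ.erase i), ∏ j ∈ t, -x j) :=
      MDifferentiable.sum fun t _ => MDifferentiable.prod fun j _ => (hx1 j).neg
    have h2 (i : ι) : MDiff (y i * ∑ t ∈ Finset.powersetCard k (Finset.univ.erase i),
        ∏ j ∈ t, -x j) := (hy1 i).mul (h1 i)
    exact MDifferentiable.sum fun i _ => h2 i
  · exact sum_mem (S := boundedAtImInftySubalgebra ℂ) fun i _ => mul_mem (hy2 i)
      (sum_mem fun t _ => prod_mem fun j _ => neg_mem (hx2 j))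

theorem hasIntegralSpan_sum_mul_prod (hw : 12 ∣ w) (hv : 12 ∣ v)
    (hy : ∀ (γ : SL(2, ℤ)) z i, y i (γ • z) = denom γ z ^ w * y (γ⁻¹ • i) z)
    (hx : ∀ (γ : SL(2, ℤ)) z i, x i (γ • z) = denom γ z ^ v * x (γ⁻¹ • i) z)
    (hy1 : ∀ i, MDiff (y i)) (hx1 : ∀ i, MDiff (x i)) (hy2 : ∀ i, IsBoundedAtImInfty (y i))
    (hx2 : ∀ i, IsBoundedAtImInfty (x i)) (i : ι) (hi : HasIntegralSpan (x i)) :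
    HasIntegralSpan (y i * ∏ j ∈ Finset.univ.erase i, (x i - x j)) := by
  rw [← sum_mul_prod_erase_self_sub, sum_mul_prod_erase_sub]
  exact .sum fun k _ =>
    (hasIntegralSpan_lagrangeCoeff hw hv hy hx hy1 hx1 hy2 hx2 k).mul (hi.pow _)

end LagrangeForms

/-- Odd powers of the eta product have no square root among the forms for `Γ₀(N)⁺`. -/
theorem sq_ne_etaProdPow_of_odd (hN : Squarefree N) {n a m : ℕ}
    (hf : Gamma0Plus N ≤ slashStabilizer f (12 * n : ℕ)) (hq : QAnalytic f) (ha : Odd a)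
    (hm : 24 * m = a * ∑ v ∈ N.divisors, v) : f ^ 2 ≠ etaProdPow N a := by
  classical
  intro hsq
  have : NeZero N := ⟨hN.ne_zero⟩
  have := Fintype.ofFinite (SL(2, ℤ) ⧸ CongruenceSubgroup.Gamma0 N)
  set y := conjugate N f (12 * n : ℕ) with hy
  have hy1 (γ : SL(2, ℤ)) (z : ℍ) (q) : y q (γ • z) = denom γ z ^ (12 * n) * y (γ⁻¹ • q) z :=
    conjugate_smul hf γ z q
  have hy2 (q) : MDiff (y q) := mdifferentiable_conjugate hq.mdiff q
  have hy3 (q) : IsBoundedAtImInfty (y q) := isBoundedAtImInfty_conjugate hN hf hq.bdd q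
  have hx1 (γ : SL(2, ℤ)) (z : ℍ) (q) :
      (y q ^ 2) (γ • z) = denom γ z ^ (12 * n * 2) * (y (γ⁻¹ • q) ^ 2) z := by
    rw [Pi.pow_apply, Pi.pow_apply, hy1, mul_pow, ← pow_mul]
  have hx2 (q) : MDiff (y q ^ 2) := (hy2 q).pow 2
  have hx3 (q) : IsBoundedAtImInfty (y q ^ 2) :=
    pow_mem (S := boundedAtImInftySubalgebra ℂ) (hy3 q) 2
  set i : SL(2, ℤ) ⧸ CongruenceSubgroup.Gamma0 N :=
    QuotientGroup.mk (1 : SL(2, ℤ)) with hi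
  have hyi : y i = f := by
    rw [hy, hi, conjugate_mk hf, inv_one, SlashAction.slash_one]
  have hxi : HasIntegralSpan (y i ^ 2) := by
    rw [hyi, hsq]
    exact ⟨qAnalytic_etaProdPow hm, by rw [qExpansion_etaProdPow hm]; exact map_mem_integralSpan _⟩
  have h1 := hasIntegralSpan_sum_mul_prod (y := fun _ => 1) (w := 0) (dvd_zero _)
    ((dvd_mul_right 12 n).mul_right 2) (fun _ _ _ => by simp) hx1
    (fun _ => QAnalytic.one.mdiff) hx2 (fun _ => QAnalytic.one.bdd) hx3 i hxi
  have h2 := hasIntegralSpan_sum_mul_prod (dvd_mul_right 12 n) ((dvd_mul_right 12 n).mul_right 2)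
    (fun γ z q => hy1 γ z q) hx1 hy2 hx2 hy3 hx3 i hxi
  rw [one_mul] at h1
  set D := ∏ j ∈ Finset.univ.erase i, (y i ^ 2 - y j ^ 2) with hD
  rw [hyi, mul_comm] at h2
  have hD0 : D ≠ 0 := by
    intro h0
    rw [hD, UpperHalfPlane.prod_eq_zero_iff fun j _ => (hx2 i).sub (hx2 j)] at h0
    obtain ⟨j, hj, hj0⟩ := h0
    refine (Finset.mem_erase.1 hj).1 ?_
    obtain ⟨γ, rfl⟩ := QuotientGroup.mk_surjective j
    rw [sub_eq_zero, hyi, hy, conjugate_mk hf] at hj0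
    have hm0 : 0 < m := by
      have h1 : 0 < ∑ v ∈ N.divisors, v := Finset.sum_pos
        (fun v hv => Nat.pos_of_mem_divisors hv) ⟨1, Nat.one_mem_divisors.2 hN.ne_zero⟩
      have := Nat.mul_pos ha.pos h1
      omega
    have hslash : (f ^ 2) ∣[((12 * n * 2 : ℕ) : ℤ)] γ⁻¹ = f ^ 2 := by
      rw [pow_slash, ← hj0]
    have hγ := mem_gamma0_of_slash_eq hN (fun _ hγ => pow_mem_slashStabilizer (hf hγ) 2) hm0
      one_ne_zero (hsq ▸ tendsto_etaProdPow_div hm) hslash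
    rw [hi, QuotientGroup.eq, mul_one]
    exact hγ
  refine PowerSeries.mul_sqrt_ne (R := qExpansion 1 f) (m := m) (coeff_zero_eulerProdSeries N a)
    ?_ ?_ (mem_span_of_mem_integralSpan h1.2) (mem_span_of_mem_integralSpan h2.2) ?_
    (h1.1.qExpansion_mul hq).symm
  · rw [coeff_one_eulerProdSeries hN.ne_zero, odd_neg]
    exact_mod_cast ha
  · rw [← hq.qExpansion_pow, hsq, qExpansion_etaProdPow hm]
  · exact fun h => hD0 (h1.1.eq_zero_of_qExpansion h)

end Conjugates

section Main

variable {N : ℕ}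

/-- Cusp forms for `Γ₀(N)⁺` without zeros in the upper half-plane are powers of the eta product. -/
theorem exists_eq_mul_etaProdPow_of_vanishesOnlyAtCusp (hN : Squarefree N) {k : ℤ}
    (g : CuspForm (Gamma0PlusGL N) k) (hg : VanishesOnlyAtCusp g) :
    ∃ (n s : ℕ) (c : ℂ), k = n ∧ 0 < n ∧ s * 2 ^ N.primeFactors.card = 2 * n ∧
      kroneckerWeight N ∣ n ∧ ∀ z, g z = c * etaProdPow N s z := by
  obtain ⟨n, hn, h4, rfl⟩ := exists_weight_eq_of_vanishesOnlyAtCusp hN g hg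
  have hinv := le_slashStabilizer_of_cuspForm g
  have hq := qAnalytic_of_cuspForm (Nat.pos_of_ne_zero hN.ne_zero) g
  have hdvd : 2 ^ N.primeFactors.card ∣ 2 * n := by
    by_contra h
    obtain ⟨f, _, a, m, hf, hfq, ha, hm, hsq⟩ := exists_sq_eq_etaProdPow hN hinv hq hg hn h4 h
    exact sq_ne_etaProdPow_of_odd hN hf hfq ha hm hsq
  obtain ⟨s, hs⟩ := hdvd
  replace hs : s * 2 ^ N.primeFactors.card = 2 * n := by rw [hs, mul_comm]
  obtain ⟨c, hc, hcz⟩ := exists_eq_mul_etaProdPow hN hinv hq hg hs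
  exact ⟨n, s, c, rfl, hn, hs,
    (kroneckerWeight_dvd_iff hN hs h4).2 (dvd_of_eq_mul_etaProdPow hinv hc hcz), hcz⟩

end Main

end

theorem corollary3p5 (N : ℕ) (hN : Squarefree N) :
    (∃ f : CuspForm (Gamma0PlusGL N) (kroneckerWeight N : ℤ),
      (∀ z : UpperHalfPlane, f z = kroneckerLimit N z) ∧
      VanishesOnlyAtCusp f ∧
      (∀ (k : ℤ) (g : CuspForm (Gamma0PlusGL N) k),
        VanishesOnlyAtCusp g → (kroneckerWeight N : ℤ) ≤ k) ∧
      (∀ g : CuspForm (Gamma0PlusGL N) (kroneckerWeight N : ℤ),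
        VanishesOnlyAtCusp g → ∃ c : ℂ, g = c • f)) ∧
    (∃ v : ℕ, orderAtImInfty (kroneckerLimit N) = (v : ℕ∞) ∧
      (v : ℚ) = (ArithmeticFunction.sigma 1 N : ℚ) * (kroneckerExponent N : ℚ) / 24 ∧
      (v : ℚ) = (kroneckerWeight N : ℚ) *
        ((ArithmeticFunction.sigma 1 N : ℚ) /
          (24 * 2 ^ ((N.primeFactors.card : ℤ) - 1)))) := by
  obtain ⟨m, hm⟩ := exists_order_kronecker hN
  have hexp := kroneckerExponent_mul_two_pow N
  have hm0 : 0 < m := by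
    have h1 : 0 < ∑ v ∈ N.divisors, v := Finset.sum_pos
      (fun v hv => Nat.pos_of_mem_divisors hv) ⟨1, Nat.one_mem_divisors.2 hN.ne_zero⟩
    have h2 : 0 < kroneckerExponent N := by
      refine Nat.pos_of_ne_zero fun h => (kroneckerWeight_pos hN).ne' ?_
      rw [h, zero_mul] at hexp
      omega
    have := Nat.mul_pos h2 h1
    omega
  constructor
  · refine ⟨cuspFormOfInvariant hN (etaProdPow N (kroneckerExponent N)) _
      (etaProdPow_kroneckerExponent_invariant hN) (mdifferentiable_etaProdPow _ _)
      (isZeroAtImInfty_etaProdPow hm hm0), fun _ => rfl, etaProdPow_ne_zero N _, ?_, ?_⟩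
    · intro k g hg
      obtain ⟨n, s, c, rfl, hn, -, hdvd, -⟩ := exists_eq_mul_etaProdPow_of_vanishesOnlyAtCusp hN g hg
      exact_mod_cast Nat.le_of_dvd hn hdvd
    · intro g hg
      obtain ⟨n, s, c, hk, hn, hs, -, hc⟩ := exists_eq_mul_etaProdPow_of_vanishesOnlyAtCusp hN g hg
      have hkn : kroneckerWeight N = n := by exact_mod_cast hk
      have hsl : s = kroneckerExponent N :=
        Nat.eq_of_mul_eq_mul_right (Nat.two_pow_pos _) (by rw [hs, hexp, hkn])
      subst hsl
      exact ⟨c, DFunLike.ext _ _ hc⟩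
  · have hmQ : (24 : ℚ) * m = kroneckerExponent N * (ArithmeticFunction.sigma 1 N : ℚ) := by
      rw [ArithmeticFunction.sigma_one_apply]
      exact_mod_cast hm
    refine ⟨m, order_qExpansion_etaProdPow hm, ?_, ?_⟩
    · rw [eq_div_iff (by norm_num)]
      linarith
    · have hexpQ : (kroneckerExponent N : ℚ) * 2 ^ N.primeFactors.card = 2 * kroneckerWeight N := by
        exact_mod_cast hexp
      have h2 : (2 : ℚ) ^ N.primeFactors.card ≠ 0 := by positivity
      rw [zpow_sub₀ two_ne_zero, zpow_one, zpow_natCast, ← mul_div_assoc, eq_div_iff (by positivity)]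
      linear_combination (2 : ℚ) ^ N.primeFactors.card / 2 * hmQ +
        (ArithmeticFunction.sigma 1 N : ℚ) / 2 * hexpQ
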